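/- Let $p,q\ge 2$ be integers, $n=p+q$, let $\gamma=(\gamma',\gamma'')=(\gamma_1,\dots,\gamma_n)$ with all $\gamma_i>0$, $\gamma'=(\gamma_1,\dots,\gamma_p)$, $\gamma''=(\gamma_{p+1},\dots,\gamma_n)$, and write $|\gamma|=\sum_{i=1}^n\gamma_i$, $|\gamma'|=\sum_{i\le p}\gamma_i$, $|\gamma''|=\sum_{i>p}\gamma_i$, $x^\gamma=\prod_{i=1}^n x_i^{\gamma_i}$. Let $P(x)=x_1^2+\dots+x_p^2-x_{p+1}^2-\dots-x_n^2$. Test functions $\varphi$ are the smooth compactly supported complex-valued functions on the closed orthant $\{x_i\ge 0,\ i=1,\dots,n\}$ that are even in each variable (i.e. restrictions of smooth compactly supported functions on $\mathbb{R}^n$ that are even in each $x_i$); distributions are the linear forms on test functions that satisfy, for every compact $K$, a bound $|u(\varphi)|\le C\sum_{|\alpha|\le N}\sup|D^\alpha\varphi|$ for all $\varphi$ supported in $K$. For $\operatorname{Re}\lambda>-1$ let $$(P^\lambda_{\gamma,+},\varphi)_\gamma=\int_{\{x:\ x_i>0\ (i=1,\dots,n),\ P(x)>0\}}P(x)^\lambda\,\varphi(x)\,x^\gamma\,dx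 .$$ Put $(\delta_\gamma,\varphi)_\gamma=\varphi(0)$, $B_i=\frac{\partial^2}{\partial x_i^2}+\frac{\gamma_i}{x_i}\frac{\partial}{\partial x_i}$, $L_B=B_1+\dots+B_p-B_{p+1}-\dots-B_n$, and $(L_B^k\delta_\gamma,\varphi)_\gamma=(L_B^k\varphi)(0)$. Assume that $n+|\gamma|$ is not an integer or is an odd integer. Then $P^\lambda_{\gamma,+}$ extends to a meromorphic distribution-valued function of $\lambda\in\mathbb{C}$, and: (1) if $p+|\gamma'|$ is not an integer or is an odd integer, and $q+|\gamma''|$ is an even integer, then for every $k=0,1,2,\dots$ the function $P^\lambda_{\gamma,+}$ has a simple pole at $\lambda=-\frac{n+|\gamma|}{2}-k$ with the nonzero residue $$\operatorname*{res}_{\lambda=-\frac{n+|\gamma|}{2}-k}P^\lambda_{\gamma,+}=\frac{(-1)^{\frac{q+|\gamma''|}{2}}}{2^{n+2k}\,k!}\,\frac{\prod_{i=1}^n\Gamma\left(\frac{\gamma_i+1}{2}\right)}{\Gamma\left(\frac{n+|\gamma|}{2}+k\right)}\,L_B^k\delta_\gamma ;$$ (2) if $p+|\gamma'|$ is an even integer,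 then $P^\lambda_{\gamma,+}$ is regular at $\lambda=-\frac{n+|\gamma|}{2}-k$ for every $k=0,1,2,\dots$. -/

import Mathlib

open Filter Topology MeasureTheory
open scoped ContDiff

/-- Test functions on the closed orthant `{x | ∀ i, 0 ≤ x i}`: smooth up to the boundary, compactly
supported, and even with respect to each variable (all odd derivatives in `x i` vanish on the face
`x i = 0`).  Such a function is the restriction of exactly one smooth compactly supported function
on the whole space that is invariant under all the reflections `x i ↦ - x i`, and it is
represented by this even extension. -/
def EvenTestFunction (ι : Type) [Fintype ι] [DecidableEq ι] : Submodule ℂ ((ι → ℝ) → ℂ) where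
  carrier := {f | ContDiff ℝ ∞ f ∧ HasCompactSupport f ∧
    ∀ (i : ι) (x : ι → ℝ), f (Function.update x i (-x i)) = f x}
  add_mem' := by
    rintro f g ⟨hf, hf', hf''⟩ ⟨hg, hg', hg''⟩
    refine ⟨hf.add hg, hf'.add hg', fun i x => ?_⟩
    simp only [Pi.add_apply, hf'', hg'']
  zero_mem' := ⟨contDiff_const, HasCompactSupport.zero, fun _ _ => rfl⟩
  smul_mem' := by
    rintro c f ⟨hf, hf', hf''⟩
    refine ⟨contDiff_const.smul hf, hf'.smul_left (f := fun _ => c), fun i x => ?_⟩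
    simp only [Pi.smul_apply, hf'']

/-- A distribution on the closed orthant: a linear form on the test functions such that, for every
compact set `K`, there are constants `C` and `N` with
`|u(φ)| ≤ C ∑_{j ≤ N} sup |D^j φ|` for all test functions `φ` supported in `K`. -/
def IsWeightedDistribution {ι : Type} [Fintype ι] [DecidableEq ι]
    (u : EvenTestFunction ι → ℂ) : Prop :=
  IsLinearMap ℂ u ∧
    ∀ K : Set (ι → ℝ), IsCompact K → ∃ (C : ℝ) (N : ℕ), ∀ φ : EvenTestFunction ι,
      tsupport (φ : (ι → ℝ) → ℂ) ⊆ K →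
        ‖u φ‖ ≤ C * ∑ j ∈ Finset.range (N + 1),
          ⨆ x : ι → ℝ, ‖iteratedFDeriv ℝ j (φ : (ι → ℝ) → ℂ) x‖

/-- The quadratic form `P(x) = |x'|² - |x''|²`. -/
def quadForm {p q : ℕ} (x : Fin p ⊕ Fin q → ℝ) : ℝ :=
  ∑ i, x (Sum.inl i) ^ 2 - ∑ j, x (Sum.inr j) ^ 2

/-- The part of the open orthant on which `P > 0`. -/
def positivePart (p q : ℕ) : Set (Fin p ⊕ Fin q → ℝ) :=
  {x | (∀ i, 0 < x i) ∧ 0 < quadForm x}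

/-- The integrand `P(x)^λ φ(x) x^γ`. -/
noncomputable def powerIntegrand {p q : ℕ} (γ : Fin p ⊕ Fin q → ℝ) (z : ℂ)
    (φ : EvenTestFunction (Fin p ⊕ Fin q)) (x : Fin p ⊕ Fin q → ℝ) : ℂ :=
  (quadForm x : ℂ) ^ z * (φ : (Fin p ⊕ Fin q → ℝ) → ℂ) x * ((∏ i, x i ^ γ i : ℝ) : ℂ)

/-- `P` is the weighted generalized function `P^λ_{γ,+}`, as a meromorphic function of `λ ∈ ℂ`
with values in the distributions:
* for `Re λ > -1` it is given by the absolutely convergent integral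
  `∫_{P(x) > 0, x_i > 0} P(x)^λ φ(x) x^γ dx`;
* off a closed discrete set of `λ`, which does not depend on `φ`, it is a distribution, and it is
  analytic in `λ` when paired with any test function;
* paired with any test function it is meromorphic on `ℂ`.
The values of `P` at the points of the exceptional set are irrelevant. -/
def IsPowerContinuation {p q : ℕ} (γ : Fin p ⊕ Fin q → ℝ)
    (P : ℂ → EvenTestFunction (Fin p ⊕ Fin q) → ℂ) : Prop :=
  (∀ z : ℂ, -1 < z.re → ∀ φ,
    IntegrableOn (powerIntegrand γ z φ) (positivePart p q) ∧
      P z φ = ∫ x in positivePart p q, powerIntegrand γ z φ x) ∧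
  (∀ z₀ : ℂ, ∀ᶠ z in 𝓝[≠] z₀,
    IsWeightedDistribution (P z) ∧ ∀ φ, AnalyticAt ℂ (fun w => P w φ) z) ∧
  (∀ z₀ : ℂ, ∀ φ, MeromorphicAt (fun w => P w φ) z₀)

/-- The functional-valued function `P` has at `z₀` a simple pole with residue the (nonzero)
functional `R`. -/
def HasSimplePoleWithResidue {p q : ℕ} (P : ℂ → EvenTestFunction (Fin p ⊕ Fin q) → ℂ) (z₀ : ℂ)
    (R : EvenTestFunction (Fin p ⊕ Fin q) → ℂ) : Prop :=
  (∃ φ, R φ ≠ 0) ∧ ∀ φ, Tendsto (fun z => (z - z₀) * P z φ) (𝓝[≠] z₀) (𝓝 (R φ))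

/-- The functional-valued (meromorphic) function `P` is regular at `z₀`: it has no pole there, and
its regular value there is a distribution. -/
def IsRegularPoint {p q : ℕ} (P : ℂ → EvenTestFunction (Fin p ⊕ Fin q) → ℂ) (z₀ : ℂ) : Prop :=
  ∃ u : EvenTestFunction (Fin p ⊕ Fin q) → ℂ, IsWeightedDistribution u ∧
    ∀ φ, Tendsto (fun z => P z φ) (𝓝[≠] z₀) (𝓝 (u φ))

/-- The Bessel operator `∂²/∂x_i² + (c / x_i) ∂/∂x_i` on functions even in `x_i`, extended
by continuity to the face `x_i = 0`, where it equals `(1 + c) ∂²/∂x_i²`. -/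
noncomputable def besselOp {ι : Type} [DecidableEq ι] (c : ℝ) (i : ι) (f : (ι → ℝ) → ℂ)
    (x : ι → ℝ) : ℂ :=
  if x i = 0 then
    ((1 + c : ℝ) : ℂ) * iteratedDeriv 2 (fun t : ℝ => f (Function.update x i t)) 0
  else
    iteratedDeriv 2 (fun t : ℝ => f (Function.update x i t)) (x i) +
      ((c / x i : ℝ) : ℂ) * deriv (fun t : ℝ => f (Function.update x i t)) (x i)

/-- The B-ultra-hyperbolic operator `L_B = B_{x_1} + ... + B_{x_p} - B_{x_{p+1}} - ... - B_{x_n}`. -/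
noncomputable def bUltraHyperbolic {p q : ℕ} (γ : Fin p ⊕ Fin q → ℝ)
    (f : (Fin p ⊕ Fin q → ℝ) → ℂ) (x : Fin p ⊕ Fin q → ℝ) : ℂ :=
  ∑ i : Fin p, besselOp (γ (Sum.inl i)) (Sum.inl i) f x -
    ∑ j : Fin q, besselOp (γ (Sum.inr j)) (Sum.inr j) f x

/-- The functional `L_B^k δ_γ`.  The operator `L_B` is symmetric for the weighted pairing
`(f, φ)_γ = ∫ f φ x^γ dx`, so it acts on functionals by duality, and
`(L_B^k δ_γ, φ)_γ = (δ_γ, L_B^k φ)_γ = (L_B^k φ)(0)`. -/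
noncomputable def iterLBDelta {p q : ℕ} (γ : Fin p ⊕ Fin q → ℝ) (k : ℕ)
    (φ : EvenTestFunction (Fin p ⊕ Fin q)) : ℂ :=
  ((bUltraHyperbolic γ)^[k] (φ : (Fin p ⊕ Fin q → ℝ) → ℂ)) 0

/-- `p + |γ'|`. -/
def weightedDimFst {p q : ℕ} (γ : Fin p ⊕ Fin q → ℝ) : ℝ := p + ∑ i : Fin p, γ (Sum.inl i)

/-- `q + |γ''|`. -/
def weightedDimSnd {p q : ℕ} (γ : Fin p ⊕ Fin q → ℝ) : ℝ := q + ∑ j : Fin q, γ (Sum.inr j)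

/-- `n + |γ|`, where `n = p + q`. -/
def weightedDim {p q : ℕ} (γ : Fin p ⊕ Fin q → ℝ) : ℝ := ((p + q : ℕ) : ℝ) + ∑ i, γ i

/-- The real number `a` is not an integer, or it is an odd integer. -/
def NonIntegerOrOdd (a : ℝ) : Prop := (∀ m : ℤ, a ≠ m) ∨ ∃ m : ℤ, Odd m ∧ a = m

/-! Write `a`, `b`, `D` for `weightedDimFst γ`, `weightedDimSnd γ`, `weightedDim γ`, so `D = a + b`,
and `powInt γ z φ` for the defining integral.

Continuation. Integrating by parts along `x_i ∂_i` gives, for `Re z > -1`, the Bernstein-type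
identity `powInt (z+1) (L_B φ) = 4 (z+1) (z + D/2) powInt z φ` (`powInt_ultraHyperbolic`). Iterating
it and dividing defines `powCont`, whose denominators `contFactor` vanish only at negative integers
and at the points `-D/2 - j`. By the identity theorem every admissible continuation agrees with
`powCont` near each point, off that point (`IsPowerContinuation.eventuallyEq_powCont`). As `D` is
not an even integer, the two families of zeros do not meet, so the poles at `-D/2 - k` are at most
simple.

Shape of the residue. At `-D/2` the residue is a distribution. It is supported at the origin: away
from `0`, on `P > 0`, the number `|x'|²` is bounded below, so the Euler field in `x'` alone raises
the exponent at the sole cost of poles at negative integers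
(`exists_tendsto_powCont_of_zero_notMem_tsupport`). It is also invariant under dilations
(`powInt_dilate`). A distribution with both properties is a multiple `c δ_γ`
(`eq_apply_zero_mul_cutoff`), and the functional equation carries this to `-D/2 - k`, where `L_B^k
δ_γ` appears (`tendsto_powCont_shift`).

The constant. On a cutoff depending only on `(|x'|², |x''|²)` the integral is a Beta function times
a Mellin transform (`powInt_cutoff`). This yields `c` as a positive constant times `Γ(b/2) Γ(1 -
D/2) / Γ(1 - a/2)` (`tendsto_powCont_cutoff`). If `a` is even, `1/Γ(1 - a/2) = 0`; hence `c = 0`,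
the simple poles disappear, and the values left there are distributions (`isRegularPoint_powCont`).
If `b = 2m`, the reflection formula turns the quotient into `(-1)^m / Γ(D/2)` up to elementary
factors (`Gamma_quotient_of_add_even`). -/

set_option linter.unusedSectionVars false

/-! ### Smooth dependence of an integral over `[0, 1]` on a parameter. -/

section ParametricIntegral

variable {E : Type} [NormedAddCommGroup E] [NormedSpace ℝ E]

/-- Dominated differentiation under the integral. The partial derivative is continuous, hence
bounded on a closed ball times `[0, 1]`, which is compact because `E` is proper. -/
theorem hasFDerivAt_parametric_integral [ProperSpace E] {F : Type} [NormedAddCommGroup F]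
    [NormedSpace ℝ F] {G : E × ℝ → F} (hG : ContDiff ℝ 1 G) (x₀ : E) :
    HasFDerivAt (fun x => ∫ t in (0 : ℝ)..1, G (x, t))
      (∫ t in (0 : ℝ)..1, fderiv ℝ (fun x => G (x, t)) x₀) x₀ := by
  have hd : ∀ t x, HasFDerivAt (fun x => G (x, t))
      ((fderiv ℝ G (x, t)).comp (ContinuousLinearMap.inl ℝ E ℝ)) x := fun t x =>
    ((hG.differentiable one_ne_zero) (x, t)).hasFDerivAt.comp x (hasFDerivAt_prodMk_left x t)
  have hfd : ∀ t x, fderiv ℝ (fun x => G (x, t)) x =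
      (fderiv ℝ G (x, t)).comp (ContinuousLinearMap.inl ℝ E ℝ) := fun t x => (hd t x).fderiv
  have hc : Continuous fun y : E × ℝ =>
      (fderiv ℝ G y).comp (ContinuousLinearMap.inl ℝ E ℝ) :=
    (hG.continuous_fderiv one_ne_zero).clm_comp continuous_const
  obtain ⟨C, hC⟩ := ((isCompact_closedBall x₀ 1).prod (isCompact_Icc (a := (0 : ℝ)) (b := 1))
    ).exists_bound_of_continuousOn hc.continuousOn
  refine intervalIntegral.hasFDerivAt_integral_of_dominated_of_fderiv_le
    (F := fun x t => G (x, t)) (F' := fun x t => fderiv ℝ (fun x => G (x, t)) x)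
    (bound := fun _ => C) (Metric.closedBall_mem_nhds x₀ one_pos) ?_ ?_ ?_ ?_ ?_ ?_
  · refine Eventually.of_forall fun x => Continuous.aestronglyMeasurable ?_
    exact hG.continuous.comp (by fun_prop)
  · exact (hG.continuous.comp (by fun_prop : Continuous fun t : ℝ => (x₀, t))).intervalIntegrable _ _
  · simp only [hfd]
    exact (hc.comp (by fun_prop : Continuous fun t : ℝ => (x₀, t))).aestronglyMeasurable
  · refine Eventually.of_forall fun t ht x hx => ?_
    rw [hfd]
    rw [Set.uIoc_of_le zero_le_one] at ht
    exact hC (x, t) ⟨hx, ht.1.le, ht.2⟩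
  · exact intervalIntegrable_const
  · exact Eventually.of_forall fun t _ x _ => by rw [hfd]; exact hd t x

/-- The derivative is again such an integral, but with values in `E →L[ℝ] F`; the target space is
therefore quantified inside the induction. -/
theorem contDiff_parametric_integral_nat [ProperSpace E] (n : ℕ) :
    ∀ {F : Type} [NormedAddCommGroup F] [NormedSpace ℝ F] {G : E × ℝ → F},
      ContDiff ℝ n G → ContDiff ℝ n (fun x => ∫ t in (0 : ℝ)..1, G (x, t)) := by
  induction n with
  | zero =>
    intro F _ _ G hG
    have hc : Continuous G := hG.continuous
    exact contDiff_zero.2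
      (intervalIntegral.continuous_parametric_intervalIntegral_of_continuous' (f := fun x t => G (x, t))
        hc 0 1)
  | succ n ih =>
    intro F _ _ G hG
    have h1 : ContDiff ℝ 1 G := hG.of_le (by exact_mod_cast Nat.le_add_left 1 n)
    refine contDiff_succ_iff_hasFDerivAt.2
      ⟨_, ?_, fun x => hasFDerivAt_parametric_integral h1 x⟩
    have := ih (G := fun y : E × ℝ => fderiv ℝ (fun x => G (x, y.2)) y.1) ?_
    · exact this
    · refine ContDiff.fderiv (n := n) (m := (n + 1 : ℕ)) (f := fun y : E × ℝ => fun x => G (x, y.2))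
        (g := fun y => y.1) ?_ contDiff_fst (by norm_cast)
      exact hG.comp (contDiff_snd.prodMk (contDiff_snd.comp contDiff_fst))

theorem ContDiff.parametric_integral [ProperSpace E] {F : Type} [NormedAddCommGroup F]
    [NormedSpace ℝ F] {G : E × ℝ → F} (hG : ContDiff ℝ ∞ G) :
    ContDiff ℝ ∞ (fun x => ∫ t in (0 : ℝ)..1, G (x, t)) :=
  contDiff_infty.2 fun n => contDiff_parametric_integral_nat n (contDiff_infty.1 hG n)

/-- The interval has length one, so a bound uniform in `t` passes to the integral without loss;
derivatives are moved inside one at a time. -/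
theorem norm_iteratedFDeriv_parametric_integral_le [ProperSpace E] (j : ℕ) :
    ∀ {F : Type} [NormedAddCommGroup F] [NormedSpace ℝ F] {G : E × ℝ → F} {x : E} {C : ℝ},
      ContDiff ℝ ∞ G →
      (∀ t ∈ Set.Icc (0 : ℝ) 1, ‖iteratedFDeriv ℝ j (fun x => G (x, t)) x‖ ≤ C) →
      ‖iteratedFDeriv ℝ j (fun x => ∫ t in (0 : ℝ)..1, G (x, t)) x‖ ≤ C := by
  induction j with
  | zero =>
    intro F _ _ G x C hG h
    simp only [norm_iteratedFDeriv_zero] at h ⊢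
    have := intervalIntegral.norm_integral_le_of_norm_le_const (a := 0) (b := 1)
      (f := fun t => G (x, t)) (C := C) fun t ht => ?_
    · simpa using this
    · rw [Set.uIoc_of_le zero_le_one] at ht
      exact h t ⟨ht.1.le, ht.2⟩
  | succ j ih =>
    intro F _ _ G x C hG h
    rw [← norm_iteratedFDeriv_fderiv]
    have h1 : fderiv ℝ (fun x => ∫ t in (0 : ℝ)..1, G (x, t)) =
        fun x => ∫ t in (0 : ℝ)..1, fderiv ℝ (fun x => G (x, t)) x :=
      funext fun x => (hasFDerivAt_parametric_integral (hG.of_le (by exact_mod_cast le_top)) x).fderiv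
    rw [h1]
    refine ih (G := fun y : E × ℝ => fderiv ℝ (fun x => G (x, y.2)) y.1) ?_ fun t ht => ?_
    · refine ContDiff.fderiv (m := ∞) (n := ∞) (f := fun y : E × ℝ => fun x => G (x, y.2))
        (g := fun y => y.1) ?_ contDiff_fst (by norm_cast)
      exact hG.comp (contDiff_snd.prodMk (contDiff_snd.comp contDiff_fst))
    · have := h t ht
      rwa [← norm_iteratedFDeriv_fderiv] at this

theorem norm_iteratedFDeriv_comp_clm_le {F : Type} [NormedAddCommGroup F] [NormedSpace ℝ F]
    {f : E → F} (hf : ContDiff ℝ ∞ f) (T : E →L[ℝ] E) (hT : ‖T‖ ≤ 1) (j : ℕ) (x : E) :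
    ‖iteratedFDeriv ℝ j (fun y => f (T y)) x‖ ≤ ‖iteratedFDeriv ℝ j f (T x)‖ := by
  have h := T.iteratedFDeriv_comp_right hf x (i := j) (by exact_mod_cast le_top)
  rw [Function.comp_def] at h
  rw [h]
  refine (ContinuousMultilinearMap.norm_compContinuousLinearMap_le _ _).trans ?_
  exact mul_le_of_le_one_right (norm_nonneg _)
    (Finset.prod_le_one (fun _ _ => norm_nonneg _) fun _ _ => hT)

end ParametricIntegral

/-! ### Partial derivatives, parity, and the smooth quotient `(∂f/∂x_i) / x_i`. -/

section Coordinates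

variable {ι : Type} [Fintype ι] [DecidableEq ι]

/-- The partial derivative in the coordinate `i`. -/
noncomputable def partialDeriv (i : ι) (f : (ι → ℝ) → ℂ) (x : ι → ℝ) : ℂ :=
  fderiv ℝ f x (Pi.single i 1)

/-- Multiplication of the coordinate `i` by `t`. -/
noncomputable def scaleCoord (i : ι) (t : ℝ) : (ι → ℝ) →L[ℝ] (ι → ℝ) :=
  ContinuousLinearMap.pi fun j => (if j = i then t else 1) • ContinuousLinearMap.proj j

theorem scaleCoord_apply (i : ι) (t : ℝ) (x : ι → ℝ) :
    scaleCoord i t x = Function.update x i (t * x i) := by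
  ext j
  by_cases h : j = i
  · subst h; simp [scaleCoord]
  · simp [scaleCoord, h]

theorem norm_scaleCoord_le (i : ι) {t : ℝ} (ht : t ∈ Set.Icc (0 : ℝ) 1) : ‖scaleCoord i t‖ ≤ 1 := by
  refine ContinuousLinearMap.opNorm_le_bound _ zero_le_one fun x => ?_
  rw [one_mul, pi_norm_le_iff_of_nonneg (norm_nonneg _)]
  intro j
  simp only [scaleCoord, ContinuousLinearMap.coe_pi', FunLike.coe_smul, Pi.smul_apply,
    ContinuousLinearMap.proj_apply, norm_smul]
  refine le_trans (mul_le_of_le_one_left (norm_nonneg _) ?_) (norm_le_pi_norm x j)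
  split_ifs
  · rw [Real.norm_eq_abs, abs_of_nonneg ht.1]; exact ht.2
  · simp

theorem contDiff_scaleCoord_uncurry (i : ι) :
    ContDiff ℝ ∞ fun y : (ι → ℝ) × ℝ => scaleCoord i y.2 y.1 := by
  refine contDiff_pi.2 fun j => ?_
  simp only [scaleCoord, ContinuousLinearMap.coe_pi', FunLike.coe_smul, Pi.smul_apply,
    ContinuousLinearMap.proj_apply]
  split_ifs <;> fun_prop

theorem ContDiff.partialDeriv {f : (ι → ℝ) → ℂ} (hf : ContDiff ℝ ∞ f) (i : ι) :
    ContDiff ℝ ∞ (partialDeriv i f) :=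
  (hf.fderiv_right (m := ∞) (by norm_cast)).clm_apply contDiff_const

theorem norm_iteratedFDeriv_partialDeriv_le {f : (ι → ℝ) → ℂ} (hf : ContDiff ℝ ∞ f) (i : ι) (j : ℕ)
    (x : ι → ℝ) :
    ‖iteratedFDeriv ℝ j (partialDeriv i f) x‖ ≤ ‖iteratedFDeriv ℝ (j + 1) f x‖ := by
  have := norm_iteratedFDeriv_clm_apply_const (f := fderiv ℝ f) (c := (Pi.single i 1 : ι → ℝ))
    (x := x) (N := ∞) (n := j)
    (hf.fderiv_right (m := ∞) (by norm_cast)).contDiffAt (by exact_mod_cast le_top)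
  refine this.trans_eq ?_
  rw [norm_iteratedFDeriv_fderiv, Pi.norm_single, norm_one, one_mul]

theorem tsupport_partialDeriv_subset (i : ι) (f : (ι → ℝ) → ℂ) :
    tsupport (partialDeriv i f) ⊆ tsupport f :=
  tsupport_fderiv_apply_subset ℝ (Pi.single i 1)

theorem hasDerivAt_update_partialDeriv {f : (ι → ℝ) → ℂ} (hf : ContDiff ℝ ∞ f) (i : ι)
    (x : ι → ℝ) (t : ℝ) :
    HasDerivAt (fun t => f (Function.update x i t)) (partialDeriv i f (Function.update x i t)) t :=
  ((hf.differentiable (by simp)) _).hasFDerivAt.comp_hasDerivAt t (hasDerivAt_update x i t)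

/-- The function `f` gets multiplied by `s` under the reflection in the coordinate `j`. -/
def HasParity (j : ι) (s : ℝ) (f : (ι → ℝ) → ℂ) : Prop :=
  ∀ x, f (Function.update x j (-x j)) = s • f x

/-- Chain rule for the reflection, written as the linear map `scaleCoord j (-1)`; the sign changes
exactly when one differentiates in the reflected variable. -/
theorem HasParity.partialDeriv {f : (ι → ℝ) → ℂ} (hf : ContDiff ℝ ∞ f) {j : ι} {s : ℝ}
    (h : HasParity j s f) (i : ι) :
    HasParity j ((if i = j then -1 else 1) * s) (partialDeriv i f) := by
  intro x
  have hu : ∀ y : ι → ℝ, Function.update y j (-y j) = scaleCoord j (-1) y := fun y => by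
    rw [scaleCoord_apply]; simp
  have h1 : f ∘ scaleCoord j (-1) = s • f := by
    ext y; simp [← hu, h y]
  have h2 : fderiv ℝ (f ∘ scaleCoord j (-1)) x (Pi.single i 1) =
      fderiv ℝ (s • f) x (Pi.single i 1) := by rw [h1]
  rw [fderiv_comp x ((hf.differentiable (by simp)) _) (scaleCoord j (-1)).differentiableAt,
    fderiv_const_smul ((hf.differentiable (by simp)) _)] at h2
  simp only [ContinuousLinearMap.fderiv, ContinuousLinearMap.coe_comp, Function.comp_apply,
    FunLike.coe_smul, Pi.smul_apply] at h2
  rw [hu]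
  have h3 : scaleCoord j (-1) (Pi.single i 1) = (if i = j then -1 else 1 : ℝ) • Pi.single i 1 := by
    rw [scaleCoord_apply]
    ext k
    by_cases hij : i = j
    · subst hij
      by_cases hk : k = i
      · subst hk; simp
      · simp [hk]
    · by_cases hk : k = j
      · subst hk; simp [hij]
      · simp [hk, hij]
  rw [h3, map_smul] at h2
  unfold _root_.partialDeriv
  split_ifs at h2 ⊢ with hij
  · rw [mul_smul, ← h2]; simp
  · simpa using h2

/-- The quotient `(∂f/∂x_i) / x_i` for a function even in `x_i`, as a smooth function. -/
noncomputable def derivQuotient (i : ι) (f : (ι → ℝ) → ℂ) (x : ι → ℝ) : ℂ :=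
  ∫ t in (0 : ℝ)..1, partialDeriv i (partialDeriv i f) (scaleCoord i t x)

theorem contDiff_derivQuotient_integrand {f : (ι → ℝ) → ℂ} (hf : ContDiff ℝ ∞ f) (i : ι) :
    ContDiff ℝ ∞ fun y : (ι → ℝ) × ℝ =>
      partialDeriv i (partialDeriv i f) (scaleCoord i y.2 y.1) :=
  ((hf.partialDeriv i).partialDeriv i).comp (contDiff_scaleCoord_uncurry i)

theorem ContDiff.derivQuotient {f : (ι → ℝ) → ℂ} (hf : ContDiff ℝ ∞ f) (i : ι) :
    ContDiff ℝ ∞ (derivQuotient i f) :=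
  (contDiff_derivQuotient_integrand hf i).parametric_integral

/-- Fundamental theorem of calculus for `t ↦ ∂_i f` along the segment from the face `x_i = 0` to
`x`; the initial value vanishes because `∂_i f` is odd in `x_i`. -/
theorem mul_derivQuotient {f : (ι → ℝ) → ℂ} (hf : ContDiff ℝ ∞ f) {i : ι}
    (h : HasParity i 1 f) (x : ι → ℝ) :
    (x i : ℂ) * derivQuotient i f x = partialDeriv i f x := by
  have hd : ∀ t : ℝ, HasDerivAt (fun t => partialDeriv i f (scaleCoord i t x))
      ((x i : ℂ) * partialDeriv i (partialDeriv i f) (scaleCoord i t x)) t := by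
    intro t
    have h1 := (hasDerivAt_update_partialDeriv (hf.partialDeriv i) i x (t * x i)).scomp t
      ((hasDerivAt_id t).mul_const (x i))
    simpa [Function.comp_def, scaleCoord_apply, Complex.real_smul] using h1
  have h2 := intervalIntegral.integral_eq_sub_of_hasDerivAt (a := 0) (b := 1)
    (fun t _ => hd t) ?_
  · rw [intervalIntegral.integral_const_mul] at h2
    rw [derivQuotient, h2]
    have h0 : partialDeriv i f (scaleCoord i 0 x) = 0 := by
      have := h.partialDeriv hf i (scaleCoord i 0 x)
      have h4 : Function.update (scaleCoord i 0 x) i (-(scaleCoord i 0 x) i) =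
          scaleCoord i 0 x := by
        simp [scaleCoord_apply]
      rw [h4] at this
      simp only [if_true, mul_one, neg_smul, one_smul] at this
      exact self_eq_neg.1 this
    rw [h0, sub_zero, scaleCoord_apply]
    simp
  · refine Continuous.intervalIntegrable ?_ _ _
    refine continuous_const.mul ?_
    exact (contDiff_derivQuotient_integrand hf i).continuous.comp (by fun_prop : Continuous fun t : ℝ => (x, t))

theorem derivQuotient_eq_of_coord_zero (f : (ι → ℝ) → ℂ) {i : ι} {x : ι → ℝ} (h : x i = 0) :
    derivQuotient i f x = partialDeriv i (partialDeriv i f) x := by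
  have : ∀ t, scaleCoord i t x = x := fun t => by
    rw [scaleCoord_apply, h, mul_zero, ← h, Function.update_eq_self]
  simp [derivQuotient, this]

/-- The defining integral sees a whole segment, which may meet the support even when `x` does not.
Off the face one uses the quotient formula instead, and on the face the second derivative at `x`
itself. -/
theorem tsupport_derivQuotient_subset {f : (ι → ℝ) → ℂ} (hf : ContDiff ℝ ∞ f) {i : ι}
    (h : HasParity i 1 f) : tsupport (derivQuotient i f) ⊆ tsupport f := by
  refine closure_minimal (fun x hx => ?_) (isClosed_tsupport f)
  by_contra hx'
  refine hx ?_
  by_cases h0 : x i = 0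
  · rw [derivQuotient_eq_of_coord_zero f h0]
    exact image_eq_zero_of_notMem_tsupport fun h' =>
      hx' (tsupport_partialDeriv_subset i f (tsupport_partialDeriv_subset i _ h'))
  · have h1 := mul_derivQuotient hf h x
    rw [image_eq_zero_of_notMem_tsupport fun h' => hx' (tsupport_partialDeriv_subset i f h')] at h1
    exact (mul_eq_zero.1 h1).resolve_left (by exact_mod_cast h0)

theorem HasParity.derivQuotient {f : (ι → ℝ) → ℂ} (hf : ContDiff ℝ ∞ f) {j : ι}
    (h : HasParity j 1 f) (i : ι) : HasParity j 1 (derivQuotient i f) := by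
  intro x
  have h2 : HasParity j 1 (_root_.partialDeriv i (_root_.partialDeriv i f)) := by
    have := (h.partialDeriv hf i).partialDeriv (hf.partialDeriv i) i
    split_ifs at this <;> simpa using this
  rw [one_smul, _root_.derivQuotient, _root_.derivQuotient]
  congr 1
  ext t
  have h3 : scaleCoord i t (Function.update x j (-x j)) =
      Function.update (scaleCoord i t x) j (-(scaleCoord i t x) j) := by
    simp only [scaleCoord_apply]
    ext k
    by_cases hk : k = i <;> by_cases hk' : k = j
    · subst hk; subst hk'; simp
    · subst hk; simp [hk']
    · subst hk'; simp [hk]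
    · simp [hk, hk']
  rw [h3, h2, one_smul]

/-- Scaling one coordinate by `t ∈ [0, 1]` is a contraction for the sup norm. The bound on `f` is
required at all points since the integrand is evaluated along a segment. -/
theorem norm_iteratedFDeriv_derivQuotient_le {f : (ι → ℝ) → ℂ} (hf : ContDiff ℝ ∞ f) (i : ι)
    {j : ℕ} {C : ℝ} (hC : ∀ x, ‖iteratedFDeriv ℝ (j + 2) f x‖ ≤ C) (x : ι → ℝ) :
    ‖iteratedFDeriv ℝ j (derivQuotient i f) x‖ ≤ C := by
  refine norm_iteratedFDeriv_parametric_integral_le j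
    (G := fun y : (ι → ℝ) × ℝ => partialDeriv i (partialDeriv i f) (scaleCoord i y.2 y.1))
    (contDiff_derivQuotient_integrand hf i) fun t ht => ?_
  have h2 := (hf.partialDeriv i).partialDeriv i
  have h3 := norm_iteratedFDeriv_comp_clm_le h2 _ (norm_scaleCoord_le i ht) j x
  refine h3.trans ?_
  exact ((norm_iteratedFDeriv_partialDeriv_le (hf.partialDeriv i) i j _).trans
      (norm_iteratedFDeriv_partialDeriv_le hf i (j + 1) _)).trans (hC _)

/-- On the face the quotient equals the second derivative, which accounts for the factor `1 + c`
there. The operator given by cases is thereby seen to be smooth on even functions. -/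
theorem besselOp_eq {f : (ι → ℝ) → ℂ} (hf : ContDiff ℝ ∞ f) {i : ι} (h : HasParity i 1 f) (c : ℝ)
    (x : ι → ℝ) :
    besselOp c i f x = partialDeriv i (partialDeriv i f) x + c * derivQuotient i f x := by
  have h1 : deriv (fun t : ℝ => f (Function.update x i t)) =
      fun t => partialDeriv i f (Function.update x i t) :=
    funext fun t => (hasDerivAt_update_partialDeriv hf i x t).deriv
  have h2 : iteratedDeriv 2 (fun t : ℝ => f (Function.update x i t)) =
      fun t => partialDeriv i (partialDeriv i f) (Function.update x i t) := by
    rw [iteratedDeriv_succ, iteratedDeriv_one, h1]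
    exact funext fun t => (hasDerivAt_update_partialDeriv (hf.partialDeriv i) i x t).deriv
  unfold besselOp
  rw [h1, h2]
  split_ifs with h0
  · rw [derivQuotient_eq_of_coord_zero f h0]
    have h3 : Function.update x i 0 = x := by rw [← h0, Function.update_eq_self]
    simp only [h3]
    push_cast
    ring
  · simp only [Function.update_eq_self]
    rw [← mul_derivQuotient hf h x]
    have : (x i : ℂ) ≠ 0 := by exact_mod_cast h0
    push_cast
    field_simp

end Coordinates

/-! ### The Bessel operators acting on test functions. -/

section EvenTestFunction

variable {ι : Type} [Fintype ι] [DecidableEq ι]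

theorem partialDeriv_add {f g : (ι → ℝ) → ℂ} (hf : ContDiff ℝ ∞ f) (hg : ContDiff ℝ ∞ g) (i : ι) :
    partialDeriv i (f + g) = partialDeriv i f + partialDeriv i g := by
  ext x
  simp [partialDeriv, fderiv_add ((hf.differentiable (by simp)) x) ((hg.differentiable (by simp)) x)]

theorem partialDeriv_const_smul {f : (ι → ℝ) → ℂ} (hf : ContDiff ℝ ∞ f) (c : ℂ) (i : ι) :
    partialDeriv i (c • f) = c • partialDeriv i f := by
  ext x
  simp [partialDeriv, fderiv_const_smul ((hf.differentiable (by simp)) x) c]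

theorem derivQuotient_add {f g : (ι → ℝ) → ℂ} (hf : ContDiff ℝ ∞ f) (hg : ContDiff ℝ ∞ g) (i : ι) :
    derivQuotient i (f + g) = derivQuotient i f + derivQuotient i g := by
  ext x
  have hc : ∀ {f : (ι → ℝ) → ℂ}, ContDiff ℝ ∞ f → IntervalIntegrable
      (fun t => partialDeriv i (partialDeriv i f) (scaleCoord i t x)) volume 0 1 := fun hf =>
    ((contDiff_derivQuotient_integrand hf i).continuous.comp
      (by fun_prop : Continuous fun t : ℝ => (x, t))).intervalIntegrable _ _
  simp only [derivQuotient, partialDeriv_add hf hg,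
    partialDeriv_add (hf.partialDeriv i) (hg.partialDeriv i), Pi.add_apply]
  exact intervalIntegral.integral_add (hc hf) (hc hg)

theorem derivQuotient_const_smul {f : (ι → ℝ) → ℂ} (hf : ContDiff ℝ ∞ f) (c : ℂ) (i : ι) :
    derivQuotient i (c • f) = c • derivQuotient i f := by
  ext x
  simp only [derivQuotient, partialDeriv_const_smul hf,
    partialDeriv_const_smul (hf.partialDeriv i), Pi.smul_apply]
  exact intervalIntegral.integral_smul _ _

namespace EvenTestFunction

instance : CoeFun (EvenTestFunction ι) fun _ => (ι → ℝ) → ℂ := ⟨fun φ => φ.1⟩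

theorem smooth (φ : EvenTestFunction ι) : ContDiff ℝ ∞ φ := φ.2.1

theorem compactSupport (φ : EvenTestFunction ι) : HasCompactSupport φ := φ.2.2.1

theorem parity (φ : EvenTestFunction ι) (i : ι) : HasParity i 1 φ := fun x => by
  rw [one_smul]; exact φ.2.2.2 i x

/-- The Bessel operator `∂²/∂x_i² + (c / x_i) ∂/∂x_i` on test functions. -/
noncomputable def bessel (c : ℝ) (i : ι) : EvenTestFunction ι →ₗ[ℂ] EvenTestFunction ι where
  toFun φ := ⟨partialDeriv i (partialDeriv i φ) + (c : ℂ) • derivQuotient i φ,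
    (((smooth φ).partialDeriv i).partialDeriv i).add
      (((smooth φ).derivQuotient i).const_smul (c : ℂ)), by
    refine HasCompactSupport.add ?_ (HasCompactSupport.smul_left (f := fun _ => (c : ℂ)) ?_)
    · exact (compactSupport φ).of_isClosed_subset (isClosed_tsupport _)
        ((tsupport_partialDeriv_subset i _).trans (tsupport_partialDeriv_subset i _))
    · exact (compactSupport φ).of_isClosed_subset (isClosed_tsupport _)
        (tsupport_derivQuotient_subset (smooth φ) ((parity φ) i)), fun j x => by
    have h1 := (((parity φ) j).partialDeriv (smooth φ) i).partialDeriv ((smooth φ).partialDeriv i) i x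
    have h2 := ((parity φ) j).derivQuotient (smooth φ) i x
    have h3 : ((if i = j then -1 else 1) * ((if i = j then -1 else 1) * 1) : ℝ) = 1 := by
      split_ifs <;> norm_num
    rw [h3, one_smul] at h1
    rw [one_smul] at h2
    simp only [Pi.add_apply, Pi.smul_apply, h1, h2]⟩
  map_add' φ ψ := by
    apply Subtype.ext
    simp only [Submodule.coe_add]
    rw [partialDeriv_add (smooth φ) (smooth ψ),
      partialDeriv_add ((smooth φ).partialDeriv i) ((smooth ψ).partialDeriv i),
      derivQuotient_add (smooth φ) (smooth ψ), smul_add]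
    abel
  map_smul' a φ := by
    apply Subtype.ext
    simp only [Submodule.coe_smul, RingHom.id_apply]
    rw [partialDeriv_const_smul (smooth φ), partialDeriv_const_smul ((smooth φ).partialDeriv i),
      derivQuotient_const_smul (smooth φ), smul_add, smul_comm]

theorem bessel_apply (c : ℝ) (i : ι) (φ : EvenTestFunction ι) (x : ι → ℝ) :
    bessel c i φ x = partialDeriv i (partialDeriv i φ) x + c * derivQuotient i φ x := rfl

theorem tsupport_bessel_subset (c : ℝ) (i : ι) (φ : EvenTestFunction ι) :
    tsupport (bessel c i φ) ⊆ tsupport φ := by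
  refine closure_minimal (fun x hx => ?_) (isClosed_tsupport _)
  by_contra hx'
  refine hx ?_
  rw [bessel_apply,
    image_eq_zero_of_notMem_tsupport fun h => hx' (tsupport_derivQuotient_subset (smooth φ)
      ((parity φ) i) h), image_eq_zero_of_notMem_tsupport fun h => hx'
      (tsupport_partialDeriv_subset i _ (tsupport_partialDeriv_subset i _ h))]
  simp

theorem norm_iteratedFDeriv_bessel_le (c : ℝ) (i : ι) (φ : EvenTestFunction ι) {j : ℕ} {C : ℝ}
    (hC : ∀ x, ‖iteratedFDeriv ℝ (j + 2) φ x‖ ≤ C) (x : ι → ℝ) :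
    ‖iteratedFDeriv ℝ j (bessel c i φ) x‖ ≤ (1 + |c|) * C := by
  have h1 := ((smooth φ).partialDeriv i).partialDeriv i
  have h2 := (smooth φ).derivQuotient i
  have hj : (j : ℕ∞ω) ≤ ∞ := by exact_mod_cast le_top
  change ‖iteratedFDeriv ℝ j (partialDeriv i (partialDeriv i φ) + (c : ℂ) • derivQuotient i φ) x‖ ≤ _
  have h3 : ContDiffAt ℝ j ((c : ℂ) • derivQuotient i φ) x :=
    ((h2.of_le hj).const_smul (c : ℂ)).contDiffAt
  rw [iteratedFDeriv_add_apply (h1.of_le hj).contDiffAt h3,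
    iteratedFDeriv_const_smul_apply (h2.of_le hj).contDiffAt, add_mul, one_mul]
  refine (norm_add_le _ _).trans (add_le_add ?_ ?_)
  · exact ((norm_iteratedFDeriv_partialDeriv_le ((smooth φ).partialDeriv i) i j _).trans
      (norm_iteratedFDeriv_partialDeriv_le (smooth φ) i (j + 1) _)).trans (hC _)
  · rw [norm_smul, Complex.norm_real, Real.norm_eq_abs]
    exact mul_le_mul_of_nonneg_left (norm_iteratedFDeriv_derivQuotient_le (smooth φ) i hC x)
      (abs_nonneg _)

end EvenTestFunction

end EvenTestFunction

/-! ### The operator `L_B` on test functions, with supports and derivative bounds. -/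

section UltraHyperbolic

variable {p q : ℕ}

/-- The signature of the quadratic form. -/
def formSign : Fin p ⊕ Fin q → ℝ := Sum.elim (fun _ => 1) (fun _ => -1)

theorem quadForm_eq_sum (x : Fin p ⊕ Fin q → ℝ) : quadForm x = ∑ i, formSign i * x i ^ 2 := by
  simp [quadForm, formSign, Fintype.sum_sum_type, sub_eq_add_neg]

theorem formSign_mul_self (i : Fin p ⊕ Fin q) : (formSign i : ℝ) * formSign i = 1 := by
  cases i <;> simp [formSign]

theorem abs_formSign (i : Fin p ⊕ Fin q) : |(formSign i : ℝ)| = 1 := by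
  cases i <;> simp [formSign]

namespace EvenTestFunction

/-- The B-ultra-hyperbolic operator on test functions. -/
noncomputable def ultraHyperbolic (γ : Fin p ⊕ Fin q → ℝ) :
    EvenTestFunction (Fin p ⊕ Fin q) →ₗ[ℂ] EvenTestFunction (Fin p ⊕ Fin q) :=
  ∑ i, (formSign i : ℂ) • bessel (γ i) i

theorem ultraHyperbolic_apply (γ : Fin p ⊕ Fin q → ℝ) (φ : EvenTestFunction (Fin p ⊕ Fin q))
    (x : Fin p ⊕ Fin q → ℝ) :
    ultraHyperbolic γ φ x = ∑ i, (formSign i : ℂ) * bessel (γ i) i φ x := by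
  simp [ultraHyperbolic, LinearMap.sum_apply, Finset.sum_apply]

theorem coe_ultraHyperbolic (γ : Fin p ⊕ Fin q → ℝ) (φ : EvenTestFunction (Fin p ⊕ Fin q)) :
    (ultraHyperbolic γ φ : (Fin p ⊕ Fin q → ℝ) → ℂ) = bUltraHyperbolic γ φ := by
  ext x
  rw [ultraHyperbolic_apply]
  simp only [bUltraHyperbolic, besselOp_eq (smooth φ) ((parity φ) _), bessel_apply, formSign,
    Fintype.sum_sum_type, sub_eq_add_neg, Sum.elim_inl, Sum.elim_inr]
  simp only [Complex.ofReal_one, one_mul, Complex.ofReal_neg, neg_mul, Finset.sum_neg_distrib]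

theorem iterLBDelta_eq (γ : Fin p ⊕ Fin q → ℝ) (k : ℕ) (φ : EvenTestFunction (Fin p ⊕ Fin q)) :
    iterLBDelta γ k φ = (ultraHyperbolic γ ^ k) φ 0 := by
  have : ∀ k, (bUltraHyperbolic γ)^[k] (φ : (Fin p ⊕ Fin q → ℝ) → ℂ) =
      ((ultraHyperbolic γ ^ k) φ : EvenTestFunction _) := by
    intro k
    induction k with
    | zero => rfl
    | succ k ih =>
      rw [Function.iterate_succ_apply', ih, pow_succ', ← coe_ultraHyperbolic]
      rfl
  rw [iterLBDelta, this]

theorem tsupport_ultraHyperbolic_subset (γ : Fin p ⊕ Fin q → ℝ)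
    (φ : EvenTestFunction (Fin p ⊕ Fin q)) :
    tsupport (ultraHyperbolic γ φ) ⊆ tsupport φ := by
  refine closure_minimal (fun x hx => ?_) (isClosed_tsupport _)
  by_contra hx'
  refine hx ?_
  rw [ultraHyperbolic_apply]
  refine Finset.sum_eq_zero fun i _ => ?_
  rw [image_eq_zero_of_notMem_tsupport fun h => hx' (tsupport_bessel_subset _ i φ h), mul_zero]

theorem tsupport_ultraHyperbolic_pow_subset (γ : Fin p ⊕ Fin q → ℝ) (k : ℕ)
    (φ : EvenTestFunction (Fin p ⊕ Fin q)) :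
    tsupport ((ultraHyperbolic γ ^ k) φ) ⊆ tsupport φ := by
  induction k with
  | zero => rfl
  | succ k ih =>
    rw [pow_succ']
    exact (tsupport_ultraHyperbolic_subset γ _).trans ih

theorem norm_iteratedFDeriv_ultraHyperbolic_le (γ : Fin p ⊕ Fin q → ℝ)
    (φ : EvenTestFunction (Fin p ⊕ Fin q)) {j : ℕ} {C : ℝ}
    (hC : ∀ x, ‖iteratedFDeriv ℝ (j + 2) φ x‖ ≤ C) (x : Fin p ⊕ Fin q → ℝ) :
    ‖iteratedFDeriv ℝ j (ultraHyperbolic γ φ) x‖ ≤ (∑ i, (1 + |γ i|)) * C := by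
  have hj : (j : ℕ∞ω) ≤ ∞ := by exact_mod_cast le_top
  have h1 : (ultraHyperbolic γ φ : (Fin p ⊕ Fin q → ℝ) → ℂ) =
      fun x => ∑ i, ((formSign i : ℂ) • (bessel (γ i) i φ : (Fin p ⊕ Fin q → ℝ) → ℂ)) x := by
    ext x; rw [ultraHyperbolic_apply]; rfl
  have h2 : ∀ i, ContDiffAt ℝ j
      ((formSign i : ℂ) • (bessel (γ i) i φ : (Fin p ⊕ Fin q → ℝ) → ℂ)) x := fun i =>
    (((smooth (bessel (γ i) i φ)).of_le hj).const_smul (formSign i : ℂ)).contDiffAt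
  rw [h1, iteratedFDeriv_fun_sum_apply fun i _ => h2 i, Finset.sum_mul]
  refine (norm_sum_le _ _).trans (Finset.sum_le_sum fun i _ => ?_)
  rw [iteratedFDeriv_const_smul_apply ((smooth (bessel (γ i) i φ)).of_le hj).contDiffAt, norm_smul,
    Complex.norm_real, Real.norm_eq_abs, abs_formSign, one_mul]
  exact norm_iteratedFDeriv_bessel_le (γ i) i φ hC x

/-- Each application of the operator costs two derivatives, so the induction runs over all
derivative orders `j` at once and is used at `j = 0`. -/
theorem norm_ultraHyperbolic_pow_le (γ : Fin p ⊕ Fin q → ℝ) (k : ℕ)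
    (φ : EvenTestFunction (Fin p ⊕ Fin q)) {C : ℝ}
    (hC : ∀ x, ‖iteratedFDeriv ℝ (2 * k) φ x‖ ≤ C) (x : Fin p ⊕ Fin q → ℝ) :
    ‖(ultraHyperbolic γ ^ k) φ x‖ ≤ (∑ i, (1 + |γ i|)) ^ k * C := by
  have : ∀ k j : ℕ, ∀ C, (∀ x, ‖iteratedFDeriv ℝ (j + 2 * k) φ x‖ ≤ C) → ∀ x,
      ‖iteratedFDeriv ℝ j ((ultraHyperbolic γ ^ k) φ) x‖ ≤ (∑ i, (1 + |γ i|)) ^ k * C := by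
    intro k
    induction k with
    | zero => intro j C h x; simpa using h x
    | succ k ih =>
      intro j C h x
      rw [pow_succ' (ultraHyperbolic γ), pow_succ' (∑ i, (1 + |γ i|)), mul_assoc]
      refine norm_iteratedFDeriv_ultraHyperbolic_le γ _ (fun y => ih (j + 2) C ?_ y) x
      intro y
      have := h y
      rwa [show j + 2 * (k + 1) = j + 2 + 2 * k by ring] at this
  have := this k 0 C (by rw [zero_add]; exact hC) x
  rwa [norm_iteratedFDeriv_zero] at this

/-- The derivatives of a test function are bounded. -/
theorem bddAbove_norm_iteratedFDeriv {ι : Type} [Fintype ι] [DecidableEq ι]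
    (φ : EvenTestFunction ι) (j : ℕ) :
    BddAbove (Set.range fun x => ‖iteratedFDeriv ℝ j φ x‖) := by
  have hc : Continuous (iteratedFDeriv ℝ j φ) :=
    (smooth φ).continuous_iteratedFDeriv (by exact_mod_cast le_top)
  obtain ⟨C, hC⟩ := hc.bounded_above_of_compact_support ((compactSupport φ).iteratedFDeriv j)
  exact ⟨C, by rintro _ ⟨x, rfl⟩; exact hC x⟩

end EvenTestFunction

end UltraHyperbolic

/-! ### The measure `x^γ dx` and its push-forward under the squared norm. -/

section WeightMeasure

variable {ι : Type} [Fintype ι]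

/-- The weight `x^γ` on the open orthant, extended by zero. -/
noncomputable def weight (γ : ι → ℝ) (x : ι → ℝ) : ℝ := ∏ i, max (x i) 0 ^ γ i

theorem weight_nonneg (γ : ι → ℝ) (x : ι → ℝ) : 0 ≤ weight γ x :=
  Finset.prod_nonneg fun _ _ => Real.rpow_nonneg (le_max_right _ _) _

theorem continuous_weight {γ : ι → ℝ} (hγ : ∀ i, 0 < γ i) : Continuous (weight γ) :=
  continuous_finsetProd _ fun i _ =>
    ((continuous_apply i).max continuous_const).rpow_const fun _ => Or.inr (hγ i).le

theorem weight_smul (γ : ι → ℝ) {r : ℝ} (hr : 0 < r) (x : ι → ℝ) :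
    weight γ (r • x) = r ^ (∑ i, γ i) * weight γ x := by
  rw [weight, weight, Real.rpow_sum_of_pos hr, ← Finset.prod_mul_distrib]
  refine Finset.prod_congr rfl fun i _ => ?_
  rw [← Real.mul_rpow hr.le (le_max_right _ _), Pi.smul_apply, smul_eq_mul,
    mul_max_of_nonneg _ _ hr.le, mul_zero]

theorem weight_eq_zero {γ : ι → ℝ} (hγ : ∀ i, 0 < γ i) {x : ι → ℝ} {i : ι} (h : x i ≤ 0) :
    weight γ x = 0 :=
  Finset.prod_eq_zero (Finset.mem_univ i) (by rw [max_eq_right h, Real.zero_rpow (hγ i).ne'])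

theorem weight_eq_of_pos (γ : ι → ℝ) {x : ι → ℝ} (h : ∀ i, 0 < x i) :
    weight γ x = ∏ i, x i ^ γ i :=
  Finset.prod_congr rfl fun i _ => by rw [max_eq_left (h i).le]

/-- The measure `x^γ dx` on the open orthant. -/
noncomputable def weightMeasure (γ : ι → ℝ) : Measure (ι → ℝ) :=
  volume.withDensity fun x => ENNReal.ofReal (weight γ x)

theorem measurable_weight (γ : ι → ℝ) : Measurable (weight γ) :=
  Finset.measurable_prod _ fun i _ =>
    ((measurable_pi_apply i).max measurable_const).pow_const _

instance (γ : ι → ℝ) : SFinite (weightMeasure γ) := by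
  unfold weightMeasure; infer_instance

theorem integral_weightMeasure {F : Type} [NormedAddCommGroup F] [NormedSpace ℝ F] (γ : ι → ℝ)
    (f : (ι → ℝ) → F) : ∫ x, f x ∂(weightMeasure γ) = ∫ x, weight γ x • f x := by
  rw [weightMeasure, integral_withDensity_eq_integral_toReal_smul
    (measurable_weight γ).ennreal_ofReal (by simp)]
  simp [weight_nonneg]

theorem integrable_weightMeasure_iff {F : Type} [NormedAddCommGroup F] [NormedSpace ℝ F] (γ : ι → ℝ)
    (f : (ι → ℝ) → F) :
    Integrable f (weightMeasure γ) ↔ Integrable fun x => weight γ x • f x := by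
  rw [weightMeasure, integrable_withDensity_iff_integrable_smul'
    (measurable_weight γ).ennreal_ofReal (by simp)]
  simp [weight_nonneg]

/-- The homogeneous dimension of `x^γ dx`. -/
noncomputable def homDim (γ : ι → ℝ) : ℝ := Fintype.card ι + ∑ i, γ i

theorem homDim_pos [Nonempty ι] {γ : ι → ℝ} (hγ : ∀ i, 0 < γ i) : 0 < homDim γ :=
  add_pos_of_pos_of_nonneg (by exact_mod_cast Fintype.card_pos)
    (Finset.sum_nonneg fun i _ => (hγ i).le)

/-- The Jacobian contributes `r ^ (-n)` and the homogeneity of the weight contributes `r ^ (-|γ|)`.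
-/
theorem map_smul_weightMeasure (γ : ι → ℝ) {r : ℝ} (hr : 0 < r) :
    (weightMeasure γ).map (r • ·) = ENNReal.ofReal (r ^ (-homDim γ)) • weightMeasure γ := by
  have hm : Measurable fun x : ι → ℝ => r • x := measurable_const_smul r
  have hv : Measure.map (fun x : ι → ℝ => r • x) volume =
      ENNReal.ofReal (r ^ (-(Fintype.card ι : ℝ))) • volume := by
    rw [Measure.map_addHaar_smul volume hr.ne', abs_of_nonneg (by positivity), Module.finrank_pi,
      Real.rpow_neg hr.le, Real.rpow_natCast]
  refine Measure.ext_of_lintegral _ fun f hf => ?_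
  have hw : Measurable fun x : ι → ℝ => ENNReal.ofReal (weight γ x) :=
    (measurable_weight γ).ennreal_ofReal
  rw [lintegral_map hf hm, lintegral_smul_measure, weightMeasure,
    lintegral_withDensity_eq_lintegral_mul _ hw (show Measurable fun x : ι → ℝ => f (r • x) from hf.comp hm),
    lintegral_withDensity_eq_lintegral_mul _ hw hf]
  have h1 : ∀ x : ι → ℝ, ((fun x => ENNReal.ofReal (weight γ x)) * fun x => f (r • x)) x =
      ENNReal.ofReal (r ^ (-∑ i, γ i)) *
        ((fun y => ENNReal.ofReal (weight γ y)) * f) (r • x) := by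
    intro x
    simp only [Pi.mul_apply]
    rw [weight_smul γ hr, ← mul_assoc, ← ENNReal.ofReal_mul (by positivity), ← mul_assoc,
      ← Real.rpow_add hr, neg_add_cancel, Real.rpow_zero, one_mul]
  rw [lintegral_congr h1, lintegral_const_mul' _ _ ENNReal.ofReal_ne_top,
    ← lintegral_map (hw.mul hf) hm, hv, lintegral_smul_measure, smul_eq_mul, smul_eq_mul, ← mul_assoc,
    ← ENNReal.ofReal_mul (by positivity), ← Real.rpow_add hr, homDim, neg_add_rev]

/-- The sum of the squares of the coordinates. -/
def sqNorm (x : ι → ℝ) : ℝ := ∑ i, x i ^ 2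

theorem sqNorm_nonneg (x : ι → ℝ) : 0 ≤ sqNorm x := Finset.sum_nonneg fun _ _ => sq_nonneg _

theorem contDiff_sqNorm : ContDiff ℝ ∞ (sqNorm : (ι → ℝ) → ℝ) := by
  unfold sqNorm; fun_prop

theorem measurable_sqNorm : Measurable (sqNorm : (ι → ℝ) → ℝ) :=
  contDiff_sqNorm.continuous.measurable

theorem sqNorm_smul (r : ℝ) (x : ι → ℝ) : sqNorm (r • x) = r ^ 2 * sqNorm x := by
  simp [sqNorm, mul_pow, Finset.mul_sum]

theorem weightMeasure_sqNorm_lt_ne_top {γ : ι → ℝ} (hγ : ∀ i, 0 < γ i) (s : ℝ) :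
    weightMeasure γ {x | sqNorm x < s} ≠ ⊤ := by
  have hsub : {x : ι → ℝ | sqNorm x < s} ⊆ Metric.closedBall 0 (1 + |s|) := by
    intro x hx
    rw [mem_closedBall_zero_iff, pi_norm_le_iff_of_nonneg (by positivity)]
    intro i
    have h1 : x i ^ 2 ≤ sqNorm x :=
      Finset.single_le_sum (f := fun i => x i ^ 2) (fun _ _ => sq_nonneg _) (Finset.mem_univ i)
    have h2 : x i ^ 2 < s := h1.trans_lt hx
    rw [Real.norm_eq_abs]
    refine abs_le_of_sq_le_sq (h2.le.trans ?_) (by positivity)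
    nlinarith [le_abs_self s, abs_nonneg s]
  refine ne_top_of_le_ne_top ?_ (measure_mono hsub)
  obtain ⟨C, hC⟩ := (isCompact_closedBall (0 : ι → ℝ) (1 + |s|)).exists_bound_of_continuousOn
    (continuous_weight hγ).continuousOn
  rw [weightMeasure, withDensity_apply _ Metric.isClosed_closedBall.measurableSet]
  refine ne_top_of_le_ne_top ?_ (setLIntegral_mono (g := fun _ => ENNReal.ofReal C) measurable_const
    fun x hx => ENNReal.ofReal_le_ofReal ((le_abs_self _).trans (hC x hx)))
  rw [setLIntegral_const]
  exact ENNReal.mul_ne_top ENNReal.ofReal_ne_top (isCompact_closedBall _ _).measure_ne_top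

theorem weightMeasure_sqNorm_lt (γ : ι → ℝ) {s : ℝ} (hs : 0 < s) :
    weightMeasure γ {x | sqNorm x < s} =
      ENNReal.ofReal (s ^ (homDim γ / 2)) * weightMeasure γ {x | sqNorm x < 1} := by
  have hr : 0 < (s ^ (2⁻¹ : ℝ))⁻¹ := by positivity
  have h1 : weightMeasure γ {x | sqNorm x < s} =
      (weightMeasure γ).map ((s ^ (2⁻¹ : ℝ))⁻¹ • ·) {x | sqNorm x < 1} := by
    rw [Measure.map_apply (measurable_const_smul _)
      (show MeasurableSet {x : ι → ℝ | sqNorm x < 1} from measurable_sqNorm measurableSet_Iio)]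
    congr 1
    ext x
    have : (s ^ (2⁻¹ : ℝ)) ^ 2 = s := by
      rw [← Real.rpow_natCast, ← Real.rpow_mul hs.le]; norm_num
    simp only [Set.mem_ofPred_eq, Set.mem_preimage, sqNorm_smul, inv_pow, this]
    rw [inv_mul_lt_iff₀ hs, mul_one]
  rw [h1, map_smul_weightMeasure γ hr, Measure.smul_apply, smul_eq_mul]
  congr 2
  rw [← Real.rpow_neg hs.le, ← Real.rpow_mul hs.le]
  congr 1; ring

/-- The measure `u^{d/2-1} du` on the half-line. -/
noncomputable def radialMeasure (d : ℝ) : Measure ℝ :=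
  (volume.restrict (Set.Ioi 0)).withDensity fun u => ENNReal.ofReal (u ^ (d / 2 - 1))

instance (d : ℝ) : SFinite (radialMeasure d) := by
  unfold radialMeasure; infer_instance

theorem measurable_rpow_const (c : ℝ) : Measurable fun u : ℝ => ENNReal.ofReal (u ^ c) :=
  (measurable_id.pow_const c).ennreal_ofReal

theorem radialMeasure_Iio_of_pos {d s : ℝ} (hd : 0 < d) (hs : 0 < s) :
    radialMeasure d (Set.Iio s) = ENNReal.ofReal (s ^ (d / 2) / (d / 2)) := by
  rw [radialMeasure, withDensity_apply _ measurableSet_Iio, Measure.restrict_restrict measurableSet_Iio,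
    Set.inter_comm, Set.Ioi_inter_Iio, restrict_Ioo_eq_restrict_Ioc,
    ← ofReal_integral_eq_lintegral_ofReal]
  · rw [← intervalIntegral.integral_of_le hs.le, integral_rpow (Or.inl (by linarith))]
    rw [sub_add_cancel, Real.zero_rpow (by positivity), sub_zero]
  · exact (intervalIntegrable_iff_integrableOn_Ioc_of_le hs.le).1
      (intervalIntegral.intervalIntegrable_rpow' (by linarith))
  · refine (ae_restrict_iff' measurableSet_Ioc).2 (Eventually.of_forall fun u hu => ?_)
    exact Real.rpow_nonneg hu.1.le _

theorem radialMeasure_Iio_of_nonpos {d s : ℝ} (hs : s ≤ 0) : radialMeasure d (Set.Iio s) = 0 := by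
  rw [radialMeasure, withDensity_apply _ measurableSet_Iio, Measure.restrict_restrict measurableSet_Iio,
    show Set.Iio s ∩ Set.Ioi 0 = ∅ by ext u; simp; intro h; linarith]
  simp

/-- By homogeneity both measures of `Iio s` are multiples of `s ^ (d/2)`, with the constant fixed at
`s = 1`. These masses are finite, so subtraction gives equality on half-open intervals, which
determine the measure. -/
theorem map_sqNorm_weightMeasure_aux [Nonempty ι] {γ : ι → ℝ} (hγ : ∀ i, 0 < γ i) :
    (weightMeasure γ).map sqNorm =
      (ENNReal.ofReal (homDim γ / 2) * weightMeasure γ {x | sqNorm x < 1}) •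
        radialMeasure (homDim γ) := by
  have hd := homDim_pos hγ
  have hIio : ∀ s, (weightMeasure γ).map sqNorm (Set.Iio s) =
      ((ENNReal.ofReal (homDim γ / 2) * weightMeasure γ {x | sqNorm x < 1}) •
        radialMeasure (homDim γ)) (Set.Iio s) := by
    intro s
    rw [Measure.map_apply measurable_sqNorm measurableSet_Iio, Measure.smul_apply, smul_eq_mul]
    rcases le_or_gt s 0 with hs | hs
    · rw [radialMeasure_Iio_of_nonpos hs, mul_zero]
      convert measure_empty (μ := weightMeasure γ)
      ext x
      simpa using hs.trans (sqNorm_nonneg x)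
    · rw [radialMeasure_Iio_of_pos hd hs]
      change weightMeasure γ {x | sqNorm x < s} = _
      rw [weightMeasure_sqNorm_lt γ hs, mul_right_comm, ← ENNReal.ofReal_mul (by positivity)]
      congr 2
      field_simp
  have hfin : ∀ s, (weightMeasure γ).map sqNorm (Set.Iio s) ≠ ⊤ := fun s => by
    rw [Measure.map_apply measurable_sqNorm measurableSet_Iio]
    exact weightMeasure_sqNorm_lt_ne_top hγ s
  have hIco : ∀ a b : ℝ, Set.Ico a b = Set.Iio b \ Set.Iio a := fun a b => by
    ext x; simp
  refine Measure.ext_of_Ico' _ _ (fun a b _ => ?_) fun a b hab => ?_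
  · exact ne_top_of_le_ne_top (hfin b) (measure_mono fun x hx => hx.2)
  · rw [hIco, measure_sdiff (Set.Iio_subset_Iio hab.le) measurableSet_Iio.nullMeasurableSet (hfin a),
      measure_sdiff (Set.Iio_subset_Iio hab.le) measurableSet_Iio.nullMeasurableSet
        (by rw [← hIio]; exact hfin a), hIio, hIio]

theorem integral_radialMeasure {F : Type} [NormedAddCommGroup F] [NormedSpace ℝ F] (d : ℝ)
    (f : ℝ → F) : ∫ u, f u ∂(radialMeasure d) = ∫ u in Set.Ioi (0 : ℝ), u ^ (d / 2 - 1) • f u := by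
  rw [radialMeasure, integral_withDensity_eq_integral_toReal_smul (measurable_rpow_const _) (by simp)]
  refine setIntegral_congr_fun measurableSet_Ioi fun u hu => ?_
  rw [ENNReal.toReal_ofReal (Real.rpow_nonneg (le_of_lt hu) _)]

theorem integral_max_rpow_mul_exp_neg_sq {c : ℝ} (hc : 0 < c) :
    ∫ x : ℝ, max x 0 ^ c * Real.exp (-x ^ 2) = Real.Gamma ((c + 1) / 2) / 2 := by
  have h1 : ∫ x in Set.Ioi (0 : ℝ), max x 0 ^ c * Real.exp (-x ^ 2) =
      ∫ x : ℝ, max x 0 ^ c * Real.exp (-x ^ 2) := by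
    refine setIntegral_eq_integral_of_forall_compl_eq_zero fun x hx => ?_
    rw [max_eq_right (not_lt.1 hx), Real.zero_rpow hc.ne', zero_mul]
  have h2 := integral_rpow_mul_exp_neg_rpow (p := 2) (q := c) two_pos (by linarith)
  rw [← h1, div_eq_mul_one_div, mul_comm, ← h2]
  refine setIntegral_congr_fun measurableSet_Ioi fun x hx => ?_
  rw [max_eq_left (le_of_lt hx), Real.rpow_two]

/-- The ratio between the push-forward of `x^γ dx` under `|x|²` and the measure `u^{d/2-1} du`. -/
noncomputable def radialConst (γ : ι → ℝ) : ℝ :=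
  (∏ i, Real.Gamma ((γ i + 1) / 2)) / (2 ^ Fintype.card ι * Real.Gamma (homDim γ / 2))

/-- The constant, so far the mass of the unit ball, is found by integrating the Gaussian `exp
(-|x|²)` in two ways: coordinate by coordinate, and radially as a Gamma integral. -/
theorem map_sqNorm_weightMeasure [Nonempty ι] {γ : ι → ℝ} (hγ : ∀ i, 0 < γ i) :
    (weightMeasure γ).map sqNorm =
      ENNReal.ofReal (radialConst γ) • radialMeasure (homDim γ) := by
  have hd := homDim_pos hγ
  have h := map_sqNorm_weightMeasure_aux hγ
  set C := ENNReal.ofReal (homDim γ / 2) * weightMeasure γ {x | sqNorm x < 1} with hC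
  have hCt : C ≠ ⊤ := ENNReal.mul_ne_top ENNReal.ofReal_ne_top (weightMeasure_sqNorm_lt_ne_top hγ 1)
  have h1 : ∫ u, Real.exp (-u) ∂((weightMeasure γ).map sqNorm) =
      (∏ i, Real.Gamma ((γ i + 1) / 2)) / 2 ^ Fintype.card ι := by
    rw [integral_map measurable_sqNorm.aemeasurable
      (by fun_prop : Continuous fun u : ℝ => Real.exp (-u)).aestronglyMeasurable,
      integral_weightMeasure]
    have : ∀ x : ι → ℝ, weight γ x • Real.exp (-sqNorm x) =
        ∏ i, (max (x i) 0 ^ γ i * Real.exp (-x i ^ 2)) := fun x => by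
      rw [Finset.prod_mul_distrib, ← Real.exp_sum, Finset.sum_neg_distrib]; rfl
    simp_rw [this]
    rw [integral_fintype_prod_volume_eq_prod
      (f := fun i (t : ℝ) => max t 0 ^ γ i * Real.exp (-t ^ 2))]
    simp_rw [integral_max_rpow_mul_exp_neg_sq (hγ _)]
    rw [Finset.prod_div_distrib, Finset.prod_const, Finset.card_univ]
  have h2 : ∫ u, Real.exp (-u) ∂(C • radialMeasure (homDim γ)) =
      C.toReal * Real.Gamma (homDim γ / 2) := by
    rw [integral_smul_measure, integral_radialMeasure, Real.Gamma_eq_integral (by positivity),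
      smul_eq_mul]
    congr 1
    exact setIntegral_congr_fun measurableSet_Ioi fun u _ => mul_comm _ _
  rw [h, h2] at h1
  have hG : Real.Gamma (homDim γ / 2) ≠ 0 := (Real.Gamma_pos_of_pos (by positivity)).ne'
  have h3 : C.toReal = radialConst γ := by
    rw [radialConst, ← div_div, ← h1, mul_div_cancel_right₀ _ hG]
  rw [h, ← h3, ENNReal.ofReal_toReal hCt]

theorem radialConst_pos [Nonempty ι] {γ : ι → ℝ} (hγ : ∀ i, 0 < γ i) : 0 < radialConst γ := by
  have := homDim_pos hγ
  refine div_pos (Finset.prod_pos fun i _ => Real.Gamma_pos_of_pos ?_)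
    (mul_pos (by positivity) (Real.Gamma_pos_of_pos (by positivity)))
  have := hγ i
  positivity

end WeightMeasure

/-! ### Push-forward of `x^γ dx` under `x ↦ (|x'|², |x''|²)`. -/

section BipolarCoordinates

variable {p q : ℕ}

/-- The pair of squared norms `(|x'|², |x''|²)`. -/
def biSqNorm (x : Fin p ⊕ Fin q → ℝ) : ℝ × ℝ :=
  (sqNorm fun i => x (Sum.inl i), sqNorm fun j => x (Sum.inr j))

theorem contDiff_biSqNorm : ContDiff ℝ ∞ (biSqNorm : (Fin p ⊕ Fin q → ℝ) → ℝ × ℝ) :=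
  (contDiff_sqNorm.comp (contDiff_pi.2 fun _ => contDiff_apply _ _ _)).prodMk
    (contDiff_sqNorm.comp (contDiff_pi.2 fun _ => contDiff_apply _ _ _))

theorem quadForm_eq_biSqNorm (x : Fin p ⊕ Fin q → ℝ) :
    quadForm x = (biSqNorm x).1 - (biSqNorm x).2 := rfl

/-- The weight factors over the two groups of variables, so the measure is a product and each factor
can be pushed forward separately. -/
theorem map_biSqNorm_weightMeasure (hp : 0 < p) (hq : 0 < q) {γ : Fin p ⊕ Fin q → ℝ}
    (hγ : ∀ i, 0 < γ i) :
    (weightMeasure γ).map biSqNorm =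
      ENNReal.ofReal (radialConst (fun i => γ (Sum.inl i)) * radialConst fun j => γ (Sum.inr j)) •
        (radialMeasure (weightedDimFst γ)).prod (radialMeasure (weightedDimSnd γ)) := by
  have : Nonempty (Fin p) := ⟨⟨0, hp⟩⟩
  have : Nonempty (Fin q) := ⟨⟨0, hq⟩⟩
  set γ₁ : Fin p → ℝ := fun i => γ (Sum.inl i) with hγ₁
  set γ₂ : Fin q → ℝ := fun j => γ (Sum.inr j) with hγ₂
  have h1 : ∀ i, 0 < γ₁ i := fun i => hγ _
  have h2 : ∀ j, 0 < γ₂ j := fun j => hγ _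
  have hd1 : homDim γ₁ = weightedDimFst γ := by simp [homDim, weightedDimFst, hγ₁]
  have hd2 : homDim γ₂ = weightedDimSnd γ := by simp [homDim, weightedDimSnd, hγ₂]
  let e := MeasurableEquiv.sumPiEquivProdPi (fun _ : Fin p ⊕ Fin q => ℝ)
  have he : MeasurePreserving e := volume_measurePreserving_sumPiEquivProdPi _
  have hw : (weightMeasure γ).map e = (weightMeasure γ₁).prod (weightMeasure γ₂) := by
    rw [weightMeasure, weightMeasure, weightMeasure, prod_withDensity
      (measurable_weight _).ennreal_ofReal (measurable_weight _).ennreal_ofReal]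
    refine Measure.ext_of_lintegral _ fun f hf => ?_
    have hm : Measurable fun z : (Fin p → ℝ) × (Fin q → ℝ) =>
        ENNReal.ofReal (weight γ₁ z.1) * ENNReal.ofReal (weight γ₂ z.2) :=
      ((measurable_weight _).comp measurable_fst).ennreal_ofReal.mul
        ((measurable_weight _).comp measurable_snd).ennreal_ofReal
    rw [lintegral_map hf e.measurable, lintegral_withDensity_eq_lintegral_mul _
      (measurable_weight _).ennreal_ofReal (show Measurable fun x => f (e x) from hf.comp e.measurable),
      lintegral_withDensity_eq_lintegral_mul _ hm hf]
    change _ = ∫⁻ a, _ ∂(volume : Measure ((Fin p → ℝ) × (Fin q → ℝ)))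
    rw [← he.lintegral_comp (hm.mul hf)]
    refine lintegral_congr fun x => ?_
    simp only [Pi.mul_apply]
    congr 1
    rw [← ENNReal.ofReal_mul (weight_nonneg _ _)]
    congr 1
    simp [weight, Fintype.prod_sum_type, e, MeasurableEquiv.coe_sumPiEquivProdPi,
      Equiv.sumPiEquivProdPi, hγ₁, hγ₂]
  have hb : (biSqNorm : (Fin p ⊕ Fin q → ℝ) → ℝ × ℝ) = Prod.map sqNorm sqNorm ∘ e := rfl
  rw [hb, ← Measure.map_map (measurable_sqNorm.prodMap measurable_sqNorm) e.measurable, hw,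
    ← Measure.map_prod_map _ _ measurable_sqNorm measurable_sqNorm, map_sqNorm_weightMeasure h1,
    map_sqNorm_weightMeasure h2, Measure.prod_smul_left, Measure.prod_smul_right, smul_smul,
    ← ENNReal.ofReal_mul (radialConst_pos h1).le, hd1, hd2]

end BipolarCoordinates

/-! ### Truncated powers and their integrals against the radial measures. -/

section TruncatedPower

/-- The truncated power `t_+^z`. -/
noncomputable def posPow (z : ℂ) (t : ℝ) : ℂ := if 0 < t then (t : ℂ) ^ z else 0

/-- The derivative `t_+^z log t` of the truncated power with respect to the exponent. -/
noncomputable def posPowLog (z : ℂ) (t : ℝ) : ℂ := if 0 < t then (t : ℂ) ^ z * Real.log t else 0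

/-- The truncated power with a real exponent. -/
noncomputable def posRpow (s t : ℝ) : ℝ := if 0 < t then t ^ s else 0

theorem posRpow_nonneg (s t : ℝ) : 0 ≤ posRpow s t := by
  unfold posRpow; split_ifs with h
  · exact Real.rpow_nonneg h.le _
  · rfl

theorem norm_posPow (z : ℂ) (t : ℝ) : ‖posPow z t‖ = posRpow z.re t := by
  unfold posPow posRpow; split_ifs with h
  · exact Complex.norm_cpow_eq_rpow_re_of_pos h z
  · exact norm_zero

theorem posPow_ofReal (s t : ℝ) : posPow s t = posRpow s t := by
  unfold posPow posRpow; split_ifs with h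
  · rw [Complex.ofReal_cpow h.le]
  · simp

theorem measurable_posPow (z : ℂ) : Measurable (posPow z) := by
  unfold posPow
  refine Measurable.ite measurableSet_Ioi ?_ measurable_const
  exact Complex.measurable_ofReal.pow_const z

theorem measurable_posPowLog (z : ℂ) : Measurable (posPowLog z) := by
  unfold posPowLog
  refine Measurable.ite measurableSet_Ioi ?_ measurable_const
  exact (Complex.measurable_ofReal.pow_const z).mul
    (Complex.measurable_ofReal.comp Real.measurable_log)

theorem measurable_posRpow (s : ℝ) : Measurable (posRpow s) := by
  unfold posRpow
  exact Measurable.ite measurableSet_Ioi (measurable_id.pow_const s) measurable_const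

theorem hasDerivAt_posPow_exponent (z : ℂ) (t : ℝ) :
    HasDerivAt (fun z => posPow z t) (posPowLog z t) z := by
  unfold posPow posPowLog; split_ifs with h
  · have := (hasDerivAt_id z).const_cpow (c := (t : ℂ)) (Or.inl (by exact_mod_cast h.ne'))
    simpa [Complex.ofReal_log h.le] using this
  · exact hasDerivAt_const z 0

theorem posRpow_le_add {s₁ s s₂ : ℝ} (h₁ : s₁ ≤ s) (h₂ : s ≤ s₂) (t : ℝ) :
    posRpow s t ≤ posRpow s₁ t + posRpow s₂ t := by
  have hn₁ := posRpow_nonneg s₁ t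
  have hn₂ := posRpow_nonneg s₂ t
  unfold posRpow at *
  split_ifs at * with h
  · rcases le_or_gt t 1 with h1 | h1
    · linarith [Real.rpow_le_rpow_of_exponent_ge h h1 h₁]
    · linarith [Real.rpow_le_rpow_of_exponent_le h1.le h₂]
  · simp

/-- Uses `|log t| ≤ (t^ε + t^(-ε)) / ε`. The majorant depends only on the strip containing `z`, as
dominated differentiation in the exponent requires. -/
theorem norm_posPowLog_le {z : ℂ} {s₁ s₂ ε : ℝ} (hε : 0 < ε) (h₁ : s₁ + ε ≤ z.re)
    (h₂ : z.re ≤ s₂ - ε) (t : ℝ) :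
    ‖posPowLog z t‖ ≤ 2 / ε * (posRpow s₁ t + posRpow s₂ t) := by
  have e₁ := posRpow_le_add (s₁ := s₁) (s := z.re - ε) (s₂ := s₂) (by linarith) (by linarith) t
  have e₂ := posRpow_le_add (s₁ := s₁) (s := z.re + ε) (s₂ := s₂) (by linarith) (by linarith) t
  rcases le_or_gt t 0 with h | h
  · rw [posPowLog, if_neg (not_lt.2 h), norm_zero]
    exact mul_nonneg (by positivity) (add_nonneg (posRpow_nonneg _ _) (posRpow_nonneg _ _))
  rw [posPowLog, if_pos h, norm_mul, Complex.norm_cpow_eq_rpow_re_of_pos h, Complex.norm_real,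
    Real.norm_eq_abs]
  have hl : |Real.log t| ≤ (t ^ ε + t ^ (-ε)) / ε := by
    have l₁ := Real.log_le_rpow_div h.le hε
    have l₂ := Real.log_le_rpow_div (inv_pos.2 h).le hε
    rw [Real.log_inv, Real.inv_rpow h.le, ← Real.rpow_neg h.le] at l₂
    have p₁ : 0 ≤ t ^ ε / ε := by positivity
    have p₂ : 0 ≤ t ^ (-ε) / ε := by positivity
    rw [add_div, abs_le]
    constructor <;> linarith
  calc t ^ z.re * |Real.log t| ≤ t ^ z.re * ((t ^ ε + t ^ (-ε)) / ε) := by gcongr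
    _ = (posRpow (z.re - ε) t + posRpow (z.re + ε) t) / ε := by
      rw [posRpow, posRpow, if_pos h, if_pos h, sub_eq_add_neg, Real.rpow_add h, Real.rpow_add h]
      ring
    _ ≤ ((posRpow s₁ t + posRpow s₂ t) + (posRpow s₁ t + posRpow s₂ t)) / ε := by gcongr
    _ = _ := by ring

theorem intervalIntegrable_beta_scaled {s t : ℂ} (hs : 0 < s.re) (ht : 0 < t.re) {u : ℝ} (hu : 0 < u) :
    IntervalIntegrable (fun v : ℝ => (v : ℂ) ^ (s - 1) * ((u : ℂ) - v) ^ (t - 1)) volume 0 u := by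
  have h := (Complex.betaIntegral_convergent hs ht).comp_mul_left (c := u⁻¹)
  simp only [div_inv_eq_mul, one_mul, zero_mul] at h
  have h2 := h.const_mul ((u : ℂ) ^ (s - 1) * (u : ℂ) ^ (t - 1))
  refine h2.congr fun v hv => ?_
  rw [Set.uIoc_of_le hu.le] at hv
  have hu' : (u : ℂ) ≠ 0 := by exact_mod_cast hu.ne'
  have e1 : (v : ℂ) = (u : ℂ) * ((u⁻¹ * v : ℝ) : ℂ) := by push_cast; field_simp
  have e2 : (u : ℂ) - v = (u : ℂ) * ((1 - u⁻¹ * v : ℝ) : ℂ) := by push_cast; field_simp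
  have hv1 : 0 ≤ u⁻¹ * v := mul_nonneg (inv_pos.2 hu).le hv.1.le
  have hv2 : 0 ≤ 1 - u⁻¹ * v := by
    rw [sub_nonneg, inv_mul_le_iff₀ hu, mul_one]; exact hv.2
  have e3 : (v : ℂ) ^ (s - 1) = (u : ℂ) ^ (s - 1) * ((u⁻¹ * v : ℝ) : ℂ) ^ (s - 1) := by
    rw [← Complex.mul_cpow_ofReal_nonneg hu.le hv1, ← e1]
  rw [e2, Complex.mul_cpow_ofReal_nonneg hu.le hv2, e3]
  push_cast
  ring

/-- The integrand lives on `0 < v < u`, where it is that of a Beta integral scaled by `u`. -/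
theorem radial_posPow {d : ℝ} (hd : 0 < d) {z : ℂ} (hz : -1 < z.re) {u : ℝ} (hu : 0 < u) :
    Integrable (fun v => posPow z (u - v)) (radialMeasure d) ∧
    ∫ v, posPow z (u - v) ∂(radialMeasure d) =
      (u : ℂ) ^ (z + (d / 2 : ℝ)) * Complex.betaIntegral (d / 2 : ℝ) (z + 1) := by
  have hs : 0 < ((d / 2 : ℝ) : ℂ).re := by rw [Complex.ofReal_re]; positivity
  have ht : 0 < (z + 1).re := by simp; linarith
  have hI := intervalIntegrable_beta_scaled hs ht hu
  rw [intervalIntegrable_iff_integrableOn_Ioo_of_le hu.le] at hI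
  have heq : ∀ v ∈ Set.Ioo 0 u, (v : ℂ) ^ (((d / 2 : ℝ) : ℂ) - 1) * ((u : ℂ) - v) ^ (z + 1 - 1) =
      v ^ (d / 2 - 1) • posPow z (u - v) := fun v hv => by
    rw [posPow, if_pos (sub_pos.2 hv.2), Complex.real_smul, Complex.ofReal_cpow hv.1.le,
      add_sub_cancel_right]
    push_cast
    rfl
  have hz0 : ∀ v ∈ Set.Ioi (0 : ℝ), v ∉ Set.Ioo 0 u → v ^ (d / 2 - 1) • posPow z (u - v) = 0 := by
    intro v hv hv'
    rw [posPow, if_neg, smul_zero]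
    intro h
    exact hv' ⟨hv, sub_pos.1 h⟩
  constructor
  · rw [radialMeasure, integrable_withDensity_iff_integrable_smul' (measurable_rpow_const _) (by simp)]
    have h1 : IntegrableOn (fun v : ℝ => v ^ (d / 2 - 1) • posPow z (u - v)) (Set.Ioi 0) :=
      (hI.congr_fun heq measurableSet_Ioo).of_forall_sdiff_eq_zero measurableSet_Ioi
        fun v hv => hz0 v hv.1 hv.2
    refine h1.congr_fun (fun v hv => ?_) measurableSet_Ioi
    simp only
    rw [ENNReal.toReal_ofReal (Real.rpow_nonneg (le_of_lt hv) _)]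
  · rw [integral_radialMeasure, setIntegral_eq_of_subset_of_forall_sdiff_eq_zero
      measurableSet_Ioi (Set.Ioo_subset_Ioi_self : Set.Ioo 0 u ⊆ Set.Ioi 0) fun v hv => hz0 v hv.1 hv.2,
      ← setIntegral_congr_fun measurableSet_Ioo heq, restrict_Ioo_eq_restrict_Ioc,
      ← intervalIntegral.integral_of_le hu.le, Complex.betaIntegral_scaled _ _ hu]
    congr 2
    ring

theorem radial_posRpow {d : ℝ} (hd : 0 < d) {s : ℝ} (hs : -1 < s) {u : ℝ} (hu : 0 < u) :
    Integrable (fun v => posRpow s (u - v)) (radialMeasure d) ∧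
    ∫ v, posRpow s (u - v) ∂(radialMeasure d) =
      u ^ (s + d / 2) * (Complex.betaIntegral (d / 2 : ℝ) (s + 1)).re := by
  obtain ⟨h1, h2⟩ := radial_posPow (z := s) hd (by simpa using hs) hu
  simp_rw [posPow_ofReal] at h1 h2
  refine ⟨by simpa using h1.re, ?_⟩
  rw [integral_complex_ofReal, ← Complex.ofReal_add, ← Complex.ofReal_cpow hu.le] at h2
  have h3 := congrArg Complex.re h2
  rwa [Complex.ofReal_re, Complex.re_ofReal_mul] at h3

theorem ae_radialMeasure_pos (d : ℝ) : ∀ᵐ u ∂(radialMeasure d), 0 < u :=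
  (withDensity_absolutelyContinuous _ _).ae_le (ae_restrict_mem measurableSet_Ioi)

/-- Tonelli: the inner integral is a Beta constant times `u ^ (s + b/2)`, and the resulting outer
exponent `a/2 - 1 + s + b/2` exceeds `-1` because `a, b ≥ 1`. -/
theorem integrable_posRpow_prod {a b : ℝ} (ha : 1 ≤ a) (hb : 1 ≤ b) {s : ℝ} (hs : -1 < s) (R : ℝ) :
    Integrable (fun y : ℝ × ℝ => if y.1 ≤ R then posRpow s (y.1 - y.2) else 0)
      ((radialMeasure a).prod (radialMeasure b)) := by
  have hm : Measurable fun y : ℝ × ℝ => if y.1 ≤ R then posRpow s (y.1 - y.2) else 0 :=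
    Measurable.ite (measurable_fst measurableSet_Iic)
      ((measurable_posRpow s).comp (measurable_fst.sub measurable_snd)) measurable_const
  rw [integrable_prod_iff hm.aestronglyMeasurable]
  constructor
  · filter_upwards [ae_radialMeasure_pos a] with u hu
    by_cases h : u ≤ R
    · simpa [h] using (radial_posRpow (by linarith) hs hu).1
    · simp [h]
  · set B := (Complex.betaIntegral (b / 2 : ℝ) (s + 1)).re
    have h1 : Integrable (fun u => if u ≤ R then u ^ (s + b / 2) * B else 0) (radialMeasure a) := by
      rw [radialMeasure, integrable_withDensity_iff_integrable_smul' (measurable_rpow_const _) (by simp)]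
      have h2 : IntegrableOn (fun u : ℝ => u ^ (a / 2 - 1 + (s + b / 2)) * B) (Set.Ioc 0 R) := by
        rcases le_or_gt R 0 with hR | hR
        · simp [Set.Ioc_eq_empty (not_lt.2 hR)]
        · exact ((intervalIntegrable_iff_integrableOn_Ioc_of_le hR.le).1
            (intervalIntegral.intervalIntegrable_rpow' (by linarith))).mul_const B
      have h3 : IntegrableOn (fun u : ℝ => if u ≤ R then u ^ (a / 2 - 1 + (s + b / 2)) * B else 0)
          (Set.Ioi 0) := by
        refine IntegrableOn.of_forall_sdiff_eq_zero
          (h2.congr_fun (fun u hu => ?_) measurableSet_Ioc) measurableSet_Ioi fun u hu => ?_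
        · simp [hu.2]
        · exact if_neg fun h => hu.2 ⟨hu.1, h⟩
      refine h3.congr_fun (fun u hu => ?_) measurableSet_Ioi
      simp only
      rw [ENNReal.toReal_ofReal (Real.rpow_nonneg (le_of_lt hu) _), smul_eq_mul]
      split_ifs
      · rw [Real.rpow_add hu]; ring
      · simp
    refine h1.congr ?_
    filter_upwards [ae_radialMeasure_pos a] with u hu
    by_cases h : u ≤ R
    · simp only [h, if_true, Real.norm_of_nonneg (posRpow_nonneg _ _)]
      exact (radial_posRpow (by linarith) hs hu).2.symm
    · simp [h]

end TruncatedPower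

/-! ### The power functional for `Re z > -1`: integrability, bounds, holomorphy. -/

section PowerFunctional

variable {p q : ℕ}

theorem one_le_weightedDimFst (hp : 0 < p) {γ : Fin p ⊕ Fin q → ℝ} (hγ : ∀ i, 0 < γ i) :
    1 ≤ weightedDimFst γ := by
  have h1 : (1 : ℝ) ≤ p := by exact_mod_cast hp
  have h2 : 0 ≤ ∑ i : Fin p, γ (Sum.inl i) := Finset.sum_nonneg fun i _ => (hγ _).le
  unfold weightedDimFst; linarith

theorem one_le_weightedDimSnd (hq : 0 < q) {γ : Fin p ⊕ Fin q → ℝ} (hγ : ∀ i, 0 < γ i) :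
    1 ≤ weightedDimSnd γ := by
  have h1 : (1 : ℝ) ≤ q := by exact_mod_cast hq
  have h2 : 0 ≤ ∑ i : Fin q, γ (Sum.inr i) := Finset.sum_nonneg fun i _ => (hγ _).le
  unfold weightedDimSnd; linarith

/-- The function `P_+^s` cut off to `|x'|² ≤ R`. -/
noncomputable def cutPower (s R : ℝ) (x : Fin p ⊕ Fin q → ℝ) : ℝ :=
  if (biSqNorm x).1 ≤ R then posRpow s (quadForm x) else 0

theorem cutPower_nonneg (s R : ℝ) (x : Fin p ⊕ Fin q → ℝ) : 0 ≤ cutPower s R x := by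
  unfold cutPower; split_ifs
  · exact posRpow_nonneg _ _
  · rfl

theorem continuous_quadForm : Continuous (quadForm : (Fin p ⊕ Fin q → ℝ) → ℝ) := by
  unfold quadForm; fun_prop

theorem integrable_cutPower (hp : 0 < p) (hq : 0 < q) {γ : Fin p ⊕ Fin q → ℝ} (hγ : ∀ i, 0 < γ i)
    {s : ℝ} (hs : -1 < s) (R : ℝ) : Integrable (cutPower s R) (weightMeasure γ) := by
  have h1 := integrable_posRpow_prod (one_le_weightedDimFst hp hγ) (one_le_weightedDimSnd hq hγ) hs R
  have h2 := (h1.smul_measure (c := ENNReal.ofReal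
    (radialConst (fun i => γ (Sum.inl i)) * radialConst fun j => γ (Sum.inr j))) (by simp))
  rw [← map_biSqNorm_weightMeasure hp hq hγ] at h2
  exact h2.comp_measurable contDiff_biSqNorm.continuous.measurable

/-- The integral `∫ P(x)_+^z f(x) x^γ dx` over the orthant. -/
noncomputable def powInt (γ : Fin p ⊕ Fin q → ℝ) (z : ℂ) (f : (Fin p ⊕ Fin q → ℝ) → ℂ) : ℂ :=
  ∫ x, posPow z (quadForm x) * f x ∂(weightMeasure γ)

/-- The derivative of `powInt` with respect to the exponent. -/
noncomputable def powLogInt (γ : Fin p ⊕ Fin q → ℝ) (z : ℂ) (f : (Fin p ⊕ Fin q → ℝ) → ℂ) : ℂ :=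
  ∫ x, posPowLog z (quadForm x) * f x ∂(weightMeasure γ)

/-- Measurable functions bounded by `M` which vanish for `|x'|² > R`. -/
structure IsAdmissible (M R : ℝ) (f : (Fin p ⊕ Fin q → ℝ) → ℂ) : Prop where
  measurable : Measurable f
  norm_le : ∀ x, ‖f x‖ ≤ M
  eq_zero : ∀ x, R < (biSqNorm x).1 → f x = 0

namespace IsAdmissible

variable {γ : Fin p ⊕ Fin q → ℝ} {M R : ℝ} {f : (Fin p ⊕ Fin q → ℝ) → ℂ}

theorem nonneg (hf : IsAdmissible M R f) : 0 ≤ M := (norm_nonneg _).trans (hf.norm_le 0)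

theorem norm_posPow_mul_le (hf : IsAdmissible M R f) (z : ℂ) (x : Fin p ⊕ Fin q → ℝ) :
    ‖posPow z (quadForm x) * f x‖ ≤ M * cutPower z.re R x := by
  rw [norm_mul, norm_posPow, mul_comm, cutPower]
  split_ifs with h
  · exact mul_le_mul_of_nonneg_right (hf.norm_le x) (posRpow_nonneg _ _)
  · rw [hf.eq_zero x (not_le.1 h)]; simp

theorem norm_posPowLog_mul_le (hf : IsAdmissible M R f) {z : ℂ} {s₁ s₂ ε : ℝ} (hε : 0 < ε)
    (h₁ : s₁ + ε ≤ z.re) (h₂ : z.re ≤ s₂ - ε) (x : Fin p ⊕ Fin q → ℝ) :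
    ‖posPowLog z (quadForm x) * f x‖ ≤ M * (2 / ε * (cutPower s₁ R x + cutPower s₂ R x)) := by
  rw [norm_mul, mul_comm, cutPower, cutPower]
  split_ifs with h
  · exact mul_le_mul (hf.norm_le x) (norm_posPowLog_le hε h₁ h₂ _) (norm_nonneg _) hf.nonneg
  · rw [hf.eq_zero x (not_le.1 h)]; simp

theorem integrable (hp : 0 < p) (hq : 0 < q) (hγ : ∀ i, 0 < γ i) (hf : IsAdmissible M R f) {z : ℂ}
    (hz : -1 < z.re) : Integrable (fun x => posPow z (quadForm x) * f x) (weightMeasure γ) :=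
  ((integrable_cutPower hp hq hγ hz R).const_mul M).mono'
    (((measurable_posPow z).comp continuous_quadForm.measurable).mul hf.measurable).aestronglyMeasurable
    (Eventually.of_forall (hf.norm_posPow_mul_le z))

theorem norm_powInt_le (hp : 0 < p) (hq : 0 < q) (hγ : ∀ i, 0 < γ i) (hf : IsAdmissible M R f) {z : ℂ}
    (hz : -1 < z.re) : ‖powInt γ z f‖ ≤ M * ∫ x, cutPower z.re R x ∂(weightMeasure γ) := by
  rw [← integral_const_mul]
  exact norm_integral_le_of_norm_le ((integrable_cutPower hp hq hγ hz R).const_mul M)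
    (Eventually.of_forall (hf.norm_posPow_mul_le z))

theorem norm_powLogInt_le (hp : 0 < p) (hq : 0 < q) (hγ : ∀ i, 0 < γ i) (hf : IsAdmissible M R f)
    {z : ℂ} {s₁ s₂ ε : ℝ} (hs : -1 < s₁) (hε : 0 < ε)
    (h₁ : s₁ + ε ≤ z.re) (h₂ : z.re ≤ s₂ - ε) :
    ‖powLogInt γ z f‖ ≤
      M * ∫ x, 2 / ε * (cutPower s₁ R x + cutPower s₂ R x) ∂(weightMeasure γ) := by
  rw [← integral_const_mul]
  exact norm_integral_le_of_norm_le ((((integrable_cutPower hp hq hγ hs R).add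
      (integrable_cutPower hp hq hγ (by linarith) R)).const_mul (2 / ε)).const_mul M)
    (Eventually.of_forall (hf.norm_posPowLog_mul_le hε h₁ h₂))

theorem hasDerivAt_powInt (hp : 0 < p) (hq : 0 < q) (hγ : ∀ i, 0 < γ i) (hf : IsAdmissible M R f)
    {z : ℂ} (hz : -1 < z.re) :
    HasDerivAt (fun z => powInt γ z f) (powLogInt γ z f) z := by
  -- The ball of radius `ε` about `z` keeps distance `ε` from the exponents `z.re ± 2 ε` of the
  -- majorant, and these must still be integrable.
  obtain ⟨ε, hε, hε'⟩ : ∃ ε : ℝ, 0 < ε ∧ -1 < z.re - 2 * ε :=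
    ⟨(z.re + 1) / 4, by linarith, by linarith⟩
  refine (hasDerivAt_integral_of_dominated_loc_of_deriv_le
    (F := fun z x => posPow z (quadForm x) * f x) (F' := fun z x => posPowLog z (quadForm x) * f x)
    (bound := fun x => M * (2 / ε * (cutPower (z.re - 2 * ε) R x + cutPower (z.re + 2 * ε) R x)))
    (Metric.ball_mem_nhds z hε) ?_ (hf.integrable hp hq hγ hz) ?_ ?_ ?_ ?_).2
  · exact Eventually.of_forall fun w => (((measurable_posPow w).comp
      continuous_quadForm.measurable).mul hf.measurable).aestronglyMeasurable
  · exact (((measurable_posPowLog z).comp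
      continuous_quadForm.measurable).mul hf.measurable).aestronglyMeasurable
  · refine Eventually.of_forall fun x w hw => hf.norm_posPowLog_mul_le hε ?_ ?_ x
    all_goals
      have h1 := (Complex.abs_re_le_norm (w - z)).trans_lt (mem_ball_iff_norm.1 hw)
      rw [Complex.sub_re, abs_lt] at h1
      linarith [h1.1, h1.2]
  · exact (((integrable_cutPower hp hq hγ hε' R).add
      (integrable_cutPower hp hq hγ (by linarith) R)).const_mul (2 / ε)).const_mul M
  · exact Eventually.of_forall fun x w _ => (hasDerivAt_posPow_exponent w _).mul_const _

theorem differentiableOn_powInt (hp : 0 < p) (hq : 0 < q) (hγ : ∀ i, 0 < γ i)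
    (hf : IsAdmissible M R f) : DifferentiableOn ℂ (fun z => powInt γ z f) {z | -1 < z.re} :=
  fun _ hz => (hf.hasDerivAt_powInt hp hq hγ hz).differentiableAt.differentiableWithinAt

theorem analyticAt_powInt (hp : 0 < p) (hq : 0 < q) (hγ : ∀ i, 0 < γ i)
    (hf : IsAdmissible M R f) {z : ℂ} (hz : -1 < z.re) :
    AnalyticAt ℂ (fun z => powInt γ z f) z :=
  (hf.differentiableOn_powInt hp hq hγ).analyticAt
    ((isOpen_lt continuous_const Complex.continuous_re).mem_nhds hz)

end IsAdmissible

end PowerFunctional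

/-! ### One-variable derivatives of truncated powers, including at the origin. -/

theorem hasDerivAt_zero_of_norm_le_rpow {F : Type} [NormedAddCommGroup F] [NormedSpace ℝ F]
    {f : ℝ → F} {s : ℝ} (hs : 1 < s) (h : ∀ t, ‖f t‖ ≤ |t| ^ s) : HasDerivAt f 0 0 := by
  have h0 : f 0 = 0 := by
    have := h 0
    rwa [abs_zero, Real.zero_rpow (by linarith), norm_le_zero_iff] at this
  rw [hasDerivAt_iff_isLittleO]
  simp only [h0, sub_zero, smul_zero]
  have h1 : f =O[𝓝 0] fun t : ℝ => |t| ^ s :=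
    Asymptotics.IsBigO.of_bound 1 (Eventually.of_forall fun t => by
      rw [one_mul, Real.norm_of_nonneg (by positivity)]; exact h t)
  refine h1.trans_isLittleO ?_
  have h2 : (fun t : ℝ => |t| ^ s) = fun t => |t| ^ (s - 1) * |t| := by
    ext t
    rcases eq_or_ne t 0 with rfl | ht
    · simp [Real.zero_rpow (by linarith : s ≠ 0)]
    · rw [← Real.rpow_add_one (abs_pos.2 ht).ne', sub_add_cancel]
  rw [h2, ← Asymptotics.isLittleO_abs_right]
  have h3 : Tendsto (fun t : ℝ => |t| ^ (s - 1)) (𝓝 0) (𝓝 0) := by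
    have : Continuous fun t : ℝ => |t| ^ (s - 1) :=
      continuous_abs.rpow_const fun _ => Or.inr (by linarith)
    have := this.tendsto 0
    rwa [abs_zero, Real.zero_rpow (by linarith)] at this
  have h4 := (Asymptotics.isLittleO_one_iff ℝ).2 h3
  simpa using h4.mul_isBigO (Asymptotics.isBigO_refl (fun t : ℝ => |t|) (𝓝 0))

theorem hasDerivAt_posPow {z : ℂ} (hz : 1 < z.re) (t : ℝ) :
    HasDerivAt (posPow z) (z * posPow (z - 1) t) t := by
  rcases lt_trichotomy t 0 with h | rfl | h
  · rw [posPow, if_neg (not_lt.2 h.le), mul_zero]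
    refine (hasDerivAt_const t (0 : ℂ)).congr_of_eventuallyEq ?_
    filter_upwards [eventually_lt_nhds h] with u hu
    exact if_neg (not_lt.2 hu.le)
  · rw [posPow, if_neg (lt_irrefl _), mul_zero]
    refine hasDerivAt_zero_of_norm_le_rpow hz fun t => ?_
    rw [norm_posPow, posRpow]
    split_ifs with h
    · rw [abs_of_pos h]
    · positivity
  · rw [posPow, if_pos h]
    have h1 := ((hasDerivAt_id (t : ℂ)).cpow_const (c := z)
      (Or.inl (by simpa using h))).comp_ofReal
    simp only [id_eq, mul_one] at h1
    refine h1.congr_of_eventuallyEq ?_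
    filter_upwards [eventually_gt_nhds h] with u hu
    exact if_pos hu

theorem posPow_sub_one_mul (z : ℂ) (t : ℝ) : posPow (z - 1) t * t = posPow z t := by
  unfold posPow; split_ifs with h
  · have : (t : ℂ) ≠ 0 := by exact_mod_cast h.ne'
    rw [Complex.cpow_sub _ _ this, Complex.cpow_one, div_mul_cancel₀ _ this]
  · rw [zero_mul]

/-- For `0 < c ≤ 1` the factor `max t 0 ^ c` alone is not differentiable at `0`; the extra factor
`t` cures this. It is the reason for integrating by parts along `x_i ∂_i` and not `∂_i`. -/
theorem hasDerivAt_mul_max_rpow {c : ℝ} (hc : 0 < c) (t : ℝ) :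
    HasDerivAt (fun t : ℝ => t * max t 0 ^ c) ((c + 1) * max t 0 ^ c) t := by
  rcases lt_trichotomy t 0 with h | rfl | h
  · rw [max_eq_right h.le, Real.zero_rpow hc.ne', mul_zero]
    refine (hasDerivAt_const t (0 : ℝ)).congr_of_eventuallyEq ?_
    filter_upwards [eventually_lt_nhds h] with u hu
    rw [max_eq_right hu.le, Real.zero_rpow hc.ne', mul_zero]
  · rw [max_self, Real.zero_rpow hc.ne', mul_zero]
    refine hasDerivAt_zero_of_norm_le_rpow (s := c + 1) (by linarith) fun t => ?_
    rw [norm_mul, Real.norm_eq_abs, Real.norm_of_nonneg (Real.rpow_nonneg (le_max_right _ _) _)]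
    rcases eq_or_ne t 0 with rfl | ht
    · rw [abs_zero, zero_mul]; positivity
    · rw [Real.rpow_add_one (abs_pos.2 ht).ne', mul_comm]
      exact mul_le_mul_of_nonneg_right (Real.rpow_le_rpow (le_max_right t 0)
        (max_le (le_abs_self t) (abs_nonneg t)) hc.le) (abs_nonneg t)
  · have h1 : HasDerivAt (fun t : ℝ => t ^ (c + 1)) ((c + 1) * t ^ c) t := by
      simpa using Real.hasDerivAt_rpow_const (x := t) (p := c + 1) (Or.inl h.ne')
    rw [max_eq_left h.le]
    refine h1.congr_of_eventuallyEq ?_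
    filter_upwards [eventually_gt_nhds h] with u hu
    rw [max_eq_left hu.le, Real.rpow_add_one hu.ne', mul_comm]

/-! ### Integration by parts along `x_i ∂_i`. -/

section IntegrationByParts

variable {p q : ℕ}

theorem hasLineDerivAt_quadForm (x : Fin p ⊕ Fin q → ℝ) (i : Fin p ⊕ Fin q) :
    HasLineDerivAt ℝ quadForm (2 * formSign i * x i) x (Pi.single i 1) := by
  have h : ∀ t : ℝ, quadForm (x + t • Pi.single i 1) =
      quadForm x + formSign i * (2 * x i * t + t ^ 2) := by
    intro t
    rw [quadForm_eq_sum, quadForm_eq_sum, ← sub_eq_iff_eq_add', ← Finset.sum_sub_distrib,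
      Finset.sum_eq_single i]
    · simp; ring
    · intro j _ hj; simp [hj]
    · simp
  rw [HasLineDerivAt]
  simp only [h]
  have h1 : HasDerivAt (fun t : ℝ => 2 * x i * t + t ^ 2) (2 * x i) 0 := by
    exact (((hasDerivAt_id (0 : ℝ)).const_mul (2 * x i)).add (hasDerivAt_pow 2 (0 : ℝ))).congr_deriv
      (by simp)
  have h2 := (h1.const_mul (formSign i)).const_add (quadForm x)
  convert! h2 using 1
  ring

theorem hasLineDerivAt_coord_mul_weight {ι : Type} [Fintype ι] [DecidableEq ι] {γ : ι → ℝ}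
    (hγ : ∀ i, 0 < γ i) (x : ι → ℝ) (i : ι) :
    HasLineDerivAt ℝ (fun x => x i * weight γ x) ((γ i + 1) * weight γ x) x (Pi.single i 1) := by
  have h : ∀ t : ℝ, (x + t • Pi.single i 1 : ι → ℝ) i * weight γ (x + t • Pi.single i 1) =
      (∏ j ∈ Finset.univ.erase i, max (x j) 0 ^ γ j) *
        ((x i + t) * max (x i + t) 0 ^ γ i) := by
    intro t
    rw [weight, ← Finset.mul_prod_erase _ _ (Finset.mem_univ i)]
    have : ∏ j ∈ Finset.univ.erase i, max ((x + t • Pi.single i 1 : ι → ℝ) j) 0 ^ γ j =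
        ∏ j ∈ Finset.univ.erase i, max (x j) 0 ^ γ j :=
      Finset.prod_congr rfl fun j hj => by simp [Finset.ne_of_mem_erase hj]
    rw [this]
    simp
    ring
  rw [HasLineDerivAt]
  simp only [h]
  have h1 : HasDerivAt (fun t : ℝ => (x i + t) * max (x i + t) 0 ^ γ i)
      ((γ i + 1) * max (x i) 0 ^ γ i) 0 := by
    have := (hasDerivAt_mul_max_rpow (hγ i) (x i + 0)).comp_const_add (x i) 0
    simpa using this
  have h2 := h1.const_mul (∏ j ∈ Finset.univ.erase i, max (x j) 0 ^ γ j)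
  convert! h2 using 1
  rw [weight, ← Finset.mul_prod_erase _ _ (Finset.mem_univ i)]
  ring

theorem exists_isAdmissible_of_isCompact {K : Set (Fin p ⊕ Fin q → ℝ)} (hK : IsCompact K) :
    ∃ R, ∀ (M : ℝ) (f : (Fin p ⊕ Fin q → ℝ) → ℂ), Measurable f → (∀ x, ‖f x‖ ≤ M) →
      tsupport f ⊆ K → IsAdmissible M R f := by
  obtain ⟨R, hR⟩ := hK.exists_bound_of_continuousOn
    (contDiff_biSqNorm (p := p) (q := q)).continuous.fst.continuousOn
  refine ⟨R, fun M f hm hM hs => ⟨hm, hM, fun x hx => ?_⟩⟩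
  refine image_eq_zero_of_notMem_tsupport fun h => ?_
  exact absurd hx (not_lt.2 ((le_abs_self _).trans (hR x (hs h))))

theorem exists_isAdmissible {f : (Fin p ⊕ Fin q → ℝ) → ℂ} (hf : Continuous f)
    (hs : HasCompactSupport f) : ∃ M R, IsAdmissible M R f := by
  obtain ⟨M, hM⟩ := hf.bounded_above_of_compact_support hs
  obtain ⟨R, hR⟩ := exists_isAdmissible_of_isCompact hs
  exact ⟨M, R, hR M f hf.measurable hM subset_rfl⟩

variable {γ : Fin p ⊕ Fin q → ℝ}

theorem integrable_posPow_mul (hp : 0 < p) (hq : 0 < q) (hγ : ∀ i, 0 < γ i) {z : ℂ} (hz : -1 < z.re)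
    {f : (Fin p ⊕ Fin q → ℝ) → ℂ} (hf : Continuous f) (hs : HasCompactSupport f) :
    Integrable (fun x => posPow z (quadForm x) * f x) (weightMeasure γ) := by
  obtain ⟨M, R, h⟩ := exists_isAdmissible hf hs
  exact h.integrable hp hq hγ hz

theorem powInt_const_mul (z c : ℂ) (f : (Fin p ⊕ Fin q → ℝ) → ℂ) :
    powInt γ z (fun x => c * f x) = c * powInt γ z f := by
  simp only [powInt, mul_left_comm _ c, integral_const_mul]

theorem powInt_sum (hp : 0 < p) (hq : 0 < q) (hγ : ∀ i, 0 < γ i) {z : ℂ} (hz : -1 < z.re)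
    {κ : Type} (s : Finset κ) {f : κ → (Fin p ⊕ Fin q → ℝ) → ℂ} (hf : ∀ i, Continuous (f i))
    (hs : ∀ i, HasCompactSupport (f i)) :
    powInt γ z (fun x => ∑ i ∈ s, f i x) = ∑ i ∈ s, powInt γ z (f i) := by
  simp only [powInt, Finset.mul_sum]
  exact integral_finsetSum _ fun i _ => integrable_posPow_mul hp hq hγ hz (hf i) (hs i)

/-- The product `P_+^z x_i x^γ`, extended by zero, has a line derivative along `e_i` at every point
when `Re z > 1`, so the integration takes place on the whole space and no boundary terms arise.
Differentiating `P_+^z` produces the factor `x_i²` with the sign of the form. -/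
theorem powInt_coord_mul_partialDeriv (hp : 0 < p) (hq : 0 < q) (hγ : ∀ i, 0 < γ i) {z : ℂ}
    (hz : 1 < z.re) {g : (Fin p ⊕ Fin q → ℝ) → ℂ} (hg : ContDiff ℝ ∞ g) (hs : HasCompactSupport g)
    (i : Fin p ⊕ Fin q) :
    powInt γ z (fun x => x i * partialDeriv i g x + (γ i + 1) * g x) =
      -2 * z * formSign i * powInt γ (z - 1) fun x => (x i : ℂ) ^ 2 * g x := by
  have hxc : Continuous fun x : Fin p ⊕ Fin q → ℝ => (x i : ℂ) :=
    Complex.continuous_ofReal.comp (continuous_apply i)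
  have hds : HasCompactSupport (partialDeriv i g) :=
    hs.of_isClosed_subset (isClosed_tsupport _) (tsupport_partialDeriv_subset i g)
  have hdc := (hg.partialDeriv i).continuous
  have I1 : Integrable (fun x => posPow z (quadForm x) * (x i * partialDeriv i g x)) (weightMeasure γ) :=
    integrable_posPow_mul (z := z) hp hq hγ (by linarith) (hxc.mul hdc) (hds.mul_left)
  have I2 := integrable_posPow_mul (z := z) hp hq hγ (by linarith) hg.continuous hs
  have I3 : Integrable (fun x => posPow (z - 1) (quadForm x) * ((x i : ℂ) ^ 2 * g x)) (weightMeasure γ) :=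
    integrable_posPow_mul (z := z - 1) hp hq hγ (by simp; linarith)
    ((hxc.pow 2).mul hg.continuous) hs.mul_left
  have I4 : Integrable (fun x => posPow z (quadForm x) * (x i * g x)) (weightMeasure γ) :=
    integrable_posPow_mul (z := z) hp hq hγ (by linarith) (hxc.mul hg.continuous) hs.mul_left
  have J1 := (integrable_weightMeasure_iff γ _).1 I1
  have J2 := (integrable_weightMeasure_iff γ _).1 (I2.const_mul ((γ i : ℂ) + 1))
  have J3 := (integrable_weightMeasure_iff γ _).1 (I3.const_mul (2 * z * formSign i))
  have J4 := (integrable_weightMeasure_iff γ _).1 I4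
  have hF : ∀ x, HasLineDerivAt ℝ
      (fun x : Fin p ⊕ Fin q → ℝ => posPow z (quadForm x) * ((x i * weight γ x : ℝ) : ℂ))
      ((z * posPow (z - 1) (quadForm x)) * (2 * formSign i * x i : ℝ) *
        ((x i * weight γ x : ℝ) : ℂ) +
        posPow z (quadForm x) * (((γ i + 1) * weight γ x : ℝ) : ℂ)) x (Pi.single i 1) := by
    intro x
    have h1 := hasLineDerivAt_quadForm x i
    have h2 := hasLineDerivAt_coord_mul_weight hγ x i
    rw [HasLineDerivAt] at h1 h2 ⊢
    have h3 : HasDerivAt (posPow z) (z * posPow (z - 1) (quadForm x))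
        (quadForm (x + (0 : ℝ) • Pi.single i 1)) := by
      simpa using hasDerivAt_posPow hz (quadForm x)
    have h4 := h3.scomp (0 : ℝ) h1
    have h5 := h4.mul h2.ofReal_comp
    convert! h5 using 1
    simp only [zero_smul, add_zero, Complex.real_smul, Function.comp_apply]
    push_cast
    ring
  have key := integral_bilinear_hasLineDerivAt_right_eq_neg_left_of_integrable
    (μ := (volume : Measure (Fin p ⊕ Fin q → ℝ))) (B := ContinuousLinearMap.mul ℝ ℂ)
    (f := fun x => posPow z (quadForm x) * ((x i * weight γ x : ℝ) : ℂ))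
    (f' := fun x => (z * posPow (z - 1) (quadForm x)) * (2 * formSign i * x i : ℝ) *
        ((x i * weight γ x : ℝ) : ℂ) +
        posPow z (quadForm x) * (((γ i + 1) * weight γ x : ℝ) : ℂ))
    (g := g) (g' := partialDeriv i g) (v := Pi.single i 1) ?_ ?_ ?_ (fun x _ => hF x)
    (fun x _ => ((hg.differentiable (by simp)) x).hasFDerivAt.hasLineDerivAt _)
  · simp only [ContinuousLinearMap.mul_apply'] at key
    have e1 : powInt γ z (fun x => x i * partialDeriv i g x + (γ i + 1) * g x) =
        (∫ x, (posPow z (quadForm x) * ((x i * weight γ x : ℝ) : ℂ)) * partialDeriv i g x) +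
          ∫ x, weight γ x • (((γ i : ℂ) + 1) * (posPow z (quadForm x) * g x)) := by
      rw [powInt, ← integral_weightMeasure]
      have : ∫ x, (posPow z (quadForm x) * ((x i * weight γ x : ℝ) : ℂ)) * partialDeriv i g x =
          ∫ x, posPow z (quadForm x) * (x i * partialDeriv i g x) ∂(weightMeasure γ) := by
        rw [integral_weightMeasure]
        congr 1; ext x; rw [Complex.real_smul]; push_cast; ring
      rw [this, ← integral_add I1 (I2.const_mul _)]
      congr 1; ext x; ring
    have e2 : ∫ x, ((z * posPow (z - 1) (quadForm x)) * (2 * formSign i * x i : ℝ) *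
        ((x i * weight γ x : ℝ) : ℂ) +
        posPow z (quadForm x) * (((γ i + 1) * weight γ x : ℝ) : ℂ)) * g x =
        2 * z * formSign i * powInt γ (z - 1) (fun x => (x i : ℂ) ^ 2 * g x) +
          ∫ x, weight γ x • (((γ i : ℂ) + 1) * (posPow z (quadForm x) * g x)) := by
      rw [powInt, ← integral_const_mul, integral_weightMeasure, ← integral_add J3 J2]
      congr 1; ext x; simp only [Complex.real_smul]; push_cast; ring
    rw [e1, key, e2]
    ring
  · refine (J3.add J2).congr (Eventually.of_forall fun x => ?_)
    simp only [Pi.add_apply, ContinuousLinearMap.mul_apply', Complex.real_smul]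
    push_cast; ring
  · refine J1.congr (Eventually.of_forall fun x => ?_)
    simp only [ContinuousLinearMap.mul_apply', Complex.real_smul]
    push_cast; ring
  · refine J4.congr (Eventually.of_forall fun x => ?_)
    simp only [ContinuousLinearMap.mul_apply', Complex.real_smul]
    push_cast; ring

end IntegrationByParts

/-! ### The functional equation between the exponents `z` and `z + 1`. -/

namespace EvenTestFunction

section Constructions

variable {ι : Type} [Fintype ι] [DecidableEq ι]

/-- The product of a test function with a smooth even function. -/
noncomputable def mulEven (k : (ι → ℝ) → ℂ) (hk : ContDiff ℝ ∞ k) (hk' : ∀ i, HasParity i 1 k)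
    (φ : EvenTestFunction ι) : EvenTestFunction ι :=
  ⟨fun x => k x * φ x, hk.mul (smooth φ), (compactSupport φ).mul_left, fun i x => by
    have h1 := hk' i x
    have h2 := parity φ i x
    rw [one_smul] at h1 h2
    simp only [h1, h2]⟩

theorem mulEven_apply {k : (ι → ℝ) → ℂ} (hk : ContDiff ℝ ∞ k) (hk' : ∀ i, HasParity i 1 k)
    (φ : EvenTestFunction ι) (x : ι → ℝ) : mulEven k hk hk' φ x = k x * φ x := rfl

/-- The operator `x_i ∂/∂x_i` on test functions. -/
noncomputable def coordDeriv (i : ι) (φ : EvenTestFunction ι) : EvenTestFunction ι :=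
  ⟨fun x => x i * partialDeriv i φ x,
    (Complex.ofRealCLM.contDiff.comp (contDiff_apply _ _ i)).mul ((smooth φ).partialDeriv i),
    HasCompactSupport.mul_left ((compactSupport φ).of_isClosed_subset (isClosed_tsupport _)
      (tsupport_partialDeriv_subset i φ)), fun j x => by
    have h := (parity φ j).partialDeriv (smooth φ) i x
    simp only [h]
    by_cases hij : i = j
    · subst hij; simp
    · simp [hij]⟩

theorem coordDeriv_apply (i : ι) (φ : EvenTestFunction ι) (x : ι → ℝ) :
    coordDeriv i φ x = x i * partialDeriv i φ x := rfl

theorem tsupport_coordDeriv_subset (i : ι) (φ : EvenTestFunction ι) :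
    tsupport (coordDeriv i φ) ⊆ tsupport φ :=
  (tsupport_mul_subset_right).trans (tsupport_partialDeriv_subset i φ)

end Constructions

variable {p q : ℕ} {γ : Fin p ⊕ Fin q → ℝ}

theorem exists_isAdmissible (φ : EvenTestFunction (Fin p ⊕ Fin q)) : ∃ M R, IsAdmissible M R φ :=
  _root_.exists_isAdmissible (smooth φ).continuous (compactSupport φ)

theorem analyticAt_powInt (hp : 0 < p) (hq : 0 < q) (hγ : ∀ i, 0 < γ i)
    (φ : EvenTestFunction (Fin p ⊕ Fin q)) {z : ℂ} (hz : -1 < z.re) :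
    AnalyticAt ℂ (fun z => powInt γ z φ) z := by
  obtain ⟨M, R, h⟩ := exists_isAdmissible φ
  exact h.analyticAt_powInt hp hq hγ hz

theorem powInt_coordDeriv (hp : 0 < p) (hq : 0 < q) (hγ : ∀ i, 0 < γ i) {z : ℂ} (hz : 1 < z.re)
    (φ : EvenTestFunction (Fin p ⊕ Fin q)) (i : Fin p ⊕ Fin q) :
    powInt γ z (coordDeriv i φ) = -(γ i + 1) * powInt γ z φ -
      2 * z * formSign i * powInt γ (z - 1) fun x => (x i : ℂ) ^ 2 * φ x := by
  have h := powInt_coord_mul_partialDeriv hp hq hγ hz (smooth φ) (compactSupport φ) i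
  have h1 : powInt γ z (fun x => x i * partialDeriv i φ x + (γ i + 1) * φ x) =
      powInt γ z (coordDeriv i φ) + (γ i + 1) * powInt γ z φ := by
    have I1 := integrable_posPow_mul (γ := γ) (z := z) hp hq hγ (by linarith)
      (smooth (coordDeriv i φ)).continuous (compactSupport (coordDeriv i φ))
    have I2 := integrable_posPow_mul (γ := γ) (z := z) hp hq hγ (by linarith)
      (smooth φ).continuous (compactSupport φ)
    rw [← powInt_const_mul, powInt, powInt, powInt,
      ← integral_add I1 ((I2.const_mul ((γ i : ℂ) + 1)).congr (Eventually.of_forall fun x => by ring))]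
    congr 1; ext x; rw [coordDeriv_apply]; ring
  rw [h1] at h
  linear_combination h

theorem powInt_sum_coord_sq (hp : 0 < p) (hq : 0 < q) (hγ : ∀ i, 0 < γ i) {z : ℂ} (hz : -1 < z.re)
    (φ : EvenTestFunction (Fin p ⊕ Fin q)) (s : Finset (Fin p ⊕ Fin q)) :
    ∑ i ∈ s, (formSign i : ℂ) * powInt γ z (fun x => (x i : ℂ) ^ 2 * φ x) =
      powInt γ z fun x => ((∑ i ∈ s, formSign i * x i ^ 2 : ℝ) : ℂ) * φ x := by
  simp_rw [← powInt_const_mul]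
  rw [← powInt_sum hp hq hγ hz]
  · congr 1; ext x; push_cast; rw [Finset.sum_mul]
    exact Finset.sum_congr rfl fun i _ => by ring
  · intro i
    have := (smooth φ).continuous
    fun_prop
  · intro i
    exact (compactSupport φ).mul_left.mul_left

theorem weightedDim_eq (γ : Fin p ⊕ Fin q → ℝ) : weightedDim γ = ∑ i, (γ i + 1) := by
  simp [weightedDim, Finset.sum_add_distrib, add_comm]

theorem weightedDim_eq_add (γ : Fin p ⊕ Fin q → ℝ) :
    weightedDim γ = weightedDimFst γ + weightedDimSnd γ := by
  simp [weightedDim, weightedDimFst, weightedDimSnd]; ring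

/-- Euler's relation in weak form: the terms `± x_i² P_+^(z-1)` add up to `P_+^z`. -/
theorem sum_powInt_coordDeriv (hp : 0 < p) (hq : 0 < q) (hγ : ∀ i, 0 < γ i) {z : ℂ} (hz : 1 < z.re)
    (φ : EvenTestFunction (Fin p ⊕ Fin q)) :
    ∑ i, powInt γ z (coordDeriv i φ) = -(2 * z + weightedDim γ) * powInt γ z φ := by
  simp_rw [powInt_coordDeriv hp hq hγ hz]
  have h1 : powInt γ (z - 1) (fun x => ((∑ i, formSign i * x i ^ 2 : ℝ) : ℂ) * φ x) =
      powInt γ z φ := by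
    unfold powInt
    congr 1; ext x
    rw [← mul_assoc, ← quadForm_eq_sum, posPow_sub_one_mul]
  have h2 := powInt_sum_coord_sq (γ := γ) (z := z - 1) hp hq hγ (by simp; linarith) φ Finset.univ
  rw [h1] at h2
  rw [Finset.sum_sub_distrib, ← Finset.sum_mul]
  simp_rw [mul_assoc (2 * z), ← Finset.mul_sum, h2]
  rw [weightedDim_eq, Finset.sum_neg_distrib]
  push_cast
  ring

/-- Integration by parts is applied to `g = (∂_i φ) / x_i`, for which `x_i ∂_i g + (γ_i + 1) g` is
the Bessel operator on `φ` and `x_i² g = x_i ∂_i φ`. -/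
theorem powInt_bessel (hp : 0 < p) (hq : 0 < q) (hγ : ∀ i, 0 < γ i) {z : ℂ} (hz : 0 < z.re)
    (φ : EvenTestFunction (Fin p ⊕ Fin q)) (i : Fin p ⊕ Fin q) :
    powInt γ (z + 1) (bessel (γ i) i φ) =
      -2 * (z + 1) * formSign i * powInt γ z (coordDeriv i φ) := by
  have hA := (smooth φ).derivQuotient i
  have hAs : HasCompactSupport (derivQuotient i φ) :=
    (compactSupport φ).of_isClosed_subset (isClosed_tsupport _)
      (tsupport_derivQuotient_subset (smooth φ) (parity φ i))
  have h := powInt_coord_mul_partialDeriv (z := z + 1) hp hq hγ (by simp; linarith) hA hAs i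
  have hmul : ∀ x : Fin p ⊕ Fin q → ℝ, (x i : ℂ) * derivQuotient i φ x = partialDeriv i φ x :=
    mul_derivQuotient (smooth φ) (parity φ i)
  have h1 : (fun x : Fin p ⊕ Fin q → ℝ => (x i : ℂ) ^ 2 * derivQuotient i φ x) =
      coordDeriv i φ := by
    ext x; rw [pow_two, mul_assoc, hmul, coordDeriv_apply]
  have h2 : (fun x : Fin p ⊕ Fin q → ℝ => (x i : ℂ) * partialDeriv i (derivQuotient i φ) x +
      (γ i + 1) * derivQuotient i φ x) = bessel (γ i) i φ := by
    ext x
    have h3 : partialDeriv i φ = fun x => (x i : ℂ) * derivQuotient i φ x :=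
      funext fun x => (hmul x).symm
    have h4 : partialDeriv i (partialDeriv i φ) x =
        x i * partialDeriv i (derivQuotient i φ) x + derivQuotient i φ x := by
      have h5 : HasFDerivAt (fun x : Fin p ⊕ Fin q → ℝ => (x i : ℂ))
          (Complex.ofRealCLM.comp (ContinuousLinearMap.proj i)) x :=
        (Complex.ofRealCLM.comp (ContinuousLinearMap.proj (R := ℝ) (φ := fun _ => ℝ) i)).hasFDerivAt
      have h6 := h5.mul ((hA.differentiable (by simp)) x).hasFDerivAt
      rw [h3]
      change fderiv ℝ ((fun x : Fin p ⊕ Fin q → ℝ => (x i : ℂ)) * derivQuotient i φ) x _ = _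
      rw [h6.fderiv]
      simp [partialDeriv]
    rw [bessel_apply, h4]
    ring
  rw [h1, h2, add_sub_cancel_right] at h
  exact h

/-- The signs in `L_B` cancel those created by the form, leaving the full Euler field, to which
`sum_powInt_coordDeriv` applies. The restriction on `z` is removed afterwards by analytic
continuation. -/
theorem powInt_ultraHyperbolic_of_re_pos (hp : 0 < p) (hq : 0 < q) (hγ : ∀ i, 0 < γ i) {z : ℂ}
    (hz : 1 < z.re) (φ : EvenTestFunction (Fin p ⊕ Fin q)) :
    powInt γ (z + 1) (ultraHyperbolic γ φ) =
      4 * (z + 1) * (z + weightedDim γ / 2) * powInt γ z φ := by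
  have h1 : (ultraHyperbolic γ φ : (Fin p ⊕ Fin q → ℝ) → ℂ) =
      fun x => ∑ i, (formSign i : ℂ) * bessel (γ i) i φ x :=
    funext (ultraHyperbolic_apply γ φ)
  rw [h1, powInt_sum (f := fun i x => (formSign i : ℂ) * bessel (γ i) i φ x) hp hq hγ
    (by simp; linarith) _ (fun i => continuous_const.mul (smooth (bessel (γ i) i φ)).continuous)
    (fun i => (compactSupport (bessel (γ i) i φ)).mul_left)]
  simp_rw [powInt_const_mul, powInt_bessel hp hq hγ (by linarith : 0 < z.re)]
  have h2 : ∀ i : Fin p ⊕ Fin q, (formSign i : ℂ) *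
      (-2 * (z + 1) * formSign i * powInt γ z (coordDeriv i φ)) =
      -2 * (z + 1) * powInt γ z (coordDeriv i φ) := fun i => by
    have : (formSign i : ℂ) * formSign i = 1 := by exact_mod_cast formSign_mul_self i
    linear_combination (-2 * (z + 1) * powInt γ z (coordDeriv i φ)) * this
  simp_rw [h2]
  rw [← Finset.mul_sum, sum_powInt_coordDeriv hp hq hγ hz]
  ring

theorem isPreconnected_re_gt (c : ℝ) : IsPreconnected {z : ℂ | c < z.re} :=
  (convex_halfSpace_re_gt c).isPreconnected

/-- The functional equation relating the exponents `z` and `z + 1`. -/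
theorem powInt_ultraHyperbolic (hp : 0 < p) (hq : 0 < q) (hγ : ∀ i, 0 < γ i) {z : ℂ}
    (hz : -1 < z.re) (φ : EvenTestFunction (Fin p ⊕ Fin q)) :
    powInt γ (z + 1) (ultraHyperbolic γ φ) =
      4 * (z + 1) * (z + weightedDim γ / 2) * powInt γ z φ := by
  have hf : AnalyticOnNhd ℂ (fun z => powInt γ (z + 1) (ultraHyperbolic γ φ)) {z | -1 < z.re} := by
    intro w hw
    have h1 : -1 < (w + 1).re := by
      have : -1 < w.re := hw
      simp; linarith
    exact (analyticAt_powInt hp hq hγ (ultraHyperbolic γ φ) h1).comp_of_eq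
      (g := fun z => powInt γ z (ultraHyperbolic γ φ)) (f := fun z => z + 1) (by fun_prop) rfl
  have hg : AnalyticOnNhd ℂ (fun z => 4 * (z + 1) * (z + weightedDim γ / 2) * powInt γ z φ)
      {z | -1 < z.re} := fun w hw =>
    AnalyticAt.mul (by fun_prop) (analyticAt_powInt hp hq hγ φ hw)
  refine hf.eqOn_of_preconnected_of_eventuallyEq hg (isPreconnected_re_gt _) (z₀ := 2)
    (by norm_num) ?_ hz
  filter_upwards [(isOpen_lt continuous_const Complex.continuous_re).mem_nhds
    (show (1 : ℝ) < (2 : ℂ).re by simp)] with w hw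
  exact powInt_ultraHyperbolic_of_re_pos hp hq hγ hw φ

end EvenTestFunction

/-! ### Raising the exponent away from the origin. -/

section Locality

/-- The inverse is taken of a smooth interpolation between the constant `δ`, used for `u ≤ δ/2`, and
`u` itself, used for `u ≥ δ`; this interpolation stays positive. -/
theorem exists_smooth_inv {δ : ℝ} (hδ : 0 < δ) :
    ∃ k : ℝ → ℝ, ContDiff ℝ ∞ k ∧ ∀ u, δ ≤ u → u * k u = 1 := by
  set s : ℝ → ℝ := fun u => Real.smoothTransition ((u - δ / 2) / (δ / 2))
  have hs : ContDiff ℝ ∞ s := Real.smoothTransition.contDiff.comp (by fun_prop)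
  have hpos : ∀ u, 0 < u * s u + δ * (1 - s u) := by
    intro u
    have h0 : 0 ≤ s u := Real.smoothTransition.nonneg _
    have h1 : s u ≤ 1 := Real.smoothTransition.le_one _
    rcases le_or_gt u (δ / 2) with h | h
    · have : s u = 0 := Real.smoothTransition.zero_of_nonpos
        (div_nonpos_of_nonpos_of_nonneg (by linarith) (by linarith))
      rw [this]; linarith
    · nlinarith
  refine ⟨fun u => (u * s u + δ * (1 - s u))⁻¹,
    ContDiff.inv (by fun_prop) fun u => (hpos u).ne', fun u hu => ?_⟩
  have : s u = 1 := Real.smoothTransition.one_of_one_le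
    ((one_le_div (by linarith)).2 (by linarith))
  have hu' : u ≠ 0 := by linarith
  simp only [this, mul_one, sub_self, mul_zero, add_zero]
  exact mul_inv_cancel₀ hu'

variable {p q : ℕ} {γ : Fin p ⊕ Fin q → ℝ}

theorem hasParity_comp_biSqNorm (k : ℝ × ℝ → ℂ) (i : Fin p ⊕ Fin q) :
    HasParity i 1 fun x => k (biSqNorm x) := by
  intro x
  have : biSqNorm (Function.update x i (-x i)) = biSqNorm x := by
    have h : ∀ j, Function.update x i (-x i) j ^ 2 = x j ^ 2 := fun j => by
      by_cases hj : j = i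
      · subst hj; simp
      · simp [hj]
    simp only [biSqNorm, sqNorm, h]
  simp only [this, one_smul]

open EvenTestFunction in
/-- Away from the origin the exponent can be raised without creating poles other than negative
integers. -/
theorem exists_powInt_eq_of_zero_notMem_tsupport (hp : 0 < p) (hq : 0 < q) (hγ : ∀ i, 0 < γ i)
    (φ : EvenTestFunction (Fin p ⊕ Fin q)) (h0 : (0 : Fin p ⊕ Fin q → ℝ) ∉ tsupport φ) :
    ∃ ψ : EvenTestFunction (Fin p ⊕ Fin q), (0 : Fin p ⊕ Fin q → ℝ) ∉ tsupport ψ ∧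
      ∀ z : ℂ, 1 < z.re → powInt γ z ψ = -z * powInt γ (z - 1) φ := by
  obtain ⟨r, hr, hφ⟩ := Metric.eventually_nhds_iff.1 (notMem_tsupport_iff_eventuallyEq.1 h0)
  -- Where `φ ≠ 0` one has `|x'|² + |x''|² ≥ r²`; together with `|x'|² > |x''|²` this forces `|x'|²
  -- ≥ r²/2`.
  obtain ⟨k, hk, hk1⟩ := exists_smooth_inv (δ := r ^ 2 / 2) (by positivity)
  set K : (Fin p ⊕ Fin q → ℝ) → ℂ := fun x => ((k (biSqNorm x).1 / 2 : ℝ) : ℂ)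
  have hKs : ContDiff ℝ ∞ K := Complex.ofRealCLM.contDiff.comp
    ((hk.comp contDiff_biSqNorm.fst).div_const 2)
  have hKp : ∀ i, HasParity i 1 K :=
    hasParity_comp_biSqNorm fun y => ((k y.1 / 2 : ℝ) : ℂ)
  set g := mulEven K hKs hKp φ with hg
  -- Only the first group of variables is used, so integration by parts gives `-2 z |x'|² g`. As `g`
  -- is `φ / (2 |x'|²)` on the relevant set, this is `-z φ`.
  refine ⟨∑ i : Fin p, (coordDeriv (Sum.inl i) g + ((γ (Sum.inl i) : ℂ) + 1) • g), ?_, fun z hz => ?_⟩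
  · rw [notMem_tsupport_iff_eventuallyEq]
    have hg0 : (0 : Fin p ⊕ Fin q → ℝ) ∉ tsupport g := fun h => h0 (tsupport_mul_subset_right h)
    have h1 : ∀ᶠ x in 𝓝 (0 : Fin p ⊕ Fin q → ℝ), x ∉ tsupport g :=
      (isClosed_tsupport _).isOpen_compl.mem_nhds hg0
    filter_upwards [h1] with x hx
    have h2 : ∀ i, coordDeriv i g x = 0 := fun i =>
      image_eq_zero_of_notMem_tsupport fun h => hx (tsupport_coordDeriv_subset i g h)
    have h3 : g x = 0 := image_eq_zero_of_notMem_tsupport hx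
    simp [Finset.sum_apply, h2, h3]
  · have I1 : ∀ i, Integrable (fun x => posPow z (quadForm x) * coordDeriv i g x) (weightMeasure γ) :=
      fun i => integrable_posPow_mul (γ := γ) (z := z) hp hq hγ (by linarith)
        (smooth (coordDeriv i g)).continuous (compactSupport (coordDeriv i g))
    have I2 := integrable_posPow_mul (γ := γ) (z := z) hp hq hγ (by linarith)
      (smooth g).continuous (compactSupport g)
    have h1 : powInt γ z (∑ i : Fin p, (coordDeriv (Sum.inl i) g + ((γ (Sum.inl i) : ℂ) + 1) • g) :
        EvenTestFunction (Fin p ⊕ Fin q)) =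
        ∑ i : Fin p, (powInt γ z (coordDeriv (Sum.inl i) g) +
          ((γ (Sum.inl i) : ℂ) + 1) * powInt γ z g) := by
      simp only [powInt]
      simp_rw [← integral_const_mul]
      have : ∀ i : Fin p, Integrable (fun x => ((γ (Sum.inl i) : ℂ) + 1) *
        (posPow z (quadForm x) * g x)) (weightMeasure γ) := fun i => I2.const_mul _
      simp_rw [← fun i : Fin p => integral_add (I1 (Sum.inl i)) (this i)]
      rw [← integral_finsetSum (f := fun (i : Fin p) x =>
        posPow z (quadForm x) * coordDeriv (Sum.inl i) g x +
          ((γ (Sum.inl i) : ℂ) + 1) * (posPow z (quadForm x) * g x)) _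
        fun i _ => (I1 (Sum.inl i)).add (this i)]
      congr 1; ext x
      simp only [Submodule.coe_sum, Finset.sum_apply, Submodule.coe_add, Submodule.coe_smul,
        Pi.add_apply, Pi.smul_apply, smul_eq_mul, Finset.mul_sum]
      exact Finset.sum_congr rfl fun i _ => by ring
    rw [h1]
    have h2 : ∀ i : Fin p, powInt γ z (coordDeriv (Sum.inl i) g) +
        ((γ (Sum.inl i) : ℂ) + 1) * powInt γ z g =
        -2 * z * (formSign (Sum.inl i : Fin p ⊕ Fin q) *
          powInt γ (z - 1) fun x => (x (Sum.inl i) : ℂ) ^ 2 * g x) := fun i => by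
      rw [powInt_coordDeriv hp hq hγ hz]; ring
    simp_rw [h2]
    rw [← Finset.mul_sum]
    have h3 := powInt_sum_coord_sq (γ := γ) (z := z - 1) hp hq hγ (by simp; linarith) g
      (Finset.univ.map ⟨Sum.inl, Sum.inl_injective⟩)
    rw [Finset.sum_map] at h3
    simp only [Function.Embedding.coeFn_mk, Finset.sum_map] at h3
    rw [h3]
    have h4 : powInt γ (z - 1) (fun x =>
        ((∑ i : Fin p, formSign (Sum.inl i : Fin p ⊕ Fin q) * x (Sum.inl i) ^ 2 : ℝ) : ℂ) * g x) =
        2⁻¹ * powInt γ (z - 1) φ := by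
      rw [← powInt_const_mul]
      unfold powInt
      congr 1; ext x
      by_cases hP : 0 < quadForm x
      · by_cases hx : φ x = 0
        · simp [hg, mulEven_apply, hx]
        · have hd : r ≤ ‖x‖ := by
            by_contra h
            exact hx (hφ (by simpa using not_le.1 h))
          have h5 : r ^ 2 ≤ (biSqNorm x).1 + (biSqNorm x).2 := by
            by_contra hlt
            rw [not_le] at hlt
            refine absurd hd (not_le.2 ((pi_norm_lt_iff hr).2 fun j => ?_))
            rw [Real.norm_eq_abs]
            refine abs_lt_of_sq_lt_sq (lt_of_le_of_lt ?_ hlt) hr.le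
            rcases j with j | j
            · exact le_add_of_le_of_nonneg
                (Finset.single_le_sum (f := fun i => x (Sum.inl i) ^ 2)
                  (fun _ _ => sq_nonneg _) (Finset.mem_univ j)) (sqNorm_nonneg fun j => x (Sum.inr j))
            · exact le_add_of_nonneg_of_le (sqNorm_nonneg fun i => x (Sum.inl i))
                (Finset.single_le_sum (f := fun i => x (Sum.inr i) ^ 2)
                  (fun _ _ => sq_nonneg _) (Finset.mem_univ j))
          have h6 : r ^ 2 / 2 ≤ (biSqNorm x).1 := by
            rw [quadForm_eq_biSqNorm] at hP; linarith
          have h7 : (((biSqNorm x).1 : ℝ) : ℂ) * (k (biSqNorm x).1 : ℝ) = 1 := by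
            exact_mod_cast hk1 _ h6
          have h8 : (∑ i : Fin p, formSign (Sum.inl i : Fin p ⊕ Fin q) * x (Sum.inl i) ^ 2 : ℝ) =
              (biSqNorm x).1 := by simp [formSign, biSqNorm, sqNorm]
          simp only [h8, hg, mulEven_apply, K]
          push_cast
          linear_combination (posPow (z - 1) (quadForm x) * φ x / 2) * h7
      · simp [posPow, hP]
    rw [h4]
    ring

end Locality

/-! ### Identity theorem for meromorphic functions on the plane. -/

section Uniqueness

/-- Meromorphic functions on the plane which agree on a right half-plane agree. -/
theorem MeromorphicAt.eventuallyEq_of_re_gt {F G : ℂ → ℂ} (hF : ∀ z, MeromorphicAt F z)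
    (hG : ∀ z, MeromorphicAt G z) {R : ℝ} (h : ∀ z : ℂ, R < z.re → F z = G z) (z₀ : ℂ) :
    F =ᶠ[𝓝[≠] z₀] G := by
  have hm : MeromorphicOn (F - G) Set.univ := fun z _ => (hF z).sub (hG z)
  have htop : meromorphicOrderAt (F - G) ((R + 1 : ℝ) : ℂ) = ⊤ := by
    rw [meromorphicOrderAt_eq_top_iff]
    refine Filter.Eventually.filter_mono nhdsWithin_le_nhds ?_
    filter_upwards [(isOpen_lt continuous_const Complex.continuous_re).mem_nhds
      (show R < ((R + 1 : ℝ) : ℂ).re by simp)] with w hw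
    rw [Pi.sub_apply, h w hw, sub_self]
  have : meromorphicOrderAt (F - G) z₀ = ⊤ := by
    by_contra hne
    exact hm.meromorphicOrderAt_ne_top_of_isPreconnected isPreconnected_univ (Set.mem_univ z₀)
      (Set.mem_univ _) hne htop
  rw [meromorphicOrderAt_eq_top_iff] at this
  filter_upwards [this] with z hz
  exact sub_eq_zero.1 hz

theorem eventually_nhdsNE_ne (z₀ c : ℂ) : ∀ᶠ z in 𝓝[≠] z₀, z ≠ c := by
  rcases eq_or_ne z₀ c with rfl | h
  · exact self_mem_nhdsWithin
  · exact (eventually_ne_nhds h).filter_mono nhdsWithin_le_nhds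

end Uniqueness

/-! ### The denominators of the continuation. -/

section ContinuationFactor

/-- The product of the factors of the functional equation. -/
noncomputable def contFactor (d : ℝ) (N : ℕ) (z : ℂ) : ℂ :=
  ∏ i ∈ Finset.range N, 4 * (z + 1 + i) * (z + d / 2 + i)

theorem contFactor_add (d : ℝ) (N j : ℕ) (z : ℂ) :
    contFactor d (N + j) z = contFactor d N z * contFactor d j (z + N) := by
  rw [contFactor, contFactor, contFactor, Finset.prod_range_add]
  congr 1
  refine Finset.prod_congr rfl fun i _ => ?_
  push_cast
  ring

theorem contFactor_succ (d : ℝ) (N : ℕ) (z : ℂ) :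
    contFactor d (N + 1) z = contFactor d N z * (4 * (z + N + 1) * (z + N + d / 2)) := by
  rw [contFactor_add]
  congr 1
  simp [contFactor]

theorem differentiable_contFactor (d : ℝ) (N : ℕ) : Differentiable ℂ (contFactor d N) := by
  unfold contFactor; fun_prop

theorem analyticAt_contFactor (d : ℝ) (N : ℕ) (z : ℂ) : AnalyticAt ℂ (contFactor d N) z :=
  (differentiable_contFactor d N).analyticAt z

theorem eventually_contFactor_ne_zero (d : ℝ) (N : ℕ) (z₀ : ℂ) :
    ∀ᶠ z in 𝓝[≠] z₀, contFactor d N z ≠ 0 := by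
  unfold contFactor
  simp only [Finset.prod_ne_zero_iff]
  refine (Filter.eventually_all_finset _).2 fun i _ => ?_
  filter_upwards [eventually_nhdsNE_ne z₀ (-1 - i), eventually_nhdsNE_ne z₀ (-d / 2 - i)] with z h1 h2
  refine mul_ne_zero (mul_ne_zero (by norm_num) fun h => h1 ?_) fun h => h2 ?_
  · linear_combination h
  · linear_combination h

end ContinuationFactor

/-! ### The meromorphic continuation and its uniqueness. -/

section Continuation

open EvenTestFunction

variable {p q : ℕ} {γ : Fin p ⊕ Fin q → ℝ}

theorem powInt_ultraHyperbolic_pow (hp : 0 < p) (hq : 0 < q) (hγ : ∀ i, 0 < γ i) {z : ℂ}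
    (hz : -1 < z.re) (φ : EvenTestFunction (Fin p ⊕ Fin q)) (j : ℕ) :
    powInt γ (z + j) ((ultraHyperbolic γ ^ j) φ) =
      contFactor (weightedDim γ) j z * powInt γ z φ := by
  induction j with
  | zero => simp [contFactor]
  | succ j ih =>
    have h : -1 < (z + j).re := by
      have : (0 : ℝ) ≤ j := j.cast_nonneg
      simp; linarith
    rw [pow_succ', Module.End.mul_apply, Nat.cast_succ, ← add_assoc,
      powInt_ultraHyperbolic hp hq hγ h, ih, contFactor_succ]
    ring

/-- The meromorphic continuation of `powInt`. -/
noncomputable def powCont (γ : Fin p ⊕ Fin q → ℝ) (z : ℂ) (φ : EvenTestFunction (Fin p ⊕ Fin q)) : ℂ :=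
  powInt γ (z + (⌊-z.re⌋₊ : ℕ)) ((ultraHyperbolic γ ^ ⌊-z.re⌋₊) φ) /
    contFactor (weightedDim γ) ⌊-z.re⌋₊ z

theorem powCont_eq_powInt {z : ℂ} (hz : -1 < z.re) (φ : EvenTestFunction (Fin p ⊕ Fin q)) :
    powCont γ z φ = powInt γ z φ := by
  have : ⌊-z.re⌋₊ = 0 := Nat.floor_eq_zero.2 (by linarith)
  rw [powCont, this]
  simp [contFactor]

/-- `powCont` uses a number of steps that jumps with `z`. Additional steps multiply numerator and
denominator by the same nonzero factor, so near a given point one fixed `M` can serve. -/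
theorem powCont_eq_div (hp : 0 < p) (hq : 0 < q) (hγ : ∀ i, 0 < γ i) {z : ℂ} {M : ℕ}
    (hz : -1 < z.re + M) (h0 : contFactor (weightedDim γ) M z ≠ 0)
    (φ : EvenTestFunction (Fin p ⊕ Fin q)) :
    powCont γ z φ =
      powInt γ (z + M) ((ultraHyperbolic γ ^ M) φ) / contFactor (weightedDim γ) M z := by
  have hle : ⌊-z.re⌋₊ ≤ M := by
    rw [← Nat.lt_succ_iff]
    refine (Nat.floor_lt' (Nat.succ_ne_zero M)).2 ?_
    push_cast; linarith
  have hlt := Nat.lt_floor_add_one (-z.re)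
  set N := ⌊-z.re⌋₊ with hN
  obtain ⟨j, rfl⟩ := Nat.exists_eq_add_of_le hle
  have h1 : -1 < (z + N).re := by simp; linarith
  have h2 := powInt_ultraHyperbolic_pow hp hq hγ h1 ((ultraHyperbolic γ ^ N) φ) j
  rw [contFactor_add] at h0 ⊢
  have h3 : (ultraHyperbolic γ ^ (N + j)) φ = (ultraHyperbolic γ ^ j) ((ultraHyperbolic γ ^ N) φ) := by
    rw [add_comm, pow_add, Module.End.mul_apply]
  rw [powCont, ← hN, h3, Nat.cast_add, ← add_assoc, h2, mul_comm (contFactor _ N z),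
    mul_div_mul_left _ _ (right_ne_zero_of_mul h0)]

theorem eventually_powCont_eq_div (hp : 0 < p) (hq : 0 < q) (hγ : ∀ i, 0 < γ i) {z₀ : ℂ} {M : ℕ}
    (hz : -1 < z₀.re + M) (φ : EvenTestFunction (Fin p ⊕ Fin q)) :
    (fun z => powCont γ z φ) =ᶠ[𝓝[≠] z₀] fun z =>
      powInt γ (z + M) ((ultraHyperbolic γ ^ M) φ) / contFactor (weightedDim γ) M z := by
  filter_upwards [eventually_contFactor_ne_zero (weightedDim γ) M z₀,
    mem_nhdsWithin_of_mem_nhds ((isOpen_lt (f := fun _ : ℂ => (-1 : ℝ)) (g := fun z : ℂ => z.re + M)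
      continuous_const (Complex.continuous_re.add continuous_const)).mem_nhds hz)] with z h0 h1
  exact powCont_eq_div hp hq hγ h1 h0 φ

theorem analyticAt_powInt_add (hp : 0 < p) (hq : 0 < q) (hγ : ∀ i, 0 < γ i) {z : ℂ} {M : ℕ}
    (hz : -1 < z.re + M) (φ : EvenTestFunction (Fin p ⊕ Fin q)) :
    AnalyticAt ℂ (fun z => powInt γ (z + M) φ) z :=
  (EvenTestFunction.analyticAt_powInt hp hq hγ φ (z := z + M) (by simpa using hz)).comp_of_eq
    (g := fun z => powInt γ z φ) (f := fun z => z + M) (by fun_prop) rfl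

theorem meromorphicAt_powCont (hp : 0 < p) (hq : 0 < q) (hγ : ∀ i, 0 < γ i) (z₀ : ℂ)
    (φ : EvenTestFunction (Fin p ⊕ Fin q)) : MeromorphicAt (fun z => powCont γ z φ) z₀ := by
  obtain ⟨M, hM⟩ := exists_nat_gt (-z₀.re)
  have hz : -1 < z₀.re + M := by linarith
  exact ((analyticAt_powInt_add hp hq hγ hz _).meromorphicAt.div
    (analyticAt_contFactor _ M z₀).meromorphicAt).congr (eventually_powCont_eq_div hp hq hγ hz φ).symm

/-- Functionals bounded by the supremum of the test function yield distributions when composed with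
powers of the ultra-hyperbolic operator. -/
theorem isWeightedDistribution_of_sup_bound {T : EvenTestFunction (Fin p ⊕ Fin q) → ℂ}
    (hT : IsLinearMap ℂ T)
    (hb : ∀ K : Set (Fin p ⊕ Fin q → ℝ), IsCompact K → ∃ C, 0 ≤ C ∧
      ∀ (φ : EvenTestFunction (Fin p ⊕ Fin q)) (M : ℝ), tsupport φ ⊆ K → (∀ x, ‖φ x‖ ≤ M) →
        ‖T φ‖ ≤ C * M) (N : ℕ) (c : ℂ) :
    IsWeightedDistribution fun φ => c * T ((ultraHyperbolic γ ^ N) φ) := by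
  refine ⟨⟨fun φ ψ => ?_, fun a φ => ?_⟩, fun K hK => ?_⟩
  · rw [map_add, hT.map_add, mul_add]
  · rw [map_smul, hT.map_smul, smul_eq_mul, smul_eq_mul]; ring
  obtain ⟨C, hC0, hC⟩ := hb K hK
  refine ⟨‖c‖ * (C * (∑ i, (1 + |γ i|)) ^ N), 2 * N, fun φ hφ => ?_⟩
  set S := ⨆ x, ‖iteratedFDeriv ℝ (2 * N) φ x‖ with hS
  have h1 : ∀ x, ‖iteratedFDeriv ℝ (2 * N) φ x‖ ≤ S := fun x =>
    le_ciSup (bddAbove_norm_iteratedFDeriv φ (2 * N)) x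
  have h2 := hC ((ultraHyperbolic γ ^ N) φ) _ ((tsupport_ultraHyperbolic_pow_subset γ N φ).trans hφ)
    (norm_ultraHyperbolic_pow_le γ N φ h1)
  have h3 : S ≤ ∑ j ∈ Finset.range (2 * N + 1), ⨆ x, ‖iteratedFDeriv ℝ j φ x‖ :=
    Finset.single_le_sum (f := fun j => ⨆ x, ‖iteratedFDeriv ℝ j φ x‖)
      (fun j _ => Real.iSup_nonneg fun x => norm_nonneg _)
      (Finset.mem_range.2 (Nat.lt_succ_self _))
  have h4 : 0 ≤ ∑ i, (1 + |γ i|) := Finset.sum_nonneg fun i _ => by positivity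
  rw [norm_mul]
  calc ‖c‖ * ‖T ((ultraHyperbolic γ ^ N) φ)‖
      ≤ ‖c‖ * (C * ((∑ i, (1 + |γ i|)) ^ N * S)) := by gcongr
    _ = ‖c‖ * (C * (∑ i, (1 + |γ i|)) ^ N) * S := by ring
    _ ≤ _ := by gcongr

theorem isLinearMap_powInt (hp : 0 < p) (hq : 0 < q) (hγ : ∀ i, 0 < γ i) {z : ℂ} (hz : -1 < z.re) :
    IsLinearMap ℂ fun φ : EvenTestFunction (Fin p ⊕ Fin q) => powInt γ z φ := by
  refine ⟨fun φ ψ => ?_, fun a φ => ?_⟩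
  · have I : ∀ φ : EvenTestFunction (Fin p ⊕ Fin q), Integrable (fun x => posPow z (quadForm x) * φ x)
      (weightMeasure γ) := fun φ =>
      integrable_posPow_mul hp hq hγ hz (smooth φ).continuous (compactSupport φ)
    unfold powInt
    rw [← integral_add (I φ) (I ψ)]
    congr 1; ext x; rw [Submodule.coe_add, Pi.add_apply]; ring
  · rw [smul_eq_mul, ← powInt_const_mul]
    rfl

theorem isWeightedDistribution_powInt (hp : 0 < p) (hq : 0 < q) (hγ : ∀ i, 0 < γ i) {z : ℂ}
    (hz : -1 < z.re) (N : ℕ) (c : ℂ) :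
    IsWeightedDistribution fun φ => c * powInt γ z ((ultraHyperbolic γ ^ N) φ) := by
  refine isWeightedDistribution_of_sup_bound (T := fun φ => powInt γ z φ)
    (isLinearMap_powInt hp hq hγ hz) (fun K hK => ?_) N c
  obtain ⟨R, hR⟩ := exists_isAdmissible_of_isCompact hK
  refine ⟨∫ x, cutPower z.re R x ∂(weightMeasure γ), integral_nonneg (cutPower_nonneg z.re R), fun φ M hs hM => ?_⟩
  rw [mul_comm]
  exact (hR M φ (smooth φ).continuous.measurable hM hs).norm_powInt_le hp hq hγ hz

/-- This is the kind of distribution left at a removable pole. Linearity is inherited from `powInt`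
through uniqueness of derivatives. -/
theorem isWeightedDistribution_powLogInt (hp : 0 < p) (hq : 0 < q) (hγ : ∀ i, 0 < γ i) {z : ℂ}
    (hz : -1 < z.re) (N : ℕ) (c : ℂ) :
    IsWeightedDistribution fun φ => c * powLogInt γ z ((ultraHyperbolic γ ^ N) φ) := by
  refine isWeightedDistribution_of_sup_bound (T := fun φ => powLogInt γ z φ) ?_ (fun K hK => ?_) N c
  · have hd : ∀ φ : EvenTestFunction (Fin p ⊕ Fin q),
        HasDerivAt (fun z => powInt γ z φ) (powLogInt γ z φ) z := fun φ => by
      obtain ⟨M, R, h⟩ := EvenTestFunction.exists_isAdmissible φ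
      exact h.hasDerivAt_powInt hp hq hγ hz
    have hev : ∀ᶠ w : ℂ in 𝓝 z, -1 < w.re :=
      (isOpen_lt continuous_const Complex.continuous_re).mem_nhds hz
    refine ⟨fun φ ψ => ?_, fun a φ => ?_⟩
    · refine (hd (φ + ψ)).unique (((hd φ).add (hd ψ)).congr_of_eventuallyEq ?_)
      filter_upwards [hev] with w hw
      exact (isLinearMap_powInt hp hq hγ hw).map_add φ ψ
    · refine (hd (a • φ)).unique (((hd φ).const_mul a).congr_of_eventuallyEq ?_)
      filter_upwards [hev] with w hw
      exact (isLinearMap_powInt hp hq hγ hw).map_smul a φ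
  · obtain ⟨R, hR⟩ := exists_isAdmissible_of_isCompact hK
    obtain ⟨ε, hε, hε'⟩ : ∃ ε : ℝ, 0 < ε ∧ -1 < z.re - ε :=
      ⟨(z.re + 1) / 2, by linarith, by linarith⟩
    refine ⟨∫ x, 2 / ε * (cutPower (z.re - ε) R x + cutPower (z.re + ε) R x) ∂(weightMeasure γ),
      integral_nonneg fun x => mul_nonneg (by positivity : 0 ≤ 2 / ε)
      (add_nonneg (cutPower_nonneg (z.re - ε) R x) (cutPower_nonneg (z.re + ε) R x)),
      fun φ M hs hM => ?_⟩
    rw [mul_comm]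
    exact (hR M φ (smooth φ).continuous.measurable hM hs).norm_powLogInt_le hp hq hγ hε' hε
      (by linarith) (by linarith)

theorem weight_smul_posPow_eq_indicator (hγ : ∀ i, 0 < γ i) (z : ℂ)
    (φ : EvenTestFunction (Fin p ⊕ Fin q)) :
    (fun x => weight γ x • (posPow z (quadForm x) * φ x)) =
      (positivePart p q).indicator (powerIntegrand γ z φ) := by
  ext x
  by_cases hx : x ∈ positivePart p q
  · rw [Set.indicator_of_mem hx, weight_eq_of_pos γ hx.1, posPow, if_pos hx.2, powerIntegrand,
      Complex.real_smul]
    ring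
  · rw [Set.indicator_of_notMem hx]
    by_cases h : ∀ i, 0 < x i
    · rw [posPow, if_neg fun h' => hx ⟨h, h'⟩, zero_mul, smul_zero]
    · push Not at h
      obtain ⟨i, hi⟩ := h
      rw [weight_eq_zero hγ hi, zero_smul]

theorem measurableSet_positivePart (p q : ℕ) : MeasurableSet (positivePart p q) := by
  have : positivePart p q = (⋂ i, {x | 0 < x i}) ∩ {x | 0 < quadForm x} := by
    ext x; simp [positivePart]
  rw [this]
  exact (MeasurableSet.iInter fun i => measurableSet_lt measurable_const (measurable_pi_apply i)).inter
    (measurableSet_lt measurable_const continuous_quadForm.measurable)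

theorem isPowerContinuation_powCont (hp : 0 < p) (hq : 0 < q) (hγ : ∀ i, 0 < γ i) :
    IsPowerContinuation γ (powCont γ) := by
  refine ⟨fun z hz φ => ?_, fun z₀ => ?_, fun z₀ φ => meromorphicAt_powCont hp hq hγ z₀ φ⟩
  · have I := (integrable_weightMeasure_iff γ _).1
      (integrable_posPow_mul hp hq hγ hz (smooth φ).continuous (compactSupport φ))
    rw [weight_smul_posPow_eq_indicator hγ, integrable_indicator_iff (measurableSet_positivePart p q)] at I
    refine ⟨I, ?_⟩
    rw [powCont_eq_powInt hz, powInt, integral_weightMeasure, weight_smul_posPow_eq_indicator hγ,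
      integral_indicator (measurableSet_positivePart p q)]
  · obtain ⟨M, hM⟩ := exists_nat_gt (-z₀.re)
    have hU : IsOpen {z : ℂ | -1 < z.re + M} :=
      isOpen_lt continuous_const (Complex.continuous_re.add continuous_const)
    filter_upwards [eventually_contFactor_ne_zero (weightedDim γ) M z₀,
      mem_nhdsWithin_of_mem_nhds (hU.mem_nhds (show -1 < z₀.re + M by linarith))] with z h0 h1
    constructor
    · have h2 : -1 < (z + (⌊-z.re⌋₊ : ℕ)).re := by
        have := Nat.lt_floor_add_one (-z.re)
        simp; linarith
      have := isWeightedDistribution_powInt hp hq hγ h2 ⌊-z.re⌋₊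
        (contFactor (weightedDim γ) ⌊-z.re⌋₊ z)⁻¹
      convert! this using 2
      rw [powCont, div_eq_inv_mul]
    · intro φ
      refine ((analyticAt_powInt_add hp hq hγ h1 ((ultraHyperbolic γ ^ M) φ)).div
        (analyticAt_contFactor _ M z) h0).congr ?_
      filter_upwards [hU.mem_nhds h1, (analyticAt_contFactor (weightedDim γ) M z).continuousAt.eventually_ne h0]
        with w hw1 hw0
      exact (powCont_eq_div hp hq hγ hw1 hw0 φ).symm

/-- Two continuations share the integral on `Re z > -1`, so all limits may be computed with
`powCont`. -/
theorem IsPowerContinuation.eventuallyEq_powCont (hp : 0 < p) (hq : 0 < q) (hγ : ∀ i, 0 < γ i)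
    {P : ℂ → EvenTestFunction (Fin p ⊕ Fin q) → ℂ} (hP : IsPowerContinuation γ P) (z₀ : ℂ)
    (φ : EvenTestFunction (Fin p ⊕ Fin q)) :
    (fun z => P z φ) =ᶠ[𝓝[≠] z₀] fun z => powCont γ z φ := by
  have hQ := isPowerContinuation_powCont hp hq hγ
  refine MeromorphicAt.eventuallyEq_of_re_gt (fun z => hP.2.2 z φ) (fun z => hQ.2.2 z φ) (R := -1)
    (fun z hz => ?_) z₀
  rw [(hP.1 z hz φ).2, (hQ.1 z hz φ).2]

end Continuation

/-! ### Dilations, and distributions supported at the origin. -/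

namespace EvenTestFunction

section Dilation

variable {ι : Type} [Fintype ι] [DecidableEq ι]

/-- The dilation `x ↦ φ (r x)` of a test function. -/
noncomputable def dilate (r : ℝ) (hr : r ≠ 0) (φ : EvenTestFunction ι) : EvenTestFunction ι :=
  ⟨fun x => φ (r • x), (smooth φ).comp (contDiff_id.const_smul r),
    (compactSupport φ).comp_smul hr, fun i x => by
      have h : r • Function.update x i (-x i) = Function.update (r • x) i (-(r • x) i) := by
        ext j
        by_cases hj : j = i
        · subst hj; simp
        · simp [hj]
      have := parity φ i (r • x)
      rw [one_smul] at this
      simp only [h, this]⟩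

theorem dilate_apply {r : ℝ} (hr : r ≠ 0) (φ : EvenTestFunction ι) (x : ι → ℝ) :
    dilate r hr φ x = φ (r • x) := rfl

theorem norm_iteratedFDeriv_dilate_le {r : ℝ} (hr : 0 < r) (φ : EvenTestFunction ι) (j : ℕ)
    (x : ι → ℝ) : ‖iteratedFDeriv ℝ j (dilate r hr.ne' φ) x‖ ≤
      r ^ j * ‖iteratedFDeriv ℝ j φ (r • x)‖ := by
  set T : (ι → ℝ) →L[ℝ] (ι → ℝ) := r • ContinuousLinearMap.id ℝ (ι → ℝ) with hT
  have hT' : ‖T‖ ≤ r := by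
    refine T.opNorm_le_bound hr.le fun y => ?_
    simp [hT, norm_smul, abs_of_pos hr]
  have h := T.iteratedFDeriv_comp_right (smooth φ) x (i := j) (by exact_mod_cast le_top)
  have h2 : (dilate r hr.ne' φ : (ι → ℝ) → ℂ) = φ ∘ T := rfl
  rw [h2, h]
  refine (ContinuousMultilinearMap.norm_compContinuousLinearMap_le _ _).trans ?_
  rw [Finset.prod_const, Finset.card_univ, Fintype.card_fin, mul_comm]
  exact mul_le_mul_of_nonneg_right (pow_le_pow_left₀ (norm_nonneg _) hT' j) (norm_nonneg _)

end Dilation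

variable {p q : ℕ}

/-- A test function equal to one near the origin. -/
noncomputable def cutoff : EvenTestFunction (Fin p ⊕ Fin q) :=
  ⟨fun x => ((Real.smoothTransition (2 - (biSqNorm x).1) *
      Real.smoothTransition (3 - (biSqNorm x).2) : ℝ) : ℂ),
    Complex.ofRealCLM.contDiff.comp
      ((Real.smoothTransition.contDiff.comp (contDiff_const.sub contDiff_biSqNorm.fst)).mul
        (Real.smoothTransition.contDiff.comp (contDiff_const.sub contDiff_biSqNorm.snd))), by
    refine HasCompactSupport.intro (isCompact_closedBall (0 : Fin p ⊕ Fin q → ℝ) 2) fun x hx => ?_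
    by_contra hne
    have h1 : (biSqNorm x).1 < 2 := by
      by_contra h
      exact hne (by rw [Real.smoothTransition.zero_of_nonpos (by linarith)]; simp)
    have h2 : (biSqNorm x).2 < 3 := by
      by_contra h
      exact hne (by rw [Real.smoothTransition.zero_of_nonpos (x := 3 - _) (by linarith)]; simp)
    refine hx (mem_closedBall_zero_iff.2 ((pi_norm_le_iff_of_nonneg (by norm_num)).2 fun i => ?_))
    rw [Real.norm_eq_abs]
    refine (abs_lt_of_sq_lt_sq ?_ (by norm_num)).le
    rcases i with i | i
    · have := Finset.single_le_sum (f := fun i => x (Sum.inl i) ^ 2)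
        (fun _ _ => sq_nonneg _) (Finset.mem_univ i)
      simp only [biSqNorm, sqNorm] at h1
      linarith
    · have := Finset.single_le_sum (f := fun i => x (Sum.inr i) ^ 2)
        (fun _ _ => sq_nonneg _) (Finset.mem_univ i)
      simp only [biSqNorm, sqNorm] at h2
      linarith,
    fun i x => by
      have := hasParity_comp_biSqNorm (fun y => ((Real.smoothTransition (2 - y.1) *
        Real.smoothTransition (3 - y.2) : ℝ) : ℂ)) i x
      rwa [one_smul] at this⟩

theorem cutoff_apply (x : Fin p ⊕ Fin q → ℝ) :
    cutoff x = ((Real.smoothTransition (2 - (biSqNorm x).1) *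
      Real.smoothTransition (3 - (biSqNorm x).2) : ℝ) : ℂ) := rfl

theorem eventually_cutoff_eq_one : ∀ᶠ x : Fin p ⊕ Fin q → ℝ in 𝓝 0, cutoff x = 1 := by
  have h0 : biSqNorm (0 : Fin p ⊕ Fin q → ℝ) = 0 := by ext <;> simp [biSqNorm, sqNorm]
  have h1 : ∀ᶠ x : Fin p ⊕ Fin q → ℝ in 𝓝 0, (biSqNorm x).1 < 1 :=
    contDiff_biSqNorm.continuous.fst.continuousAt.eventually_lt continuousAt_const (by simp [h0])
  have h2 : ∀ᶠ x : Fin p ⊕ Fin q → ℝ in 𝓝 0, (biSqNorm x).2 < 1 :=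
    contDiff_biSqNorm.continuous.snd.continuousAt.eventually_lt continuousAt_const (by simp [h0])
  filter_upwards [h1, h2] with x h1 h2
  rw [cutoff_apply, Real.smoothTransition.one_of_one_le (by linarith),
    Real.smoothTransition.one_of_one_le (by linarith)]
  simp

theorem cutoff_zero : cutoff (0 : Fin p ⊕ Fin q → ℝ) = 1 :=
  (eventually_cutoff_eq_one (p := p) (q := q)).self_of_nhds

/-- A distribution supported at the origin and homogeneous of the degree of the delta distribution is
a multiple of the latter. -/
theorem eq_apply_zero_mul_cutoff {T : EvenTestFunction (Fin p ⊕ Fin q) → ℂ}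
    (hT : IsWeightedDistribution T)
    (hloc : ∀ φ : EvenTestFunction (Fin p ⊕ Fin q), (0 : Fin p ⊕ Fin q → ℝ) ∉ tsupport φ → T φ = 0)
    (hscale : ∀ (r : ℝ) (hr : 0 < r) (φ : EvenTestFunction (Fin p ⊕ Fin q)),
      T (dilate r hr.ne' φ) = T φ) (φ : EvenTestFunction (Fin p ⊕ Fin q)) :
    T φ = φ 0 * T cutoff := by
  set χ : EvenTestFunction (Fin p ⊕ Fin q) := cutoff with hχ
  -- It remains to treat functions vanishing at the origin. Contracting such a function makes it
  -- `O(r)` on the support of `χ` together with all its derivatives, while `T` does not notice the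
  -- contraction.
  set ψ : EvenTestFunction (Fin p ⊕ Fin q) := φ - φ 0 • χ with hψ
  have hψ0 : ψ 0 = 0 := by
    simp only [hψ, hχ, Submodule.coe_sub, Submodule.coe_smul, Pi.sub_apply, Pi.smul_apply, cutoff_zero]
    simp
  suffices T ψ = 0 by
    rw [hψ, hT.1.map_sub, hT.1.map_smul, smul_eq_mul] at this
    exact sub_eq_zero.1 this
  obtain ⟨C, N, hC⟩ := hT.2 (tsupport χ) χ.2.2.1
  obtain ⟨R, hR0, hR⟩ : ∃ R : ℝ, 0 < R ∧ ∀ x ∈ tsupport χ, ‖x‖ ≤ R := by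
    obtain ⟨R, hR0, hR⟩ := (compactSupport χ).isCompact.isBounded.exists_pos_norm_le
    exact ⟨R, hR0, hR⟩
  set S : EvenTestFunction (Fin p ⊕ Fin q) → ℕ → ℝ := fun φ j => ⨆ x, ‖iteratedFDeriv ℝ j φ x‖ with hS
  have hS0 : ∀ φ j, 0 ≤ S φ j := fun φ j => Real.iSup_nonneg fun x => norm_nonneg _
  have hSle : ∀ φ j x, ‖iteratedFDeriv ℝ j (φ : EvenTestFunction (Fin p ⊕ Fin q)) x‖ ≤ S φ j :=
    fun φ j x => le_ciSup (bddAbove_norm_iteratedFDeriv φ j) x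
  set A : ℕ → ℝ := fun m => R * S ψ 1 + S ψ m with hA
  have hA0 : ∀ m, 0 ≤ A m := fun m => add_nonneg (mul_nonneg hR0.le (hS0 _ _)) (hS0 _ _)
  have hdil : ∀ (r : ℝ) (hr : 0 < r), r ≤ 1 → ∀ m, ∀ x ∈ tsupport χ,
      ‖iteratedFDeriv ℝ m (dilate r hr.ne' ψ) x‖ ≤ r * A m := by
    intro r hr hr1 m x hx
    -- For the values, the mean value inequality and `ψ 0 = 0` supply the factor `r`. For `m ≥ 1`
    -- the dilation supplies `r ^ m ≤ r`.
    rcases Nat.eq_zero_or_pos m with rfl | hm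
    · rw [norm_iteratedFDeriv_zero, dilate_apply]
      have h1 := (convex_univ (𝕜 := ℝ)).norm_image_sub_le_of_norm_fderiv_le (f := ψ) (C := S ψ 1)
        (fun y _ => (smooth ψ).differentiable (by simp) y)
        (fun y _ => by rw [← norm_iteratedFDeriv_one]; exact hSle ψ 1 y) (Set.mem_univ 0)
        (Set.mem_univ (r • x))
      rw [hψ0, sub_zero, sub_zero, norm_smul, Real.norm_eq_abs, abs_of_pos hr] at h1
      calc ‖ψ (r • x)‖ ≤ S ψ 1 * (r * ‖x‖) := h1
        _ ≤ S ψ 1 * (r * R) := by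
          gcongr
          · exact hS0 _ _
          · exact hR x hx
        _ = r * (R * S ψ 1) := by ring
        _ ≤ r * A 0 := by
          gcongr
          exact le_add_of_nonneg_right (hS0 _ _)
    · refine (norm_iteratedFDeriv_dilate_le hr ψ m x).trans ?_
      calc r ^ m * ‖iteratedFDeriv ℝ m ψ (r • x)‖ ≤ r * S ψ m :=
            mul_le_mul (pow_le_of_le_one hr.le hr1 hm.ne') (hSle _ _ _) (norm_nonneg _) hr.le
        _ ≤ r * A m := by
            gcongr
            exact le_add_of_nonneg_left (mul_nonneg hR0.le (hS0 _ _))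
  set B : ℝ := |C| * ∑ j ∈ Finset.range (N + 1), ∑ i ∈ Finset.range (j + 1),
    (j.choose i : ℝ) * S χ i * A (j - i) with hB
  have hχp : ∀ i, HasParity i 1 χ := parity χ
  have key : ∀ r : ℝ, 0 < r → r ≤ 1 → ‖T ψ‖ ≤ r * B := by
    intro r hr hr1
    -- The supports of the dilates grow as `r → 0`. Multiplication by `χ` puts them in one compact
    -- set, so `C` and `N` do not depend on `r`; locality makes this harmless because `χ = 1` near
    -- `0`.
    set θ := mulEven χ (smooth χ) hχp (dilate r hr.ne' ψ) with hθ
    have hθs : tsupport θ ⊆ tsupport χ := tsupport_mul_subset_left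
    have h1 : T ψ = T θ := by
      have h2 : T (dilate r hr.ne' ψ - θ) = 0 := by
        refine hloc _ ?_
        rw [notMem_tsupport_iff_eventuallyEq]
        filter_upwards [eventually_cutoff_eq_one] with x hx
        rw [Submodule.coe_sub, Pi.sub_apply, hθ, mulEven_apply, hχ, hx, one_mul, sub_self,
          Pi.zero_apply]
      rw [hT.1.map_sub, hscale r hr] at h2
      exact sub_eq_zero.1 h2
    rw [h1]
    refine (hC θ hθs).trans ?_
    have h3 : ∀ j, (⨆ x, ‖iteratedFDeriv ℝ j θ x‖) ≤ r * ∑ i ∈ Finset.range (j + 1),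
        (j.choose i : ℝ) * S χ i * A (j - i) := by
      intro j
      refine ciSup_le fun x => ?_
      by_cases hx : x ∈ tsupport χ
      · refine (norm_iteratedFDeriv_mul_le (smooth χ) (smooth (dilate r hr.ne' ψ)) x (n := j)
          (by exact_mod_cast le_top)).trans ?_
        rw [Finset.mul_sum]
        refine Finset.sum_le_sum fun i _ => ?_
        calc (j.choose i : ℝ) * ‖iteratedFDeriv ℝ i χ x‖ *
              ‖iteratedFDeriv ℝ (j - i) (dilate r hr.ne' ψ) x‖
            ≤ (j.choose i : ℝ) * S χ i * (r * A (j - i)) := by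
              gcongr
              · exact mul_nonneg (Nat.cast_nonneg _) (hS0 _ _)
              · exact hSle _ _ _
              · exact hdil r hr hr1 _ x hx
          _ = _ := by ring
      · have : iteratedFDeriv ℝ j θ x = 0 := by
          by_contra h
          exact hx (hθs (support_iteratedFDeriv_subset (𝕜 := ℝ) j h))
        rw [this, norm_zero]
        exact mul_nonneg hr.le (Finset.sum_nonneg fun i _ =>
          mul_nonneg (mul_nonneg (Nat.cast_nonneg _) (hS0 _ _)) (hA0 _))
    calc C * ∑ j ∈ Finset.range (N + 1), ⨆ x, ‖iteratedFDeriv ℝ j θ x‖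
        ≤ |C| * ∑ j ∈ Finset.range (N + 1), ⨆ x, ‖iteratedFDeriv ℝ j θ x‖ := by
          refine mul_le_mul_of_nonneg_right (le_abs_self C) (Finset.sum_nonneg fun j _ => hS0 θ j)
      _ ≤ |C| * ∑ j ∈ Finset.range (N + 1), r * ∑ i ∈ Finset.range (j + 1),
          (j.choose i : ℝ) * S χ i * A (j - i) := by
          gcongr with j _
          exact h3 j
      _ = r * B := by rw [hB, ← Finset.mul_sum]; ring
  have hlim : Tendsto (fun r : ℝ => r * B) (𝓝[>] 0) (𝓝 0) := by
    have : Tendsto (fun r : ℝ => r * B) (𝓝 0) (𝓝 (0 * B)) :=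
      (continuous_id.mul continuous_const).tendsto 0
    rw [zero_mul] at this
    exact this.mono_left nhdsWithin_le_nhds
  refine norm_le_zero_iff.1 (ge_of_tendsto hlim ?_)
  filter_upwards [Ioc_mem_nhdsGT (zero_lt_one (α := ℝ))] with r hr
  exact key r hr.1 hr.2

end EvenTestFunction

/-! ### Homogeneity of the power functional. -/

section ResidueFunctional

open EvenTestFunction

variable {p q : ℕ} {γ : Fin p ⊕ Fin q → ℝ}

theorem powInt_dilate {r : ℝ} (hr : 0 < r) (z : ℂ)
    (φ : EvenTestFunction (Fin p ⊕ Fin q)) :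
    powInt γ z (dilate r hr.ne' φ) = (r : ℂ) ^ (-(2 * z + weightedDim γ)) * powInt γ z φ := by
  have hD : homDim γ = weightedDim γ := by simp [homDim, weightedDim]
  have h1 : ∫ x, posPow z (quadForm x) * φ x ∂((weightMeasure γ).map (r • ·)) =
      (r : ℂ) ^ (2 * z) * powInt γ z (dilate r hr.ne' φ) := by
    refine ((Homeomorph.smulOfNeZero r hr.ne').measurableEmbedding.integral_map
      (μ := weightMeasure γ) fun x => posPow z (quadForm x) * φ x).trans ?_
    rw [powInt, ← integral_const_mul]
    congr 1; ext x
    have hq : quadForm (r • x) = r ^ 2 * quadForm x := by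
      simp only [quadForm, Pi.smul_apply, smul_eq_mul, mul_pow, ← Finset.mul_sum]; ring
    change posPow z (quadForm (r • x)) * φ (r • x) = _
    rw [dilate_apply, hq]
    by_cases h : 0 < quadForm x
    · rw [posPow, posPow, if_pos (by positivity), if_pos h, sq, mul_assoc, Complex.ofReal_mul,
        Complex.mul_cpow_ofReal_nonneg hr.le (by positivity), Complex.ofReal_mul,
        Complex.mul_cpow_ofReal_nonneg hr.le h.le, show 2 * z = ((2 : ℕ) : ℂ) * z by simp,
        Complex.cpow_nat_mul]
      ring
    · rw [posPow, posPow, if_neg h, if_neg (by nlinarith [sq_nonneg r])]; simp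
  rw [map_smul_weightMeasure γ hr, integral_smul_measure, ENNReal.toReal_ofReal (by positivity), hD] at h1
  have hr0 : (r : ℂ) ≠ 0 := by exact_mod_cast hr.ne'
  rw [neg_add, Complex.cpow_add _ _ hr0, Complex.cpow_neg, mul_assoc]
  rw [Complex.real_smul, Complex.ofReal_cpow hr.le] at h1
  push_cast at h1
  rw [show powInt γ z φ = ∫ x, posPow z (quadForm x) * φ x ∂weightMeasure γ from rfl, h1, inv_mul_cancel_left₀]
  simp [Complex.cpow_eq_zero_iff, hr0]

end ResidueFunctional

/-! ### Simple zeros of the denominators at `-D/2 - k`. -/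

section ContinuationFactor

/-- The cofactor of the factor `z + d / 2` in `contFactor d (N + 1) z`. -/
noncomputable def contCofactor (d : ℝ) (N : ℕ) (z : ℂ) : ℂ :=
  (∏ i ∈ Finset.range N, 4 * (z + 1 + ((i : ℂ) + 1)) * (z + d / 2 + ((i : ℂ) + 1))) * (4 * (z + 1))

theorem contFactor_succ_eq_mul (d : ℝ) (N : ℕ) (z : ℂ) :
    contFactor d (N + 1) z = (z + d / 2) * contCofactor d N z := by
  rw [contFactor, Finset.prod_range_succ', contCofactor]
  push_cast
  ring

theorem continuous_contCofactor (d : ℝ) (N : ℕ) : Continuous (contCofactor d N) := by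
  unfold contCofactor; fun_prop

/-- At `-d/2` the remaining factors of the second family are positive integers, and those of the
first vanish only if `d` is a positive even integer. -/
theorem contCofactor_ne_zero {d : ℝ} (hd : ∀ j : ℕ, d ≠ 2 * (j + 1)) (N : ℕ) :
    contCofactor d N (-(d / 2)) ≠ 0 := by
  have h : ∀ j : ℕ, (-(d / 2) + 1 + j : ℂ) ≠ 0 := fun j h => hd j <| by
    have h' : -(d / 2) + 1 + (j : ℝ) = 0 := by exact_mod_cast h
    linarith
  refine mul_ne_zero (Finset.prod_ne_zero_iff.2 fun i _ => ?_) (mul_ne_zero (by norm_num) ?_)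
  · refine mul_ne_zero (mul_ne_zero (by norm_num) ?_) ?_
    · have := h (i + 1)
      push_cast at this
      exact this
    · rw [neg_add_cancel, zero_add]
      exact_mod_cast Nat.succ_ne_zero i
  · simpa using h 0

theorem contFactor_ne_zero {d : ℝ} (hd : 0 < d) (k : ℕ) :
    contFactor d k (-(d / 2) - k) ≠ 0 := by
  refine Finset.prod_ne_zero_iff.2 fun i hi => ?_
  have hik : i + 1 ≤ k := Finset.mem_range.1 hi
  obtain ⟨j, rfl⟩ := Nat.exists_eq_add_of_le hik
  refine mul_ne_zero (mul_ne_zero (by norm_num) fun h => ?_) fun h => ?_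
  · have h' : -(d / 2) - ((i + 1 + j : ℕ) : ℝ) + 1 + (i : ℝ) = 0 := by exact_mod_cast h
    push_cast at h'
    have : (0 : ℝ) ≤ j := j.cast_nonneg
    linarith
  · have h' : -(d / 2) - ((i + 1 + j : ℕ) : ℝ) + d / 2 + (i : ℝ) = 0 := by exact_mod_cast h
    push_cast at h'
    have : (0 : ℝ) ≤ j := j.cast_nonneg
    linarith

end ContinuationFactor

/-! ### Residues at `-D/2` and at its shifts; removable poles. -/

section ResidueFunctional

open EvenTestFunction

variable {p q : ℕ} {γ : Fin p ⊕ Fin q → ℝ}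

theorem weightedDim_pos (hp : 0 < p) (hγ : ∀ i, 0 < γ i) : 0 < weightedDim γ := by
  rw [weightedDim_eq]
  exact Finset.sum_pos (fun i _ => add_pos (hγ i) one_pos) ⟨Sum.inl ⟨0, hp⟩, Finset.mem_univ _⟩

theorem tendsto_add_nhdsNE (z₀ c : ℂ) : Tendsto (· + c) (𝓝[≠] z₀) (𝓝[≠] (z₀ + c)) :=
  tendsto_nhdsWithin_iff.2 ⟨((continuous_add_const c).tendsto z₀).mono_left nhdsWithin_le_nhds, by
    filter_upwards [self_mem_nhdsWithin] with z hz h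
    exact hz (add_right_cancel h)⟩

theorem meromorphicAt_powCont_add (hp : 0 < p) (hq : 0 < q) (hγ : ∀ i, 0 < γ i) (c z₀ : ℂ)
    (φ : EvenTestFunction (Fin p ⊕ Fin q)) : MeromorphicAt (fun z => powCont γ (z + c) φ) z₀ :=
  MeromorphicAt.comp_analyticAt (f := fun z => powCont γ z φ) (g := fun z => z + c)
    (meromorphicAt_powCont hp hq hγ (z₀ + c) φ) (by fun_prop)

/-- Induction on the number of unit shifts needed to reach `Re z > -1`. Each shift divides by `-(z₀
+ 1)`, nonzero because `z₀` is not a negative integer, and keeps the support away from the origin.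
-/
theorem exists_tendsto_powCont_of_zero_notMem_tsupport (hp : 0 < p) (hq : 0 < q)
    (hγ : ∀ i, 0 < γ i) (n : ℕ) : ∀ {z₀ : ℂ}, -1 < z₀.re + n → (∀ j : ℕ, z₀ ≠ -(j + 1)) →
      ∀ φ : EvenTestFunction (Fin p ⊕ Fin q), (0 : Fin p ⊕ Fin q → ℝ) ∉ tsupport φ →
        ∃ L, Tendsto (fun z => powCont γ z φ) (𝓝[≠] z₀) (𝓝 L) := by
  induction n with
  | zero =>
    intro z₀ hz _ φ _
    refine ⟨powInt γ z₀ φ, ?_⟩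
    have h := (analyticAt_powInt hp hq hγ φ (z := z₀) (by simpa using hz)).continuousAt.tendsto
    refine (h.mono_left nhdsWithin_le_nhds).congr' ?_
    filter_upwards [mem_nhdsWithin_of_mem_nhds ((isOpen_lt continuous_const
      Complex.continuous_re).mem_nhds (show -1 < z₀.re by simpa using hz))] with z hz
    exact (powCont_eq_powInt hz φ).symm
  | succ n ih =>
    intro z₀ hz hne φ h0
    obtain ⟨ψ, hψ0, hψ⟩ := exists_powInt_eq_of_zero_notMem_tsupport hp hq hγ φ h0
    obtain ⟨L, hL⟩ := ih (z₀ := z₀ + 1) (by push_cast at hz; simp; linarith)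
      (fun j h => hne (j + 1) (by push_cast; linear_combination h)) ψ hψ0
    have hev : (fun z => powCont γ (z + 1) ψ) =ᶠ[𝓝[≠] z₀] fun z => -(z + 1) * powCont γ z φ := by
      refine MeromorphicAt.eventuallyEq_of_re_gt
        (fun z => meromorphicAt_powCont_add hp hq hγ 1 z ψ)
        (fun z => MeromorphicAt.mul (by fun_prop) (meromorphicAt_powCont hp hq hγ z φ)) (R := 0)
        (fun z hz => ?_) z₀
      simp only [Pi.mul_apply]
      rw [powCont_eq_powInt (by simp; linarith), powCont_eq_powInt (by linarith),
        hψ _ (by simp; linarith), add_sub_cancel_right]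
    have hz1 : -(z₀ + 1) ≠ 0 := fun h => hne 0 (by push_cast; linear_combination -h)
    refine ⟨L / -(z₀ + 1), ?_⟩
    have h1 := (hL.comp (tendsto_add_nhdsNE z₀ 1)).div
      ((by fun_prop : Continuous fun z : ℂ => -(z + 1)).tendsto z₀ |>.mono_left nhdsWithin_le_nhds) hz1
    refine h1.congr' ?_
    filter_upwards [hev, eventually_nhdsNE_ne z₀ (-1)] with z h2 h3
    have h4 : -(z + 1) ≠ 0 := fun h => h3 (by linear_combination -h)
    simp only [Pi.div_apply, Function.comp_apply, h2]
    rw [mul_div_cancel_left₀ _ h4]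

/-- After `N + 1` steps the factor `z + D/2` cancels against the denominator. The limit is `powInt`
at an exponent of real part above `-1`, applied to a power of `L_B` and divided by the cofactor,
hence a distribution. -/
theorem exists_residue (hp : 0 < p) (hq : 0 < q) (hγ : ∀ i, 0 < γ i)
    (hd : ∀ j : ℕ, weightedDim γ ≠ 2 * (j + 1)) :
    ∃ T : EvenTestFunction (Fin p ⊕ Fin q) → ℂ, IsWeightedDistribution T ∧
      ∀ φ, Tendsto (fun z => (z + weightedDim γ / 2) * powCont γ z φ)
        (𝓝[≠] (-(weightedDim γ / 2) : ℂ)) (𝓝 (T φ)) := by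
  set D := weightedDim γ with hD
  obtain ⟨N, hN⟩ := exists_nat_gt (D / 2)
  have hre : (-(D / 2) : ℂ).re = -(D / 2) := by
    rw [show (-(D / 2) : ℂ) = ((-(D / 2) : ℝ) : ℂ) by push_cast; ring, Complex.ofReal_re]
  have h1 : -1 < (-(D / 2) : ℂ).re + (N + 1 : ℕ) := by rw [hre]; push_cast; linarith
  refine ⟨fun φ => (contCofactor D N (-(D / 2)))⁻¹ *
    powInt γ (-(D / 2) + (N + 1 : ℕ)) ((ultraHyperbolic γ ^ (N + 1)) φ),
    isWeightedDistribution_powInt hp hq hγ (by simpa only [Complex.add_re, Complex.natCast_re] using h1) _ _,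
    fun φ => ?_⟩
  have h2 := (analyticAt_powInt_add hp hq hγ h1 ((ultraHyperbolic γ ^ (N + 1)) φ)).continuousAt.tendsto
  have h3 := (((continuous_contCofactor D N).tendsto (-(D / 2) : ℂ)).inv₀
    (contCofactor_ne_zero hd N)).mul h2
  refine (h3.mono_left nhdsWithin_le_nhds).congr' ?_
  filter_upwards [eventually_powCont_eq_div hp hq hγ h1 φ, self_mem_nhdsWithin] with z h4 h5
  have h6 : z + D / 2 ≠ 0 := fun h => h5 (by rw [Set.mem_singleton_iff]; linear_combination h)
  rw [h4, ← hD, contFactor_succ_eq_mul, ← mul_div_assoc, mul_div_mul_left _ _ h6, div_eq_inv_mul]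

/-- Away from the origin `powCont` has a finite limit, which the factor `z + D/2` kills. Dilation
multiplies by `r ^ (-(2z + D))`, which tends to `1` at `z = -D/2`. -/
theorem exists_residue_eq_mul_apply_zero (hp : 0 < p) (hq : 0 < q) (hγ : ∀ i, 0 < γ i)
    (hd : ∀ j : ℕ, weightedDim γ ≠ 2 * (j + 1)) :
    ∃ c : ℂ, ∀ φ : EvenTestFunction (Fin p ⊕ Fin q),
      Tendsto (fun z => (z + weightedDim γ / 2) * powCont γ z φ)
        (𝓝[≠] (-(weightedDim γ / 2) : ℂ)) (𝓝 (c * φ 0)) := by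
  obtain ⟨T, hT, hlim⟩ := exists_residue hp hq hγ hd
  have hw : Tendsto (fun z : ℂ => z + weightedDim γ / 2) (𝓝[≠] (-(weightedDim γ / 2) : ℂ)) (𝓝 0) := by
    have := ((by fun_prop : Continuous fun z : ℂ => z + weightedDim γ / 2).tendsto
      (-(weightedDim γ / 2) : ℂ)).mono_left (nhdsWithin_le_nhds (s := {(-(weightedDim γ / 2) : ℂ)}ᶜ))
    simpa using this
  refine ⟨T cutoff, fun φ => ?_⟩
  rw [mul_comm, ← eq_apply_zero_mul_cutoff hT (fun φ h0 => ?_) (fun r hr φ => ?_) φ]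
  · exact hlim φ
  · obtain ⟨n, hn⟩ := exists_nat_gt (weightedDim γ / 2)
    obtain ⟨L, hL⟩ := exists_tendsto_powCont_of_zero_notMem_tsupport hp hq hγ n
      (z₀ := (-(weightedDim γ / 2) : ℂ)) (by
        rw [show (-(weightedDim γ / 2) : ℂ) = ((-(weightedDim γ / 2) : ℝ) : ℂ) by push_cast; ring,
          Complex.ofReal_re]
        linarith)
      (fun j h => hd j (by
        have h' : -(weightedDim γ / 2) = -((j : ℝ) + 1) := by exact_mod_cast h
        linarith)) φ h0
    have := hw.mul hL
    rw [zero_mul] at this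
    exact tendsto_nhds_unique (hlim φ) this
  · have hr0 : (r : ℂ) ≠ 0 := by exact_mod_cast hr.ne'
    have hc : Continuous fun z : ℂ => (r : ℂ) ^ (-(2 * z + weightedDim γ)) :=
      (by fun_prop : Continuous fun z : ℂ => -(2 * z + weightedDim γ)).const_cpow (Or.inl hr0)
    have hev : (fun z => powCont γ z (dilate r hr.ne' φ)) =ᶠ[𝓝[≠] (-(weightedDim γ / 2) : ℂ)]
        fun z => (r : ℂ) ^ (-(2 * z + weightedDim γ)) * powCont γ z φ := by
      refine MeromorphicAt.eventuallyEq_of_re_gt (fun z => meromorphicAt_powCont hp hq hγ z _)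
        (fun z => MeromorphicAt.mul (AnalyticAt.meromorphicAt ?_) (meromorphicAt_powCont hp hq hγ z φ))
        (R := 0) (fun z hz => ?_) _
      · exact Differentiable.analyticAt (fun w => DifferentiableAt.const_cpow (by fun_prop) (Or.inl hr0)) z
      · simp only [Pi.mul_apply]
        rw [powCont_eq_powInt (by linarith), powCont_eq_powInt (by linarith), powInt_dilate hr]
    refine tendsto_nhds_unique (hlim _) ?_
    have h1 := ((hc.tendsto (-(weightedDim γ / 2) : ℂ)).mono_left
      (nhdsWithin_le_nhds (s := {(-(weightedDim γ / 2) : ℂ)}ᶜ))).mul (hlim φ)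
    rw [show -(2 * (-(weightedDim γ / 2) : ℂ) + weightedDim γ) = 0 by ring, Complex.cpow_zero,
      one_mul] at h1
    refine h1.congr' ?_
    filter_upwards [hev] with z hz
    rw [hz]; ring

/-- The behaviour at the shifted points follows from the functional equation. -/
theorem tendsto_powCont_shift (hp : 0 < p) (hq : 0 < q) (hγ : ∀ i, 0 < γ i)
    {c : ℂ}
    (hc : ∀ φ : EvenTestFunction (Fin p ⊕ Fin q),
      Tendsto (fun z => (z + weightedDim γ / 2) * powCont γ z φ)
        (𝓝[≠] (-(weightedDim γ / 2) : ℂ)) (𝓝 (c * φ 0))) (k : ℕ)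
    (φ : EvenTestFunction (Fin p ⊕ Fin q)) :
    Tendsto (fun z => (z - (-(weightedDim γ / 2) - k)) * powCont γ z φ)
      (𝓝[≠] (-(weightedDim γ / 2) - k : ℂ))
      (𝓝 (c * iterLBDelta γ k φ / contFactor (weightedDim γ) k (-(weightedDim γ / 2) - k))) := by
  have hD0 := weightedDim_pos hp hγ
  set D := weightedDim γ with hD
  -- The iterated functional equation, extended to the whole plane; it moves the residue at `-D/2`
  -- to `-D/2 - k`.
  have hev : (fun z => powCont γ (z + k) ((ultraHyperbolic γ ^ k) φ)) =ᶠ[𝓝[≠] (-(D / 2) - k : ℂ)]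
      fun z => contFactor D k z * powCont γ z φ := by
    refine MeromorphicAt.eventuallyEq_of_re_gt (fun z => meromorphicAt_powCont_add hp hq hγ k z _)
      (fun z => (analyticAt_contFactor D k z).meromorphicAt.mul (meromorphicAt_powCont hp hq hγ z φ))
      (R := -1) (fun z hz => ?_) _
    have : (0 : ℝ) ≤ k := k.cast_nonneg
    simp only [Pi.mul_apply]
    rw [powCont_eq_powInt hz, powCont_eq_powInt (by simp; linarith),
      powInt_ultraHyperbolic_pow hp hq hγ hz]
  have h0 := contFactor_ne_zero hD0 k
  have h1 := tendsto_add_nhdsNE (-(D / 2) - k : ℂ) k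
  rw [sub_add_cancel] at h1
  have h2 := ((hc ((ultraHyperbolic γ ^ k) φ)).comp h1).div
    (((differentiable_contFactor D k).continuous.tendsto _).mono_left nhdsWithin_le_nhds) h0
  rw [← iterLBDelta_eq] at h2
  refine h2.congr' ?_
  filter_upwards [hev, eventually_contFactor_ne_zero D k _] with z h3 h4
  simp only [Pi.div_apply, Function.comp_apply, h3]
  field_simp
  ring

/-- Near `z₀` one has `powCont = H / ((z - z₀) g)` with `g z₀ ≠ 0`. The residue hypothesis forces `H
z₀ = 0`, so the limit is `H' z₀ / g z₀`; here `H'` is a `powLogInt`, which shows that the regular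
value is a distribution. -/
theorem isRegularPoint_powCont (hp : 0 < p) (hq : 0 < q) (hγ : ∀ i, 0 < γ i)
    (hd : ∀ j : ℕ, weightedDim γ ≠ 2 * (j + 1)) (k : ℕ)
    (h : ∀ φ : EvenTestFunction (Fin p ⊕ Fin q),
      Tendsto (fun z => (z - (-(weightedDim γ / 2) - k)) * powCont γ z φ)
        (𝓝[≠] (-(weightedDim γ / 2) - k : ℂ)) (𝓝 0)) :
    IsRegularPoint (powCont γ) (-(weightedDim γ / 2) - k) := by
  have hD0 := weightedDim_pos hp hγ
  set D := weightedDim γ with hD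
  set z₀ : ℂ := -(D / 2) - k with hz₀
  obtain ⟨M, hM⟩ := exists_nat_gt (D / 2)
  set N := k + (M + 1) with hN
  have hre : z₀.re = -(D / 2) - k := by
    rw [hz₀, show (-(D / 2) - k : ℂ) = ((-(D / 2) - k : ℝ) : ℂ) by push_cast; ring, Complex.ofReal_re]
  have h1 : -1 < z₀.re + N := by rw [hre, hN]; push_cast; linarith
  set g : ℂ → ℂ := fun z => contFactor D k z * contCofactor D M (z + k) with hg
  have hgc : Continuous g := (differentiable_contFactor D k).continuous.mul
    ((continuous_contCofactor D M).comp (continuous_add_const _))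
  have hg0 : g z₀ ≠ 0 := mul_ne_zero (contFactor_ne_zero hD0 k) (by
    rw [hz₀, sub_add_cancel]; exact contCofactor_ne_zero hd M)
  have hfac : ∀ z, contFactor D N z = (z - z₀) * g z := fun z => by
    rw [hN, contFactor_add, contFactor_succ_eq_mul, hg, hz₀]; ring
  refine ⟨fun φ => (g z₀)⁻¹ * powLogInt γ (z₀ + N) ((ultraHyperbolic γ ^ N) φ),
    isWeightedDistribution_powLogInt hp hq hγ (by simpa using h1) N _, fun φ => ?_⟩
  set H : ℂ → ℂ := fun z => powInt γ (z + N) ((ultraHyperbolic γ ^ N) φ) with hH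
  have hHd : HasDerivAt H (powLogInt γ (z₀ + N) ((ultraHyperbolic γ ^ N) φ)) z₀ := by
    obtain ⟨m, R, hA⟩ := EvenTestFunction.exists_isAdmissible ((ultraHyperbolic γ ^ N) φ)
    exact (hA.hasDerivAt_powInt hp hq hγ (z := z₀ + N) (by simpa using h1)).comp_add_const z₀ N
  have hev := eventually_powCont_eq_div hp hq hγ h1 φ
  have hgne : ∀ᶠ z in 𝓝[≠] z₀, g z ≠ 0 :=
    (hgc.continuousAt.eventually_ne hg0).filter_mono nhdsWithin_le_nhds
  have hH0 : H z₀ = 0 := by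
    have h2 := (h φ).mul ((hgc.tendsto z₀).mono_left (nhdsWithin_le_nhds (s := {z₀}ᶜ)))
    rw [zero_mul] at h2
    refine tendsto_nhds_unique (hHd.continuousAt.tendsto.mono_left
      (nhdsWithin_le_nhds (s := {z₀}ᶜ))) (h2.congr' ?_)
    filter_upwards [hev, hgne, self_mem_nhdsWithin] with z h3 h4 h5
    have h6 : z - z₀ ≠ 0 := sub_ne_zero.2 h5
    rw [h3, ← hD, hfac]
    field_simp
    rfl
  have h2 := (((hgc.tendsto z₀).inv₀ hg0).mono_left (nhdsWithin_le_nhds (s := {z₀}ᶜ))).mul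
    (hasDerivAt_iff_tendsto_slope.1 hHd)
  refine h2.congr' ?_
  filter_upwards [hev, hgne, self_mem_nhdsWithin] with z h3 h4 h5
  have h6 : z - z₀ ≠ 0 := sub_ne_zero.2 h5
  rw [h3, ← hD, hfac, slope_def_field, hH0, sub_zero]
  field_simp
  rfl

end ResidueFunctional

/-! ### The Mellin transform of a cutoff function. -/

section Mellin

variable {f : ℝ → ℂ} {R : ℝ}

theorem isBigO_atTop_of_eq_zero (h : ∀ u, R < u → f u = 0) (g : ℝ → ℝ) : f =O[atTop] g := by
  refine (Asymptotics.isBigO_zero g atTop).congr' ?_ EventuallyEq.rfl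
  filter_upwards [eventually_gt_atTop R] with u hu
  exact (h u hu).symm

theorem isBigO_nhdsGT_zero_of_eq_zero (h : ∀ u, u < 1 → f u = 0) (g : ℝ → ℝ) : f =O[𝓝[>] 0] g := by
  refine (Asymptotics.isBigO_zero g (𝓝[>] 0)).congr' ?_ EventuallyEq.rfl
  filter_upwards [mem_nhdsWithin_of_mem_nhds (Iio_mem_nhds (zero_lt_one (α := ℝ)))] with u hu
  exact (h u hu).symm

theorem mellinConvergent_of_eq_zero (hf : Continuous f) (h : ∀ u, R < u → f u = 0) {s : ℂ}
    (hs : 0 < s.re) : MellinConvergent f s := by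
  refine mellinConvergent_of_isBigO_rpow (a := s.re + 1) (b := 0)
    (hf.locallyIntegrable.locallyIntegrableOn _) (isBigO_atTop_of_eq_zero h _) (by linarith) ?_ hs
  simp only [neg_zero, Real.rpow_zero]
  exact (hf.tendsto 0).isBigO_one ℝ |>.mono nhdsWithin_le_nhds

/-- Integration by parts of `u^s f(u)`, which vanishes at both ends. It isolates the pole at `s =
0`. -/
theorem mul_mellin_eq_neg_mellin_deriv (hf : ContDiff ℝ ∞ f) (h : ∀ u, R < u → f u = 0) {s : ℂ}
    (hs : 0 < s.re) : s * mellin f s = -mellin (deriv f) (s + 1) := by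
  have hfd : Continuous (deriv f) := hf.continuous_deriv (by simp)
  have hd0 : ∀ u, R < u → deriv f u = 0 := fun u hu => by
    have : f =ᶠ[𝓝 u] fun _ => 0 := by filter_upwards [Ioi_mem_nhds hu] with v hv using h v hv
    rw [this.deriv_eq, deriv_const]
  have I1 := mellinConvergent_of_eq_zero hf.continuous h hs
  have I2 := mellinConvergent_of_eq_zero hfd hd0 (s := s + 1) (by simp; linarith)
  have hs0 : s ≠ 0 := fun h => by simp [h] at hs
  have key := integral_Ioi_of_hasDerivAt_of_tendsto (f := fun u : ℝ => (u : ℂ) ^ s * f u)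
    (f' := fun u : ℝ => s * ((u : ℂ) ^ (s - 1) • f u) + (u : ℂ) ^ (s + 1 - 1) • deriv f u)
    (a := 0) (m := 0) ?_ (fun u hu => ?_) ((I1.const_mul s).add I2) ?_
  · rw [integral_add (I1.const_mul s) I2, integral_const_mul, Complex.ofReal_zero,
      Complex.zero_cpow hs0, zero_mul, sub_zero] at key
    exact eq_neg_of_add_eq_zero_left key
  · exact ((Complex.continuousAt_ofReal_cpow_const 0 s (Or.inl hs)).mul
      hf.continuous.continuousAt).continuousWithinAt
  · have h2 := hasDerivAt_ofReal_cpow_const (x := u) (r := s) (ne_of_gt hu) hs0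
    have h3 := h2.mul ((hf.differentiable (by simp)) u).hasDerivAt
    convert! h3 using 1
    simp only [smul_eq_mul, add_sub_cancel_right]
    ring
  · refine tendsto_const_nhds.congr' ?_
    filter_upwards [eventually_gt_atTop R] with u hu
    rw [h u hu, mul_zero]

/-- The derivative vanishes near `0` and near infinity, so its Mellin integral converges for every
exponent. -/
theorem differentiable_mellin_deriv (hf : ContDiff ℝ ∞ f) (h : ∀ u, R < u → f u = 0)
    (h1 : ∀ u, u < 1 → f u = 1) : Differentiable ℂ (mellin (deriv f)) := fun s => by
  refine mellin_differentiableAt_of_isBigO_rpow (a := s.re + 1) (b := s.re - 1)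
    ((hf.continuous_deriv (by simp)).locallyIntegrable.locallyIntegrableOn _)
    (isBigO_atTop_of_eq_zero (R := R) (fun u hu => ?_) _) (by linarith)
    (isBigO_nhdsGT_zero_of_eq_zero (fun u hu => ?_) _) (by linarith)
  · have : f =ᶠ[𝓝 u] fun _ => 0 := by filter_upwards [Ioi_mem_nhds hu] with v hv using h v hv
    rw [this.deriv_eq, deriv_const]
  · have : f =ᶠ[𝓝 u] fun _ => 1 := by filter_upwards [Iio_mem_nhds hu] with v hv using h1 v hv
    rw [this.deriv_eq, deriv_const]

theorem mellin_deriv_one (hf : ContDiff ℝ ∞ f) (h : ∀ u, R < u → f u = 0)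
    (h1 : ∀ u, u < 1 → f u = 1) : mellin (deriv f) 1 = -1 := by
  have hfd : Continuous (deriv f) := hf.continuous_deriv (by simp)
  have hd0 : ∀ u, R < u → deriv f u = 0 := fun u hu => by
    have : f =ᶠ[𝓝 u] fun _ => 0 := by filter_upwards [Ioi_mem_nhds hu] with v hv using h v hv
    rw [this.deriv_eq, deriv_const]
  have I := mellinConvergent_of_eq_zero hfd hd0 (s := 1) (by simp)
  simp only [MellinConvergent, mellin, sub_self, Complex.cpow_zero, one_smul] at I ⊢
  rw [integral_Ioi_of_hasDerivAt_of_tendsto' (f := f) (m := 0)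
    (fun u _ => ((hf.differentiable (by simp)) u).hasDerivAt) I, h1 0 one_pos, zero_sub]
  refine tendsto_const_nhds.congr' ?_
  filter_upwards [eventually_gt_atTop R] with u hu
  rw [h u hu]

end Mellin

/-! ### The residue constant, evaluated on the cutoff. -/

section Constant

open EvenTestFunction

variable {p q : ℕ} {γ : Fin p ⊕ Fin q → ℝ}

/-- The factor of `cutoff` depending on the first group of variables. -/
noncomputable def radialCutoff (u : ℝ) : ℂ := (Real.smoothTransition (2 - u) : ℂ)

theorem contDiff_radialCutoff : ContDiff ℝ ∞ radialCutoff :=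
  Complex.ofRealCLM.contDiff.comp (Real.smoothTransition.contDiff.comp (contDiff_const.sub contDiff_id))

theorem radialCutoff_eq_zero {u : ℝ} (hu : 2 < u) : radialCutoff u = 0 := by
  rw [radialCutoff, Real.smoothTransition.zero_of_nonpos (by linarith), Complex.ofReal_zero]

theorem radialCutoff_eq_one {u : ℝ} (hu : u < 1) : radialCutoff u = 1 := by
  rw [radialCutoff, Real.smoothTransition.one_of_one_le (by linarith), Complex.ofReal_one]

/-- In the variables `u = |x'|²`, `v = |x''|²` the integrand is supported on `v < u ≤ 2`. There `3 -
v ≥ 1`, so the second factor of the cutoff equals one; the inner integral is then a Beta function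
and the outer one a Mellin transform. -/
theorem powInt_cutoff (hp : 0 < p) (hq : 0 < q) (hγ : ∀ i, 0 < γ i) {z : ℂ} (hz : -1 < z.re) :
    powInt γ z cutoff = (radialConst (fun i => γ (Sum.inl i)) * radialConst (fun j => γ (Sum.inr j)) : ℝ) *
      (Complex.betaIntegral (weightedDimSnd γ / 2 : ℝ) (z + 1) *
        mellin radialCutoff (z + weightedDim γ / 2)) := by
  have hp' : Nonempty (Fin p) := ⟨⟨0, hp⟩⟩
  have hq' : Nonempty (Fin q) := ⟨⟨0, hq⟩⟩
  set C := radialConst (fun i => γ (Sum.inl i)) * radialConst (fun j => γ (Sum.inr j)) with hC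
  have hC0 : 0 < C := mul_pos (radialConst_pos fun i => hγ _) (radialConst_pos fun i => hγ _)
  set G : ℝ × ℝ → ℂ := fun y => posPow z (y.1 - y.2) *
    ((Real.smoothTransition (2 - y.1) * Real.smoothTransition (3 - y.2) : ℝ) : ℂ) with hG
  have hGm : Measurable G := by
    refine Measurable.mul ((measurable_posPow z).comp (by fun_prop)) (Continuous.measurable ?_)
    exact Complex.continuous_ofReal.comp
      ((Real.smoothTransition.continuous.comp (by fun_prop)).mul
        (Real.smoothTransition.continuous.comp (by fun_prop)))
  have hI : Integrable (fun x => G (biSqNorm x)) (weightMeasure γ) :=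
    integrable_posPow_mul (γ := γ) hp hq hγ hz (smooth cutoff).continuous (compactSupport cutoff)
  have hbm : Measurable (biSqNorm : (Fin p ⊕ Fin q → ℝ) → ℝ × ℝ) := contDiff_biSqNorm.continuous.measurable
  have hI2 : Integrable G ((weightMeasure γ).map biSqNorm) :=
    (integrable_map_measure hGm.aestronglyMeasurable hbm.aemeasurable).2 hI
  have h1 : powInt γ z cutoff = ∫ y, G y ∂((weightMeasure γ).map biSqNorm) :=
    (integral_map hbm.aemeasurable hGm.aestronglyMeasurable).symm
  have hb : 0 < weightedDimSnd γ := lt_of_lt_of_le one_pos (one_le_weightedDimSnd hq hγ)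
  rw [map_biSqNorm_weightMeasure hp hq hγ, ← hC] at h1 hI2
  rw [integrable_smul_measure (by simpa using hC0) ENNReal.ofReal_ne_top] at hI2
  rw [h1, integral_smul_measure, ENNReal.toReal_ofReal hC0.le, Complex.real_smul, integral_prod _ hI2]
  congr 1
  rw [mellin, integral_radialMeasure, ← integral_const_mul]
  refine setIntegral_congr_fun measurableSet_Ioi fun u hu => ?_
  rw [Set.mem_Ioi] at hu
  have h2 : ∫ v, G (u, v) ∂(radialMeasure (weightedDimSnd γ)) =
      radialCutoff u * ((u : ℂ) ^ (z + (weightedDimSnd γ / 2 : ℝ)) *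
        Complex.betaIntegral (weightedDimSnd γ / 2 : ℝ) (z + 1)) := by
    rw [← (radial_posPow hb hz hu).2, ← integral_const_mul]
    congr 1; ext v
    simp only [hG, radialCutoff]
    rcases le_or_gt 2 u with h | h
    · rw [Real.smoothTransition.zero_of_nonpos (by linarith)]; simp
    · by_cases hv : 0 < u - v
      · rw [Real.smoothTransition.one_of_one_le (x := 3 - v) (by linarith), mul_one]; ring
      · simp [posPow, hv]
  simp only [h2]
  have hu0 : (u : ℂ) ≠ 0 := by exact_mod_cast hu.ne'
  rw [Complex.real_smul, Complex.ofReal_cpow hu.le, smul_eq_mul,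
    show z + (weightedDim γ : ℂ) / 2 - 1 =
      ((weightedDimFst γ / 2 - 1 : ℝ) : ℂ) + (z + (weightedDimSnd γ / 2 : ℝ)) by
        rw [weightedDim_eq_add]; push_cast; ring, Complex.cpow_add ((weightedDimFst γ / 2 - 1 : ℝ) : ℂ)
          (z + (weightedDimSnd γ / 2 : ℝ)) hu0]
  ring

/-- The Beta function is rewritten with Gamma functions, with `1/Γ` as an entire function, and the
factor `z + D/2` turns the Mellin transform into that of the derivative. The product `G` is
continuous at `-D/2`, so the limit is its value there. -/
theorem tendsto_powCont_cutoff (hp : 0 < p) (hq : 0 < q) (hγ : ∀ i, 0 < γ i)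
    (hd : ∀ j : ℕ, weightedDim γ ≠ 2 * (j + 1)) :
    Tendsto (fun z => (z + weightedDim γ / 2) * powCont γ z cutoff)
      (𝓝[≠] (-(weightedDim γ / 2) : ℂ))
      (𝓝 ((radialConst (fun i => γ (Sum.inl i)) * radialConst (fun j => γ (Sum.inr j)) : ℝ) *
        (Real.Gamma (weightedDimSnd γ / 2) * Real.Gamma (1 - weightedDim γ / 2) /
          Real.Gamma (1 - weightedDimFst γ / 2) : ℝ))) := by
  set C := radialConst (fun i => γ (Sum.inl i)) * radialConst (fun j => γ (Sum.inr j)) with hC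
  set b := weightedDimSnd γ with hbdef
  set D := weightedDim γ with hD
  have hb : 0 < b := lt_of_lt_of_le one_pos (one_le_weightedDimSnd hq hγ)
  have hD0 : 0 < D := weightedDim_pos hp hγ
  have hf := contDiff_radialCutoff
  have hdiff := differentiable_mellin_deriv hf (fun u hu => radialCutoff_eq_zero hu)
    (fun u hu => radialCutoff_eq_one hu)
  set G : ℂ → ℂ := fun z => C * (Complex.Gamma (b / 2 : ℝ) * Complex.Gamma (z + 1) *
    (Complex.Gamma (z + 1 + (b / 2 : ℝ)))⁻¹) * -mellin (deriv radialCutoff) (z + D / 2 + 1) with hG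
  have hGi : Differentiable ℂ fun z => (Complex.Gamma (z + 1 + (b / 2 : ℝ)))⁻¹ :=
    Complex.differentiable_one_div_Gamma.comp (by fun_prop : Differentiable ℂ fun z : ℂ => z + 1 + (b / 2 : ℝ))
  have hMd : Differentiable ℂ fun z : ℂ => -mellin (deriv radialCutoff) (z + D / 2 + 1) :=
    (hdiff.comp (by fun_prop : Differentiable ℂ fun z : ℂ => z + D / 2 + 1)).neg
  have hGm : ∀ z, MeromorphicAt G z := fun z => by
    refine MeromorphicAt.mul (MeromorphicAt.mul (by fun_prop) (MeromorphicAt.mul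
      (MeromorphicAt.mul (by fun_prop) ?_) (hGi.analyticAt z).meromorphicAt)) (hMd.analyticAt z).meromorphicAt
    exact MeromorphicAt.comp_analyticAt (g := fun z => z + 1) (Meromorphic.Gamma (z + 1)) (by fun_prop)
  have hev : (fun z => (z + D / 2) * powCont γ z cutoff) =ᶠ[𝓝[≠] (-(D / 2) : ℂ)] G := by
    refine MeromorphicAt.eventuallyEq_of_re_gt
      (fun z => MeromorphicAt.mul (by fun_prop) (meromorphicAt_powCont hp hq hγ z _)) hGm (R := 0)
      (fun z hz => ?_) _
    simp only [Pi.mul_apply]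
    have hbr : 0 < ((b / 2 : ℝ) : ℂ).re := by rw [Complex.ofReal_re]; positivity
    have hzr : 0 < (z + 1).re := by simp; linarith
    have h1 : 0 < (z + (D / 2 : ℝ)).re := by simp; positivity
    have h2 := Complex.Gamma_mul_Gamma_eq_betaIntegral hbr hzr
    have h3 : Complex.Gamma (z + 1 + (b / 2 : ℝ)) ≠ 0 :=
      Complex.Gamma_ne_zero_of_re_pos (by rw [Complex.add_re]; exact add_pos hzr hbr)
    rw [add_comm _ (z + 1)] at h2
    have h4 := mul_mellin_eq_neg_mellin_deriv hf (fun u hu => radialCutoff_eq_zero hu) h1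
    push_cast at h4
    rw [powCont_eq_powInt (by linarith), powInt_cutoff hp hq hγ (by linarith), hG]
    simp only [← h4, h2, ← hC, ← hbdef, ← hD]
    field_simp
  have hGc : ContinuousAt G (-(D / 2) : ℂ) := by
    refine ((continuousAt_const).mul ((continuousAt_const.mul ?_).mul
      hGi.continuous.continuousAt)).mul hMd.continuous.continuousAt
    -- A pole of `Γ(z + 1)` at `-D/2` would mean `D = 2 (m + 1)`, which `hd` excludes.
    refine ContinuousAt.comp (g := Complex.Gamma) (f := fun z => z + 1)
      (Complex.differentiableAt_Gamma _ fun m h => hd m ?_).continuousAt (by fun_prop)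
    have h' : -(D / 2) + 1 = -(m : ℝ) := by exact_mod_cast h
    linarith
  have hGv : G (-(D / 2) : ℂ) = C * (Real.Gamma (b / 2) * Real.Gamma (1 - D / 2) /
      Real.Gamma (1 - weightedDimFst γ / 2) : ℝ) := by
    have e1 : (-(D / 2) + 1 : ℂ) = ((1 - D / 2 : ℝ) : ℂ) := by push_cast; ring
    have e2 : (((1 - D / 2 : ℝ) : ℂ) + (b / 2 : ℝ)) = ((1 - weightedDimFst γ / 2 : ℝ) : ℂ) := by
      rw [hD, weightedDim_eq_add, ← hbdef]; push_cast; ring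
    have e3 : (-(D / 2) + D / 2 + 1 : ℂ) = 1 := by ring
    simp only [hG]
    rw [e3, mellin_deriv_one hf (fun u hu => radialCutoff_eq_zero hu)
      (fun u hu => radialCutoff_eq_one hu), e1, e2, Complex.Gamma_ofReal, Complex.Gamma_ofReal,
      Complex.Gamma_ofReal]
    push_cast
    ring
  rw [← hGv]
  exact (hGc.tendsto.mono_left nhdsWithin_le_nhds).congr' hev.symm

end Constant

/-! ### The functionals `L_B^k δ_γ` are nonzero. -/

section Nonvanishing

variable {ι : Type} [Fintype ι] [DecidableEq ι]

theorem besselOp_congr {f g : (ι → ℝ) → ℂ} {x : ι → ℝ} (h : f =ᶠ[𝓝 x] g) (c : ℝ) (i : ι) :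
    besselOp c i f x = besselOp c i g x := by
  have hs : (fun t : ℝ => f (Function.update x i t)) =ᶠ[𝓝 (x i)]
      fun t => g (Function.update x i t) := by
    have ht : Tendsto (fun t : ℝ => Function.update x i t) (𝓝 (x i)) (𝓝 x) := by
      have := (continuous_const.update i continuous_id : Continuous fun t : ℝ =>
        Function.update x i t).tendsto (x i)
      rwa [Function.update_eq_self] at this
    exact ht.eventually h
  unfold besselOp
  split_ifs with h0
  · rw [← h0, hs.iteratedDeriv_eq]
  · rw [hs.iteratedDeriv_eq, hs.deriv_eq]

theorem bUltraHyperbolic_congr {p q : ℕ} (γ : Fin p ⊕ Fin q → ℝ) {f g : (Fin p ⊕ Fin q → ℝ) → ℂ}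
    {x : Fin p ⊕ Fin q → ℝ} (h : f =ᶠ[𝓝 x] g) : bUltraHyperbolic γ f x = bUltraHyperbolic γ g x := by
  simp only [bUltraHyperbolic, besselOp_congr h]

theorem deriv_const_mul_ofReal_pow (c : ℂ) (n : ℕ) :
    deriv (fun t : ℝ => c * (t : ℂ) ^ (n + 1)) = fun t : ℝ => c * (n + 1) * (t : ℂ) ^ n := by
  ext t
  have h := (((hasDerivAt_pow (n + 1) (t : ℂ)).comp_ofReal).const_mul c).deriv
  rw [h]
  rw [Nat.add_sub_cancel]
  push_cast
  ring

theorem besselOp_coord_pow (a : ℝ) (i : ι) (c : ℂ) (k : ℕ) (x : ι → ℝ) :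
    besselOp a i (fun y => c * (y i : ℂ) ^ (2 * (k + 1))) x =
      c * ((2 * k + 2) * (2 * k + 1 + a)) * (x i : ℂ) ^ (2 * k) := by
  have h2 : iteratedDeriv 2 (fun t : ℝ => c * (t : ℂ) ^ (2 * (k + 1))) =
      fun t : ℝ => c * (2 * k + 2) * (2 * k + 1) * (t : ℂ) ^ (2 * k) := by
    rw [iteratedDeriv_succ, iteratedDeriv_one, show 2 * (k + 1) = 2 * k + 1 + 1 by ring,
      deriv_const_mul_ofReal_pow, deriv_const_mul_ofReal_pow]
    ext t; push_cast; ring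
  simp only [besselOp, Function.update_self, h2]
  split_ifs with h0
  · rw [h0]
    rcases Nat.eq_zero_or_pos k with rfl | hk
    · simp; ring
    · rw [Complex.ofReal_zero, zero_pow (by omega)]; simp
  · rw [show 2 * (k + 1) = 2 * k + 1 + 1 by ring, deriv_const_mul_ofReal_pow]
    have hx : (x i : ℂ) ≠ 0 := by exact_mod_cast h0
    push_cast
    field_simp
    ring

theorem besselOp_coord_pow_of_ne (a : ℝ) {i j : ι} (hij : i ≠ j) (c : ℂ) (k : ℕ) (x : ι → ℝ) :
    besselOp a j (fun y => c * (y i : ℂ) ^ k) x = 0 := by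
  simp only [besselOp, Function.update_of_ne hij]
  split_ifs <;> simp [iteratedDeriv_const]

variable {p q : ℕ} {γ : Fin p ⊕ Fin q → ℝ}

open EvenTestFunction

/-- On `c x_i^(2k+2)` only the Bessel operator in `x_i` survives; it lowers the degree by two and
multiplies `c` by the positive number `(2k+2)(2k+1+γ_i)`. Only the germ at the origin matters, so a
monomial times a cutoff qualifies. -/
theorem ultraHyperbolic_pow_apply_zero_ne_zero (hγ : ∀ i, 0 < γ i) (i : Fin p) (k : ℕ) :
    ∀ (φ : EvenTestFunction (Fin p ⊕ Fin q)) {c : ℂ}, c ≠ 0 →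
      (φ : (Fin p ⊕ Fin q → ℝ) → ℂ) =ᶠ[𝓝 0] (fun x => c * (x (Sum.inl i) : ℂ) ^ (2 * k)) →
      (ultraHyperbolic γ ^ k) φ 0 ≠ 0 := by
  induction k with
  | zero =>
    intro φ c hc h
    rw [pow_zero, Module.End.one_apply, h.self_of_nhds]
    simpa using hc
  | succ k ih =>
    intro φ c hc h
    rw [pow_succ, Module.End.mul_apply]
    refine ih _ (c := c * ((2 * k + 2) * (2 * k + 1 + γ (Sum.inl i)))) (mul_ne_zero hc ?_) ?_
    · have h1 : (0 : ℝ) < (2 * k + 2) * (2 * k + 1 + γ (Sum.inl i)) :=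
        mul_pos (by positivity) (add_pos (by positivity) (hγ _))
      exact_mod_cast h1.ne'
    · rw [coe_ultraHyperbolic]
      filter_upwards [h.eventually_nhds] with x hx
      rw [bUltraHyperbolic_congr γ hx, bUltraHyperbolic, Finset.sum_eq_single i, besselOp_coord_pow,
        Finset.sum_eq_zero, sub_zero]
      · exact fun j _ => besselOp_coord_pow_of_ne _ Sum.inl_ne_inr _ _ _
      · exact fun j _ hj => besselOp_coord_pow_of_ne _ (fun h => hj (Sum.inl_injective h).symm) _ _ _
      · exact fun h => absurd (Finset.mem_univ i) h

theorem exists_iterLBDelta_ne_zero (hp : 0 < p) (hγ : ∀ i, 0 < γ i) (k : ℕ) :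
    ∃ φ : EvenTestFunction (Fin p ⊕ Fin q), iterLBDelta γ k φ ≠ 0 := by
  set i₀ : Fin p := ⟨0, hp⟩
  have hk : ContDiff ℝ ∞ fun x : Fin p ⊕ Fin q → ℝ => (x (Sum.inl i₀) : ℂ) ^ (2 * k) :=
    (Complex.ofRealCLM.contDiff.comp (contDiff_apply _ _ _)).pow _
  have hk' : ∀ i, HasParity i 1 fun x : Fin p ⊕ Fin q → ℝ => (x (Sum.inl i₀) : ℂ) ^ (2 * k) := by
    intro i x
    by_cases h : Sum.inl i₀ = i
    · subst h; simp [pow_mul]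
    · simp [Function.update_of_ne h]
  refine ⟨mulEven _ hk hk' cutoff, ?_⟩
  rw [iterLBDelta_eq]
  refine ultraHyperbolic_pow_apply_zero_ne_zero hγ i₀ k _ one_ne_zero ?_
  filter_upwards [eventually_cutoff_eq_one] with x hx
  rw [mulEven_apply, hx]; ring

end Nonvanishing

/-! ### Gamma function identities for the constants. -/

section Constants

variable {p q : ℕ} {γ : Fin p ⊕ Fin q → ℝ}

theorem NonIntegerOrOdd.ne_even {a : ℝ} (h : NonIntegerOrOdd a) (m : ℤ) : a ≠ 2 * m := by
  rintro rfl
  rcases h with h | ⟨k, hk, h⟩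
  · exact h (2 * m) (by push_cast; rfl)
  · have h' : 2 * m = k := by exact_mod_cast h
    rw [← h'] at hk
    exact Int.not_odd_iff_even.2 (even_two_mul m) hk

theorem radialConst_mul_radialConst (γ : Fin p ⊕ Fin q → ℝ) :
    radialConst (fun i => γ (Sum.inl i)) * radialConst (fun j => γ (Sum.inr j)) =
      (∏ i, Real.Gamma ((γ i + 1) / 2)) /
        (2 ^ (p + q) * (Real.Gamma (weightedDimFst γ / 2) * Real.Gamma (weightedDimSnd γ / 2))) := by
  have h1 : homDim (fun i => γ (Sum.inl i)) = weightedDimFst γ := by simp [homDim, weightedDimFst]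
  have h2 : homDim (fun j => γ (Sum.inr j)) = weightedDimSnd γ := by simp [homDim, weightedDimSnd]
  rw [radialConst, radialConst, h1, h2, Fintype.prod_sum_type, div_mul_div_comm, Fintype.card_fin,
    Fintype.card_fin, pow_add]
  congr 1
  ring

/-- Reversing the order of the product turns the factors into `-(d/2 + i)` and `-(i + 1)`; the signs
cancel in pairs, leaving a Gamma quotient and a factorial. -/
theorem contFactor_shift {d : ℝ} (hd : 0 < d) (k : ℕ) :
    contFactor d k (-(d / 2) - k) =
      (4 ^ k * (k.factorial : ℝ) * Real.Gamma (d / 2 + k) / Real.Gamma (d / 2) : ℝ) := by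
  have h1 : contFactor d k (-(d / 2) - k) =
      ((∏ i ∈ Finset.range k, 4 * (d / 2 + i) * (i + 1) : ℝ) : ℂ) := by
    rw [contFactor, ← Finset.prod_range_reflect, Complex.ofReal_prod]
    refine Finset.prod_congr rfl fun i hi => ?_
    have hik : i + 1 ≤ k := Finset.mem_range.1 hi
    obtain ⟨j, rfl⟩ := Nat.exists_eq_add_of_le hik
    rw [show i + 1 + j - 1 - i = j by omega]
    push_cast
    ring
  rw [h1]
  congr 1
  have hG : Real.Gamma (d / 2) ≠ 0 := (Real.Gamma_pos_of_pos (by positivity)).ne'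
  induction k with
  | zero => simp [hG]
  | succ k ih =>
    have h2 : d / 2 + k ≠ 0 := by positivity
    rw [Finset.prod_range_succ, ih, Nat.factorial_succ, Nat.cast_succ, ← add_assoc,
      Real.Gamma_add_one h2]
    · rw [pow_succ]
      push_cast
      field_simp
    · rw [contFactor, ← Finset.prod_range_reflect, Complex.ofReal_prod]
      refine Finset.prod_congr rfl fun i hi => ?_
      have hik : i + 1 ≤ k := Finset.mem_range.1 hi
      obtain ⟨j, rfl⟩ := Nat.exists_eq_add_of_le hik
      rw [show i + 1 + j - 1 - i = j by omega]
      push_cast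
      ring

theorem Gamma_one_sub_eq_zero_of_even {a : ℝ} (ha : 0 < a) {m : ℤ} (hm : Even m) (h : a = m) :
    Real.Gamma (1 - a / 2) = 0 := by
  obtain ⟨j, rfl⟩ := hm
  subst h
  have hj : 1 ≤ j := by
    have : (0 : ℤ) < j + j := by exact_mod_cast ha
    omega
  obtain ⟨n, rfl⟩ := Int.le.dest hj
  rw [show (1 - ((1 + (n : ℤ) + (1 + n) : ℤ) : ℝ) / 2) = -(n : ℝ) by push_cast; ring]
  exact Real.Gamma_neg_nat_eq_zero n

/-- Reflection formula at `a/2` and at `a/2 + m`: the two sines differ by `(-1)^m`, and they are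
nonzero because `a` is not an even integer. -/
theorem Gamma_quotient_of_add_even {a : ℝ} (ha : NonIntegerOrOdd a) (m : ℕ) :
    Real.Gamma (1 - (a + 2 * m) / 2) / (Real.Gamma (a / 2) * Real.Gamma (1 - a / 2)) =
      (-1) ^ m / Real.Gamma ((a + 2 * m) / 2) := by
  have h1 := Real.Gamma_mul_Gamma_one_sub (a / 2)
  have h2 := Real.Gamma_mul_Gamma_one_sub ((a + 2 * m) / 2)
  have hs : Real.sin (Real.pi * (a / 2)) ≠ 0 := by
    rw [Ne, Real.sin_eq_zero_iff]
    rintro ⟨n, hn⟩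
    refine ha.ne_even n ?_
    have := mul_left_cancel₀ Real.pi_ne_zero ((mul_comm _ _).trans hn)
    linarith
  have h3 : Real.sin (Real.pi * ((a + 2 * m) / 2)) = (-1) ^ m * Real.sin (Real.pi * (a / 2)) := by
    rw [show Real.pi * ((a + 2 * m) / 2) = Real.pi * (a / 2) + m * Real.pi by ring,
      Real.sin_add_nat_mul_pi]
  rw [h3] at h2
  have hne : Real.Gamma ((a + 2 * m) / 2) ≠ 0 := by
    intro h
    rw [h, zero_mul] at h2
    exact div_ne_zero Real.pi_ne_zero (mul_ne_zero (pow_ne_zero _ (by norm_num)) hs) h2.symm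
  have h4 : Real.Gamma (1 - (a + 2 * m) / 2) =
      Real.pi / ((-1) ^ m * Real.sin (Real.pi * (a / 2))) / Real.Gamma ((a + 2 * m) / 2) := by
    rw [← h2, mul_div_cancel_left₀ _ hne]
  have h5 : ((-1 : ℝ) ^ m) * (-1) ^ m = 1 := by rw [← mul_pow]; simp
  have h6 : (-1 : ℝ) ^ m ≠ 0 := pow_ne_zero _ (by norm_num)
  have hpi := Real.pi_ne_zero
  rw [h1, h4]
  set s := Real.sin (Real.pi * (a / 2))
  field_simp
  rw [sq, h5]

end Constants

/-! ### The theorem. -/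

theorem theorem2 (p q : ℕ) (hp : 1 < p) (hq : 1 < q) (γ : Fin p ⊕ Fin q → ℝ)
    (hγ : ∀ i, 0 < γ i) (hn : NonIntegerOrOdd (weightedDim γ)) :
    (∃ P : ℂ → EvenTestFunction (Fin p ⊕ Fin q) → ℂ, IsPowerContinuation γ P) ∧
    ∀ P : ℂ → EvenTestFunction (Fin p ⊕ Fin q) → ℂ, IsPowerContinuation γ P →
      (∀ m : ℕ, NonIntegerOrOdd (weightedDimFst γ) → weightedDimSnd γ = 2 * (m : ℝ) →
        ∀ k : ℕ, HasSimplePoleWithResidue P ((-(weightedDim γ / 2) - k : ℝ) : ℂ)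
          (fun φ =>
            (((-1) ^ m / (2 ^ (p + q + 2 * k) * (k.factorial : ℝ)) *
              ((∏ i, Real.Gamma ((γ i + 1) / 2)) / Real.Gamma (weightedDim γ / 2 + k)) : ℝ) : ℂ) *
              iterLBDelta γ k φ)) ∧
      ((∃ m : ℤ, Even m ∧ weightedDimFst γ = m) →
        ∀ k : ℕ, IsRegularPoint P ((-(weightedDim γ / 2) - k : ℝ) : ℂ)) := by
  have hp0 : 0 < p := by omega
  have hq0 : 0 < q := by omega
  have hd : ∀ j : ℕ, weightedDim γ ≠ 2 * (j + 1) := fun j => by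
    have := hn.ne_even (j + 1)
    push_cast at this
    exact this
  have hD0 : 0 < weightedDim γ := weightedDim_pos hp0 hγ
  have ha0 : 0 < weightedDimFst γ := lt_of_lt_of_le one_pos (one_le_weightedDimFst hp0 hγ)
  have hb0 : 0 < weightedDimSnd γ := lt_of_lt_of_le one_pos (one_le_weightedDimSnd hq0 hγ)
  obtain ⟨c, hc⟩ := exists_residue_eq_mul_apply_zero hp0 hq0 hγ hd
  -- The cutoff takes the value one at the origin, so comparing the two limits determines `c`.
  have hcv := tendsto_nhds_unique (hc EvenTestFunction.cutoff) (tendsto_powCont_cutoff hp0 hq0 hγ hd)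
  rw [EvenTestFunction.cutoff_zero, mul_one, radialConst_mul_radialConst] at hcv
  refine ⟨⟨_, isPowerContinuation_powCont hp0 hq0 hγ⟩, fun P hP => ⟨fun m ha hb k => ⟨?_, fun φ => ?_⟩,
    fun ⟨m, hm, ha⟩ k => ?_⟩⟩
  · obtain ⟨φ, hφ⟩ := exists_iterLBDelta_ne_zero (q := q) hp0 hγ k
    refine ⟨φ, mul_ne_zero (Complex.ofReal_ne_zero.2 (mul_ne_zero ?_ (div_ne_zero ?_ ?_))) hφ⟩
    · exact div_ne_zero (pow_ne_zero _ (by norm_num)) (by positivity)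
    · exact Finset.prod_ne_zero_iff.2 fun i _ =>
        (Real.Gamma_pos_of_pos (div_pos (add_pos (hγ i) one_pos) two_pos)).ne'
    · exact (Real.Gamma_pos_of_pos (by positivity)).ne'
  · have h1 := tendsto_powCont_shift hp0 hq0 hγ hc k φ
    rw [contFactor_shift hD0] at h1
    have e : ((-(weightedDim γ / 2) - k : ℝ) : ℂ) = -(weightedDim γ / 2) - k := by push_cast; ring
    rw [e]
    have hq' := Gamma_quotient_of_add_even ha m
    rw [← hb, ← EvenTestFunction.weightedDim_eq_add] at hq'
    have g1 := (Real.Gamma_pos_of_pos (half_pos hD0)).ne'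
    have g2 := (Real.Gamma_pos_of_pos (half_pos hb0)).ne'
    have g3 : Real.Gamma (weightedDim γ / 2 + k) ≠ 0 := (Real.Gamma_pos_of_pos (by positivity)).ne'
    have g4 : (k.factorial : ℝ) ≠ 0 := by positivity
    have hconst : (-1) ^ m / (2 ^ (p + q + 2 * k) * (k.factorial : ℝ)) *
        ((∏ i, Real.Gamma ((γ i + 1) / 2)) / Real.Gamma (weightedDim γ / 2 + k)) =
        (∏ i, Real.Gamma ((γ i + 1) / 2)) / (2 ^ (p + q) *
          (Real.Gamma (weightedDimFst γ / 2) * Real.Gamma (weightedDimSnd γ / 2))) *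
          (Real.Gamma (weightedDimSnd γ / 2) * Real.Gamma (1 - weightedDim γ / 2) /
            Real.Gamma (1 - weightedDimFst γ / 2)) /
          (4 ^ k * (k.factorial : ℝ) * Real.Gamma (weightedDim γ / 2 + k) /
            Real.Gamma (weightedDim γ / 2)) := by
      calc _ = (∏ i, Real.Gamma ((γ i + 1) / 2)) / 2 ^ (p + q) *
            ((-1) ^ m / Real.Gamma (weightedDim γ / 2)) /
            (4 ^ k * (k.factorial : ℝ) * Real.Gamma (weightedDim γ / 2 + k) /
              Real.Gamma (weightedDim γ / 2)) := by
            rw [pow_add _ (p + q), pow_mul, show (2 : ℝ) ^ 2 = 4 by norm_num]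
            field_simp
        _ = _ := by
            rw [← hq']
            congr 1
            field_simp
    rw [hconst, Complex.ofReal_div, Complex.ofReal_mul, ← hcv]
    beta_reduce
    rw [div_mul_eq_mul_div]
    refine h1.congr' ?_
    filter_upwards [hP.eventuallyEq_powCont hp0 hq0 hγ (-(weightedDim γ / 2) - k) φ] with z hz
    rw [hz]
  -- `Real.Gamma` has the value `0` at its poles, and division by zero gives `0`; this agrees with
  -- the entire function `1/Γ`, which vanishes there.
  · have hc0 : c = 0 := by
      rw [hcv, Gamma_one_sub_eq_zero_of_even ha0 hm ha]; simp
    have e : ((-(weightedDim γ / 2) - k : ℝ) : ℂ) = -(weightedDim γ / 2) - k := by push_cast; ring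
    rw [e]
    obtain ⟨u, hu, hlim⟩ := isRegularPoint_powCont hp0 hq0 hγ hd k fun φ => by
      have := tendsto_powCont_shift hp0 hq0 hγ hc k φ
      rwa [hc0, zero_mul, zero_div] at this
    refine ⟨u, hu, fun φ => (hlim φ).congr' ?_⟩
    exact (hP.eventuallyEq_powCont hp0 hq0 hγ _ φ).symm
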